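/- **Model.** Let $d\ge 1$. For each vertex $x\in\mathbb Z^d$ let deaths arrive on the line $\{x\}\times\mathbb R$ as a Poisson process of rate $\kappa^{-1}\delta_x$, and for each nearest-neighbour edge $u=x+\tfrac12 e_i$ (joining $x$ and $x+e_i$, $1\le i\le d$) let bonds arrive on $\{u\}\times\mathbb R$ as a Poisson process of rate $\kappa\lambda_u$, all processes being independent; let $P=P_{\kappa,\delta,\lambda}$ be their joint law. Delete from $\mathbb Z^d\times\mathbb R$ every death, and identify $(x,t)$ with $(x+e_i,t)$ whenever there is a bond at $(x+\tfrac12e_i,t)$. Write $(x,t)\leftrightarrow(y,s)$ if both points survive and lie in the same connected component of the resulting quotient space. **Environment.** For $i=0,\dots,d$ let $\nu_i\in\mathbb N$, $\mathbf M_i\in\mathbb R^{\nu_i\times d}$ and $h_i:\mathbb T^{\nu_i}\to[0,\infty)$, where $\mathbb T=\mathbb R/\mathbb Z$. For phases $\theta=(\theta_0,\dots,\theta_d)\in\mathbb T^{\nu_0}\times\cdots\times\mathbb T^{\nu_d}$ put $$\delta_x=h_0(\theta_0+\mathbf M_0x),\qquad \lambda_{x+\frac12e_i}=\frac1{h_i(\theta_i+\mathbf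 M_ix)}\quad(1\le i\le d).$$ Let $\nu,\zeta,\sigma>0$. The environment process $(\mathbb T^{\nu_i},\mathbf M_i,h_i)_{i=0}^d$ is *$(\nu,\zeta,\sigma)$-regular* if for every $i$: 1. $\nu\le\nu_i$; 2. $\mathbf M_i$ is $\zeta$-Diophantine: there is $c>0$ with $\operatorname{dist}(\mathbf M_ix+\vartheta,\vartheta)\ge c\,\|x\|_1^{-\zeta}$ for all $x\in\mathbb Z^d\setminus\{0\}$ and $\vartheta\in\mathbb T^{\nu_i}$; 3. $h_i$ is continuous and nonnegative, has finitely many zeros, and is $\sigma$-admissible: for every zero $\vartheta$ of $h_i$, $$\limsup_{\epsilon\to0}\ \sup_{0<\operatorname{dist}(\vartheta',\vartheta)<\epsilon}\frac{|\log h_i(\vartheta')|}{|\log \operatorname{dist}(\vartheta',\vartheta)|}<\sigma .$$ Let $R=\max\{2,\sum_{i=0}^d|h_i^{-1}(0)|\}$. **Theorem.** There is an absolute constant $C>0$ such that the following holds. Suppose that the environment process is $(\nu,\zeta,\sigma)$-regular and let $\mu>0$. Then there is $\kappa_0>0$ such that for Lebesgue-almost every phase $\theta$, for every $\kappa\in(0,\kappa_0]$,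 every $$0<\tau<\frac{C}{1+R^2\sigma\max\{d/\nu,\zeta\}}$$ and every $x\in\mathbb Z^d$ there is a finite constant $C_x$ (which may depend on $\theta,\kappa,\tau$ as well) such that for all $t,s\in\mathbb R$ and $y\in\mathbb Z^d$ $$P[(x,t)\leftrightarrow(y,s)]<C_x\exp\left(-\mu\max\{\|y-x\|_1,|s-t|^\tau\}\right).$$ -/

import Mathlib

open MeasureTheory ProbabilityTheory Filter Topology
open scoped ENNReal

noncomputable section

namespace QPPerc

/-! ### The lattice and the space on which the Poisson processes live -/

/-- The vertices `ℤ^d`. -/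
abbrev Vertex (d : ℕ) : Type := Fin d → ℤ

/-- The nearest-neighbour edges: `(x, i)` stands for the edge joining `x` and `x + e_i`,
that is, the one with midpoint `x + e_i / 2`. -/
abbrev Edge (d : ℕ) : Type := Vertex d × Fin d

/-- The disjoint union of the vertices and the edges. -/
abbrev Graph (d : ℕ) : Type := Vertex d ⊕ Edge d

/-- One copy of the real line for each vertex and each edge. -/
abbrev Lines (d : ℕ) : Type := Graph d × ℝ

/-- The `ℓ¹` norm on `ℤ^d`. -/
def l1 {d : ℕ} (x : Vertex d) : ℝ := ∑ i, |(x i : ℝ)|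

/-! ### Configurations and their law -/

/-- Locally finite subsets of the union of the lines. -/
def Config (d : ℕ) : Type :=
  {ω : Set (Lines d) // ∀ (w : Graph d) (a b : ℝ), {t | (w, t) ∈ ω ∧ a ≤ t ∧ t ≤ b}.Finite}

/-- The number of points of a configuration in a set. -/
def Config.count {d : ℕ} (B : Set (Lines d)) (ω : Config d) : ℕ∞ := (ω.1 ∩ B).encard

/-- The σ-algebra generated by the numbers of points in measurable sets. -/
instance Config.instMeasurableSpace (d : ℕ) : MeasurableSpace (Config d) :=
  ⨆ B : {B : Set (Lines d) // MeasurableSet B}, MeasurableSpace.comap (Config.count B.1) inferInstance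

/-- The measure on the lines which is `rate w` times Lebesgue measure on the line of `w`. -/
def intensity {d : ℕ} (rate : Graph d → ℝ) : Measure (Lines d) :=
  Measure.sum fun w => ENNReal.ofReal (rate w) • (volume : Measure ℝ).map (Prod.mk w)

/-- `P` is the law of independent Poisson processes on the lines, with rate `rate w` on the line
of `w`; in other words of the Poisson process on the union of the lines with the above
intensity: the number of points in a set of finite intensity is Poisson distributed with mean the
intensity of the set, and the numbers of points in disjoint sets are independent. -/
structure IsPoissonLaw {d : ℕ} (rate : Graph d → ℝ) (P : Measure (Config d)) : Prop where
  isProbabilityMeasure : IsProbabilityMeasure P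
  poisson : ∀ B : Set (Lines d), MeasurableSet B → intensity rate B < ∞ → ∀ n : ℕ,
    P {ω | Config.count B ω = n} =
      ENNReal.ofReal (Real.exp (-(intensity rate B).toReal) *
        (intensity rate B).toReal ^ n / n.factorial)
  indep : ∀ (m : ℕ) (B : Fin m → Set (Lines d)), (∀ j, MeasurableSet (B j)) →
    Pairwise (fun j k => Disjoint (B j) (B k)) →
    iIndepFun (fun j => Config.count (B j)) P

/-! ### Percolation -/

/-- The vertex lines with the deaths removed, as a subspace of `ℤ^d × ℝ`. -/
abbrev Config.Alive {d : ℕ} (ω : Config d) : Type :=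
  {X : Vertex d × ℝ // (Sum.inl X.1, X.2) ∉ ω.1}

/-- `X = (x, t)` and `Y = (x + e_i, t)` where there is a bond at time `t` on the edge joining `x`
and `x + e_i`. -/
def Config.Bond {d : ℕ} (ω : Config d) (X Y : ω.Alive) : Prop :=
  ∃ i : Fin d, Y.1.1 = X.1.1 + Pi.single i 1 ∧ Y.1.2 = X.1.2 ∧
    (Sum.inr (X.1.1, i), X.1.2) ∈ ω.1

/-- The topological space obtained by deleting the deaths and identifying the two end points of
every bond, with the quotient topology. -/
abbrev Config.Space {d : ℕ} (ω : Config d) : Type := Quot ω.Bond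

/-- `X` and `Y` are not deaths and lie in the same connected component. -/
def Config.Connects {d : ℕ} (ω : Config d) (X Y : Vertex d × ℝ) : Prop :=
  ∃ (hX : (Sum.inl X.1, X.2) ∉ ω.1) (hY : (Sum.inl Y.1, Y.2) ∉ ω.1),
    (Quot.mk _ ⟨Y, hY⟩ : ω.Space) ∈ connectedComponent (Quot.mk _ ⟨X, hX⟩ : ω.Space)

/-! ### Quasiperiodic environments -/

/-- The `n`-dimensional torus `(ℝ/ℤ)^n`. -/
abbrev Torus (n : ℕ) : Type := Fin n → UnitAddCircle

/-- The point `M x` of the torus. -/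
def shift {n d : ℕ} (M : Matrix (Fin n) (Fin d) ℝ) (x : Vertex d) : Torus n :=
  fun j => ((M.mulVec (fun i => (x i : ℝ)) j : ℝ) : UnitAddCircle)

/-- `ζ`-Diophantine matrices. -/
def IsDiophantine {n d : ℕ} (ζ : ℝ) (M : Matrix (Fin n) (Fin d) ℝ) : Prop :=
  ∃ c : ℝ, 0 < c ∧ ∀ x : Vertex d, x ≠ 0 → ∀ θ : Torus n,
    c / l1 x ^ ζ ≤ dist (shift M x + θ) θ

/-- Nonnegative continuous functions with finitely many zeros. -/
def IsSampling {n : ℕ} (h : Torus n → ℝ) : Prop :=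
  Continuous h ∧ (∀ θ, 0 ≤ h θ) ∧ {θ | h θ = 0}.Finite

/-- `σ`-admissible functions. The upper limit is taken in `[0, ∞]`, and the supremum over
`θ' ≠ θ`, where the quotient is meaningful. -/
def IsAdmissible {n : ℕ} (σ : ℝ) (h : Torus n → ℝ) : Prop :=
  ∀ θ, h θ = 0 →
    limsup (fun ε : ℝ => ⨆ (θ' : Torus n) (_ : θ' ≠ θ) (_ : dist θ' θ < ε),
      ENNReal.ofReal (|Real.log (h θ')| / |Real.log (dist θ' θ)|)) (𝓝[>] (0 : ℝ))
      < ENNReal.ofReal σ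

/-- The data of an environment process: tori, shifts and sampling functions. The index `0` is for
the vertices, the index `i + 1` for the edges in direction `e_i` (`i = 0, …, d - 1`). -/
structure Environment (d : ℕ) where
  dim : Fin (d + 1) → ℕ
  mat : ∀ i, Matrix (Fin (dim i)) (Fin d) ℝ
  h : ∀ i, Torus (dim i) → ℝ

namespace Environment

variable {d : ℕ} (E : Environment d)

/-- `(ν, ζ, σ)`-regular environment processes. -/
structure IsRegular (ν ζ σ : ℝ) : Prop where
  le_dim : ∀ i, ν ≤ E.dim i
  diophantine : ∀ i, IsDiophantine ζ (E.mat i)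
  sampling : ∀ i, IsSampling (E.h i)
  admissible : ∀ i, IsAdmissible σ (E.h i)

/-- `R`, the larger of `2` and the total number of zeros of the sampling functions. -/
def numZeros : ℕ := max 2 (∑ i, {θ | E.h i θ = 0}.ncard)

/-- The initial phases. -/
abbrev Phase : Type := ∀ i, Torus (E.dim i)

/-- The field `δ`. -/
def death (θ : E.Phase) (x : Vertex d) : ℝ := E.h 0 (θ 0 + shift (E.mat 0) x)

/-- The field `λ`. -/
def bond (θ : E.Phase) (u : Edge d) : ℝ :=
  1 / E.h u.2.succ (θ u.2.succ + shift (E.mat u.2.succ) u.1)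

/-- Deaths have rate `κ⁻¹ δ`, bonds have rate `κ λ`. -/
def rate (κ : ℝ) (θ : E.Phase) : Graph d → ℝ
  | Sum.inl x => κ⁻¹ * E.death θ x
  | Sum.inr u => κ * E.bond θ u

end Environment

end QPPerc

end

noncomputable section

namespace QPPerc

/-! ### Finite families of independent edges -/

section Bernoulli

variable {ι : Type*}

/-! Small `κ` makes deaths frequent and bonds rare, except where the environment is bad. Badness is
measured by g(x) = `Environment.quality`: deaths at x have rate at least g(x)/κ and bonds at x have
rate at most κ/g(x). A multiscale analysis shows that small values of g are rare enough to outweigh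
the long time it takes to block them.

Environment. A small value of a sampling function forces the orbit close to a zero
(`IsAdmissible.exists_dist_rpow_le`), and the Diophantine condition keeps visits to the same zero
apart. With N = 2R and scales y_{k+1} = y_k^(2(N+1)), every ball of radius y_k^5 therefore contains
at most N vertices with g < y_k^(-β) (`IsRegular.eventually_isSeparated`). This holds for all phases
at once, which is why κ₀ does not depend on θ. The phase matters only for the Borel–Cantelli bound
that g decays at most like a power 2σd/ν of the distance (`IsRegular.ae_exists_le_quality`).

Percolation. Cutting time into cells of length 1/M gives independent edges, for which the van den
Berg–Kesten inequality (`prob_disjointOcc_le`) and Harris' inequality (`prob_mul_le_and`) are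
available. Decay over the vertices with g ≥ y_k^(-β) is proved by induction on k (`IsLarge.decays`),
with spatial rate m + 2^(-k) and correlation time y_k^(β(12N+1)). By `prob_cellConn_le_exp` it
suffices that leaving a box is unlikely (`IsLarge.decays_succ`). Sideways, the box meets at most N
bad lines of level k; each of them squares the prefactor but keeps the spatial rate
(`prob_cellConn_add_lines`), and a small loss of rate over the radius y_k^4 pays for this. In time,
a connection must cross many disjoint slabs, each blocked with probability at least y_{k+1}^(-6Nβ)/2
(`IsLarge.prob_slabCrossed_le`). Blocking uses a set V containing the bad vertices of level k in the
ball and all lower bad vertices near its elements (`IsSeparated.exists_blocking`): all lines of V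
die almost simultaneously, without bonds around them, and excursions off V are short
(`IsLarge.prob_excursion_le`). These events are decreasing, so Harris' inequality multiplies their
probabilities.

Conclusion. Put ℓ = max(‖y - x‖₁, |s - t|^τ) and take a ball around x of radius L = ⌈ℓ⌉. All its
vertices are good at a level whose correlation time is O(L^q) with q of order R²σd/ν; the exponent β
cancels here, and ζ with it. A connection either stays in the ball and pays for its distance in
space and time, or leaves the ball and pays exp(-(μ+2)L), up to lower-order factors. The time part
is sufficient as soon as q + 2 ≤ 1/τ, which is what the condition on τ provides (`exponent_bound`).
-/

open Classical in
/-- Expectation of `f` of the random set which contains each `e ∈ F` independently with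
probability `p e`. -/
def expect (F : Finset ι) (p : ι → ℝ) (f : Set ι → ℝ) : ℝ :=
  ∑ S ∈ F.powerset, ((∏ e ∈ S, p e) * ∏ e ∈ F \ S, (1 - p e)) * f (S : Set ι)

open Classical in
/-- Probability of the event `A`. -/
def prob (F : Finset ι) (p : ι → ℝ) (A : Set ι → Prop) : ℝ :=
  expect F p fun S => if A S then 1 else 0

variable {F : Finset ι} {p : ι → ℝ}

open Classical in
lemma expect_insert {e : ι} (he : e ∉ F) (f : Set ι → ℝ) :
    expect (insert e F) p f =
      p e * expect F p (fun S => f (insert e S)) + (1 - p e) * expect F p f := by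
  unfold expect
  rw [Finset.sum_powerset_insert he, add_comm, Finset.mul_sum, Finset.mul_sum]
  congr 1
  · refine Finset.sum_congr rfl fun S hS => ?_
    have hS' : S ⊆ F := Finset.mem_powerset.1 hS
    have h1 : e ∉ S := fun h => he (hS' h)
    rw [Finset.prod_insert h1, Finset.insert_sdiff_insert, Finset.coe_insert,
      Finset.sdiff_insert_of_notMem he]
    ring
  · refine Finset.sum_congr rfl fun S hS => ?_
    have hS' : S ⊆ F := Finset.mem_powerset.1 hS
    have h1 : e ∉ S := fun h => he (hS' h)
    rw [Finset.insert_sdiff_of_notMem _ h1, Finset.prod_insert (by simp [he])]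
    ring

lemma expect_mono (hp : ∀ e, 0 ≤ p e ∧ p e ≤ 1) {f g : Set ι → ℝ}
    (h : ∀ S : Set ι, S ⊆ F → f S ≤ g S) : expect F p f ≤ expect F p g := by
  classical
  refine Finset.sum_le_sum fun S hS => mul_le_mul_of_nonneg_left
    (h _ (by exact_mod_cast Finset.mem_powerset.1 hS)) ?_
  exact mul_nonneg (Finset.prod_nonneg fun e _ => (hp e).1)
    (Finset.prod_nonneg fun e _ => sub_nonneg.2 (hp e).2)

lemma expect_add (f g : Set ι → ℝ) :
    expect F p (fun S => f S + g S) = expect F p f + expect F p g := by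
  simp [expect, mul_add, Finset.sum_add_distrib]

lemma expect_const_mul (c : ℝ) (f : Set ι → ℝ) :
    expect F p (fun S => c * f S) = c * expect F p f := by
  simp only [expect, Finset.mul_sum]
  exact Finset.sum_congr rfl fun S _ => by ring

lemma expect_const (c : ℝ) : expect F p (fun _ => c) = c := by
  classical
  induction F using Finset.induction_on with
  | empty => simp [expect]
  | insert e F he ih => rw [expect_insert he, ih]; ring

lemma expect_nonneg (hp : ∀ e, 0 ≤ p e ∧ p e ≤ 1) {f : Set ι → ℝ} (h : ∀ S, 0 ≤ f S) :
    0 ≤ expect F p f := by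
  rw [← expect_const (F := F) (p := p) 0]
  exact expect_mono hp fun S _ => h S

lemma prob_nonneg (hp : ∀ e, 0 ≤ p e ∧ p e ≤ 1) (A : Set ι → Prop) : 0 ≤ prob F p A :=
  expect_nonneg hp fun S => by split_ifs <;> norm_num

lemma prob_le_one (hp : ∀ e, 0 ≤ p e ∧ p e ≤ 1) (A : Set ι → Prop) : prob F p A ≤ 1 := by
  rw [← expect_const (F := F) (p := p) 1]
  exact expect_mono hp fun S _ => by split_ifs <;> norm_num

lemma prob_mono (hp : ∀ e, 0 ≤ p e ∧ p e ≤ 1) {A B : Set ι → Prop}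
    (h : ∀ S : Set ι, S ⊆ F → A S → B S) : prob F p A ≤ prob F p B := by
  refine expect_mono hp fun S hS => ?_
  by_cases hA : A S
  · simp [hA, h S hS hA]
  · simp only [hA, if_false]; split_ifs <;> norm_num

lemma prob_false {A : Set ι → Prop} (h : ∀ S : Set ι, S ⊆ F → ¬ A S) : prob F p A = 0 := by
  classical
  refine Finset.sum_eq_zero fun S hS => ?_
  have : ¬ A S := h _ (by exact_mod_cast Finset.mem_powerset.1 hS)
  simp [this]

lemma prob_not (A : Set ι → Prop) : prob F p (fun S => ¬ A S) = 1 - prob F p A := by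
  rw [eq_sub_iff_add_eq, prob, prob, ← expect_add]
  rw [← expect_const (F := F) (p := p) 1]
  congr 1; funext S; rw [expect_const]; by_cases h : A S <;> simp [h]

lemma prob_or_le (hp : ∀ e, 0 ≤ p e ∧ p e ≤ 1) (A B : Set ι → Prop) :
    prob F p (fun S => A S ∨ B S) ≤ prob F p A + prob F p B := by
  rw [prob, prob, prob, ← expect_add]
  refine expect_mono hp fun S _ => ?_
  by_cases hA : A S <;> by_cases hB : B S <;> simp [hA, hB]

lemma prob_exists_le (hp : ∀ e, 0 ≤ p e ∧ p e ≤ 1) {κ : Type*} (s : Finset κ)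
    (A : κ → Set ι → Prop) :
    prob F p (fun S => ∃ k ∈ s, A k S) ≤ ∑ k ∈ s, prob F p (A k) := by
  classical
  induction s using Finset.induction_on with
  | empty => simp [prob_false]
  | insert k s hk ih =>
    rw [Finset.sum_insert hk]
    refine le_trans ?_ ((prob_or_le hp _ _).trans (add_le_add_right ih _))
    exact prob_mono hp fun S _ h => by simpa using h

/-- The event that `A` and `B` occur disjointly. -/
def DisjointOcc (A B : Set ι → Prop) (S : Set ι) : Prop :=
  ∃ T T', T ⊆ S ∧ T' ⊆ S ∧ Disjoint T T' ∧ A T ∧ B T'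

-- The two disjoint witnesses are given independent copies of the edges, one edge at a time. A
-- relation `U` between two sets is used, instead of a pair of events, because such relations are
-- stable under conditioning on the edge that is being duplicated.
open Classical in
lemma expect_disjoint_le (hp : ∀ e, 0 ≤ p e ∧ p e ≤ 1) (U : Set ι → Set ι → Prop)
    (hU : ∀ S S' T T', S ⊆ T → S' ⊆ T' → U S S' → U T T') :
    expect F p (fun S => if ∃ T T', T ⊆ S ∧ T' ⊆ S ∧ Disjoint T T' ∧ U T T' then 1 else 0) ≤
      expect F p (fun S => expect F p fun S' => if U S S' then 1 else 0) := by
  induction F using Finset.induction_on generalizing U with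
  | empty =>
    simp only [expect, Finset.powerset_empty, Finset.sum_singleton, Finset.prod_empty,
      Finset.sdiff_self, one_mul, Finset.coe_empty]
    split_ifs with h1 h2 h2
    · exact le_rfl
    · obtain ⟨T, T', hT, hT', -, h⟩ := h1
      exact absurd (hU _ _ _ _ hT hT' h) h2
    · norm_num
    · exact le_rfl
  | insert e F he ih =>
    obtain ⟨V, hV⟩ : ∃ V : Set ι → Set ι → Prop,
        -- When `e` is open, only one of two disjoint witnesses can use it; this is the event left
        -- for the other edges.
        V = fun T T' => U (insert e T) T' ∨ U T (insert e T') := ⟨_, rfl⟩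
    have hVm : ∀ S S' T T', S ⊆ T → S' ⊆ T' → V S S' → V T T' := by
      subst hV
      rintro S S' T T' h h' (h1 | h1)
      · exact Or.inl (hU _ _ _ _ (Set.insert_subset_insert h) h' h1)
      · exact Or.inr (hU _ _ _ _ h (Set.insert_subset_insert h') h1)
    have hq : 0 ≤ 1 - p e := sub_nonneg.2 (hp e).2
    rw [expect_insert he]
    have h1 : expect F p (fun S => if ∃ T T', T ⊆ insert e S ∧ T' ⊆ insert e S ∧ Disjoint T T' ∧
        U T T' then (1 : ℝ) else 0) ≤
        expect F p (fun S => if ∃ T T', T ⊆ S ∧ T' ⊆ S ∧ Disjoint T T' ∧ V T T'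
          then (1 : ℝ) else 0) := by
      refine prob_mono hp fun S _ => ?_
      rintro ⟨T, T', hT, hT', hd, h⟩
      refine ⟨T \ {e}, T' \ {e}, by simpa [Set.sdiff_subset_iff] using hT,
        by simpa [Set.sdiff_subset_iff] using hT',
        hd.mono Set.sdiff_subset Set.sdiff_subset, ?_⟩
      rw [hV]
      by_cases heT : e ∈ T
      · left
        have heT' : e ∉ T' := fun h' => Set.disjoint_left.1 hd heT h'
        refine hU _ _ _ _ ?_ ?_ h
        · simp
        · rw [Set.sdiff_singleton_eq_self heT']
      · right
        refine hU _ _ _ _ ?_ ?_ h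
        · rw [Set.sdiff_singleton_eq_self heT]
        · simp
    refine (add_le_add (mul_le_mul_of_nonneg_left (h1.trans (ih V hVm)) (hp e).1)
      (mul_le_mul_of_nonneg_left (ih U hU) hq)).trans ?_
    rw [expect_insert he]
    simp only [expect_insert he]
    simp only [expect_add, expect_const_mul]
    rw [← sub_nonneg]
    -- The comparison at the single edge `e`: one copy that serves either side, against two
    -- independent copies. If just one side needs `e`, both sides equal `p e` when the other copy is
    -- of no use.
    have key : ∀ S S' : Set ι,
        p e * (if V S S' then (1:ℝ) else 0) + (1 - p e) * (if U S S' then 1 else 0) ≤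
        p e * (p e * (if U (insert e S) (insert e S') then 1 else 0) +
          (1 - p e) * (if U (insert e S) S' then 1 else 0)) +
        (1 - p e) * (p e * (if U S (insert e S') then 1 else 0) +
          (1 - p e) * (if U S S' then 1 else 0)) := by
      intro S S'
      have hs := Set.subset_insert e S
      have hs' := Set.subset_insert e S'
      by_cases h0 : U S S'
      · have a1 := hU _ _ _ _ hs hs' h0
        have a2 := hU _ _ _ _ hs le_rfl h0
        have a3 := hU _ _ _ _ le_rfl hs' h0
        simp only [hV, h0, a1, a2, a3, or_self, if_true]
        linarith
      · by_cases h1 : U (insert e S) S'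
        · have a1 := hU _ _ _ _ le_rfl hs' h1
          simp only [hV, h0, a1, h1, true_or, if_true, if_false]
          split_ifs <;> nlinarith [(hp e).1]
        · by_cases h2 : U S (insert e S')
          · have a1 := hU _ _ _ _ hs le_rfl h2
            simp only [hV, h0, a1, h1, h2, or_true, if_true, if_false]
            nlinarith [(hp e).1]
          · simp only [hV, h0, h1, h2, or_self, if_false]
            split_ifs <;> nlinarith [(hp e).1, mul_nonneg (hp e).1 (hp e).1]
    have := expect_mono (F := F) hp fun S _ => expect_mono (F := F) hp fun S' _ => key S S'
    simp only [expect_add, expect_const_mul] at this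
    linarith

/-- The van den Berg–Kesten inequality. -/
lemma prob_disjointOcc_le (hp : ∀ e, 0 ≤ p e ∧ p e ≤ 1) {A B : Set ι → Prop}
    (hA : Monotone A) (hB : Monotone B) :
    prob F p (DisjointOcc A B) ≤ prob F p A * prob F p B := by
  classical
  have := expect_disjoint_le (F := F) hp (fun S S' => A S ∧ B S')
    (fun S S' T T' h h' hh => ⟨hA h hh.1, hB h' hh.2⟩)
  refine (le_of_eq ?_).trans (this.trans (le_of_eq ?_))
  · unfold prob DisjointOcc; congr!
  · refine Eq.trans (b := expect F p fun S => prob F p B * (if A S then 1 else 0)) ?_ ?_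
    · congr 1; funext S
      by_cases h : A S
      · simp [h, prob]
      · simpa [h] using expect_const (F := F) (p := p) 0
    · rw [expect_const_mul, mul_comm]; rfl

/-- Conditioning on one edge splits the covariance into conditional covariances, nonnegative by
induction, and the covariance `p e * (1 - p e)` times the product of two differences of conditional
means, which have the same sign by monotonicity. -/
lemma expect_mul_le (hp : ∀ e, 0 ≤ p e ∧ p e ≤ 1) {f g : Set ι → ℝ}
    (hf : Antitone f) (hg : Antitone g) :
    expect F p f * expect F p g ≤ expect F p (fun S => f S * g S) := by
  classical
  induction F using Finset.induction_on generalizing f g with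
  | empty => simp [expect]
  | insert e F he ih =>
    rw [expect_insert he, expect_insert he, expect_insert he]
    have hf' : Antitone fun S => f (insert e S) := fun S T h => hf (Set.insert_subset_insert h)
    have hg' : Antitone fun S => g (insert e S) := fun S T h => hg (Set.insert_subset_insert h)
    have h1 := ih hf' hg'
    have h2 := ih hf hg
    have h3 : expect F p (fun S => f (insert e S)) ≤ expect F p f :=
      expect_mono hp fun S _ => hf (Set.subset_insert e S)
    have h4 : expect F p (fun S => g (insert e S)) ≤ expect F p g :=
      expect_mono hp fun S _ => hg (Set.subset_insert e S)
    have hq : 0 ≤ 1 - p e := sub_nonneg.2 (hp e).2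
    have h5 := mul_le_mul_of_nonneg_left h1 (hp e).1
    have h6 := mul_le_mul_of_nonneg_left h2 hq
    have h7 := mul_nonneg (mul_nonneg (hp e).1 hq)
      (mul_nonneg (sub_nonneg.2 h3) (sub_nonneg.2 h4))
    nlinarith

/-- Harris' inequality for decreasing events. -/
lemma prob_mul_le_and (hp : ∀ e, 0 ≤ p e ∧ p e ≤ 1) {A B : Set ι → Prop}
    (hA : Antitone A) (hB : Antitone B) :
    prob F p A * prob F p B ≤ prob F p (fun S => A S ∧ B S) := by
  classical
  have aux : ∀ {A : Set ι → Prop}, Antitone A → Antitone fun S => if A S then (1:ℝ) else 0 := by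
    intro A hA S T h
    by_cases hT : A T
    · simp [hT, hA h hT]
    · simp only [hT, if_false]; split_ifs <;> norm_num
  refine (expect_mul_le hp (aux hA) (aux hB)).trans (le_of_eq ?_)
  unfold prob
  congr 1; funext S
  by_cases h : A S <;> by_cases h' : B S <;> simp [h, h']

lemma prod_prob_le_forall (hp : ∀ e, 0 ≤ p e ∧ p e ≤ 1) {κ : Type*} (s : Finset κ)
    {A : κ → Set ι → Prop} (hA : ∀ k ∈ s, Antitone (A k)) :
    ∏ k ∈ s, prob F p (A k) ≤ prob F p (fun S => ∀ k ∈ s, A k S) := by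
  classical
  induction s using Finset.induction_on with
  | empty =>
    simp only [Finset.prod_empty, Finset.notMem_empty, false_imp_iff, implies_true]
    rw [prob]; simp [expect_const]
  | insert k s hk ih =>
    rw [Finset.prod_insert hk]
    have ih' := ih fun j hj => hA j (Finset.mem_insert_of_mem hj)
    refine (mul_le_mul_of_nonneg_left ih' (prob_nonneg hp _)).trans
      ((prob_mul_le_and hp (hA k (Finset.mem_insert_self _ _)) ?_).trans ?_)
    · intro S T h hT j hj
      exact hA j (Finset.mem_insert_of_mem hj) h (hT j hj)
    · exact prob_mono hp fun S _ h => by simpa using h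

/-- Not an equality, since `e` may lie outside `F`. It is all that is needed: upper bounds for open
edges come from van den Berg–Kesten and lower bounds for closed edges from Harris, with no case
distinction on `F`. -/
lemma prob_mem_le (hp : ∀ e, 0 ≤ p e ∧ p e ≤ 1) (e : ι) : prob F p (fun S => e ∈ S) ≤ p e := by
  classical
  by_cases he : e ∈ F
  · rw [← Finset.insert_erase he, prob, expect_insert (by simp)]
    have h0 : expect (F.erase e) p (fun S => if e ∈ S then (1:ℝ) else 0) = 0 :=
      prob_false (A := fun S => e ∈ S) fun S hS h => by simpa using hS h
    rw [h0]
    simp [expect_const]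
  · rw [prob_false fun S hS h => he (by exact_mod_cast hS h)]
    exact (hp e).1

lemma prob_forall_mem_le (hp : ∀ e, 0 ≤ p e ∧ p e ≤ 1) (s : Finset ι) :
    prob F p (fun S => ∀ e ∈ s, e ∈ S) ≤ ∏ e ∈ s, p e := by
  classical
  induction s using Finset.induction_on with
  | empty => simpa using prob_le_one hp _
  | insert e s hk ih =>
    rw [Finset.prod_insert hk]
    refine le_trans ?_ ((prob_disjointOcc_le (A := fun S => e ∈ S)
      (B := fun S => ∀ e ∈ s, e ∈ S) hp (fun S T h he => h he)
      (fun S T h hh e he => h (hh e he))).trans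
      (mul_le_mul (prob_mem_le hp e) ih (prob_nonneg hp _) (hp e).1))
    refine prob_mono hp fun S _ h => ⟨{e}, s, ?_, ?_, ?_, rfl, fun e he => he⟩
    · simpa using h e (by simp)
    · intro f hf; exact h f (by simp [Finset.mem_coe.1 hf])
    · simpa using hk

lemma prod_le_prob_forall_notMem (hp : ∀ e, 0 ≤ p e ∧ p e ≤ 1) (s : Finset ι) :
    ∏ e ∈ s, (1 - p e) ≤ prob F p (fun S => ∀ e ∈ s, e ∉ S) := by
  refine le_trans (Finset.prod_le_prod (fun e _ => sub_nonneg.2 (hp e).2) fun e _ => ?_)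
    (prod_prob_le_forall hp s fun e _ S T h he h' => he (h h'))
  rw [prob_not]
  linarith [prob_mem_le (F := F) hp e]

end Bernoulli

/-! ### The graph distance on the lattice -/

section Lattice

variable {d : ℕ}

/-- The `ℓ¹` distance, as a natural number. -/
def dst (x y : Vertex d) : ℕ := ∑ i, (x i - y i).natAbs

lemma dst_self (x : Vertex d) : dst x x = 0 := by simp [dst]

lemma dst_comm (x y : Vertex d) : dst x y = dst y x :=
  Finset.sum_congr rfl fun i _ => by omega

lemma dst_triangle (x y z : Vertex d) : dst x z ≤ dst x y + dst y z := by
  rw [dst, dst, dst, ← Finset.sum_add_distrib]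
  exact Finset.sum_le_sum fun i _ => by omega

lemma natAbs_le_dst (x y : Vertex d) (i : Fin d) : (x i - y i).natAbs ≤ dst x y :=
  Finset.single_le_sum (f := fun i => (x i - y i).natAbs) (fun _ _ => Nat.zero_le _)
    (Finset.mem_univ i)

lemma eq_of_dst_eq_zero {x y : Vertex d} (h : dst x y = 0) : x = y := by
  funext i
  have := natAbs_le_dst x y i
  omega

lemma dst_add_single (x : Vertex d) (i : Fin d) : dst x (x + Pi.single i 1) = 1 := by
  unfold dst
  rw [Finset.sum_eq_single i]
  · simp
  · intro j _ hj; simp [hj]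
  · simp

lemma l1_sub_eq_dst (x y : Vertex d) : l1 (y - x) = dst x y := by
  simp only [l1, dst, Nat.cast_sum, Pi.sub_apply]
  refine Finset.sum_congr rfl fun i _ => ?_
  rw [Nat.cast_natAbs, ← Int.cast_abs, abs_sub_comm]

/-- The closed ball of radius `r`, as a finite set. -/
def ballF (x : Vertex d) (r : ℕ) : Finset (Vertex d) :=
  (Fintype.piFinset fun i => Finset.Icc (x i - r) (x i + r)).filter fun y => dst x y ≤ r

lemma mem_ballF {x y : Vertex d} {r : ℕ} : y ∈ ballF x r ↔ dst x y ≤ r := by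
  simp only [ballF, Finset.mem_filter, Fintype.mem_piFinset, Finset.mem_Icc, and_iff_right_iff_imp]
  intro h i
  have := natAbs_le_dst x y i
  omega

lemma card_ballF_le (x : Vertex d) (r : ℕ) : (ballF x r).card ≤ (2 * r + 1) ^ d := by
  refine (Finset.card_filter_le _ _).trans (le_of_eq ?_)
  rw [Fintype.card_piFinset]
  have : ∀ i : Fin d, (Finset.Icc (x i - r) (x i + r)).card = 2 * r + 1 := fun i => by
    rw [Int.card_Icc]; omega
  simp [this]

lemma sum_pow_natAbs_le {r : ℝ} (h0 : 0 ≤ r) (h1 : r < 1) (s : Finset ℤ) (i : ℤ) :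
    ∑ j ∈ s, r ^ (j - i).natAbs ≤ 2 / (1 - r) := by
  classical
  have key : ∀ t : Finset ℤ, Set.InjOn (fun j : ℤ => (j - i).natAbs) t →
      ∑ j ∈ t, r ^ (j - i).natAbs ≤ 1 / (1 - r) := by
    intro t ht
    rw [← Finset.sum_image (f := fun n : ℕ => r ^ n) (by exact_mod_cast ht), one_div,
      ← tsum_geometric_of_lt_one h0 h1]
    exact (summable_geometric_of_lt_one h0 h1).sum_le_tsum _ fun n _ => pow_nonneg h0 n
  rw [← Finset.sum_filter_add_sum_filter_not s (fun j => i ≤ j)]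
  have e1 := key (s.filter fun j => i ≤ j) (by
    intro a ha b hb h
    simp only [Finset.coe_filter, Set.mem_ofPred_eq] at ha hb
    simp only at h
    omega)
  have e2 := key (s.filter fun j => ¬ i ≤ j) (by
    intro a ha b hb h
    simp only [Finset.coe_filter, Set.mem_ofPred_eq] at ha hb
    simp only at h
    omega)
  calc _ ≤ 1 / (1 - r) + 1 / (1 - r) := add_le_add e1 e2
    _ = 2 / (1 - r) := by ring

lemma sum_exp_abs_le {T : ℝ} (hT : 1 ≤ T) (s : Finset ℤ) (i : ℤ) :
    ∑ j ∈ s, Real.exp (-(|(j : ℝ) - i| / T)) ≤ 4 * T := by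
  have hT0 : 0 < T := by linarith
  have h1 : Real.exp (-(1 / T)) ≤ 1 - 1 / (2 * T) := by
    have h2 : 1 / T ≤ 1 := by rw [div_le_one hT0]; exact hT
    have h3 : 0 < 1 / T := by positivity
    have h5 : 1 + 1 / T ≤ Real.exp (1 / T) := by linarith [Real.add_one_le_exp (1 / T)]
    have h6 : Real.exp (-(1 / T)) ≤ (1 + 1 / T)⁻¹ := by
      rw [Real.exp_neg]
      exact inv_anti₀ (by linarith) h5
    refine h6.trans ?_
    rw [inv_le_iff_one_le_mul₀ (by linarith)]
    have : 1 / (2 * T) = 1 / T / 2 := by field_simp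
    rw [this]
    nlinarith
  have h0 : Real.exp (-(1 / T)) < 1 := by
    rw [Real.exp_lt_one_iff]
    have : 0 < 1 / T := by positivity
    linarith
  have e : ∀ j : ℤ, Real.exp (-(|(j : ℝ) - i| / T)) = Real.exp (-(1 / T)) ^ (j - i).natAbs := by
    intro j
    rw [← Real.exp_nat_mul, Nat.cast_natAbs]
    push_cast
    congr 1; ring
  simp only [e]
  refine (sum_pow_natAbs_le (Real.exp_pos _).le h0 s i).trans ?_
  rw [div_le_iff₀ (by linarith)]
  have : 1 / (2 * T) * (4 * T) = 2 := by field_simp; norm_num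
  nlinarith

lemma sum_exp_dst_le {m : ℝ} (hm : 1 ≤ m) (s : Finset (Vertex d)) (x : Vertex d) :
    ∑ y ∈ s, Real.exp (-(m * dst x y)) ≤ 4 ^ d := by
  classical
  obtain ⟨r, hr⟩ : ∃ r : ℕ, s ⊆ ballF x r :=
    ⟨s.sup fun y => dst x y, fun y hy => mem_ballF.2 (Finset.le_sup (f := fun y => dst x y) hy)⟩
  calc ∑ y ∈ s, Real.exp (-(m * dst x y))
      ≤ ∑ y ∈ s, Real.exp (-(dst x y : ℝ)) := by
        refine Finset.sum_le_sum fun y _ => Real.exp_le_exp.2 ?_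
        have : (0 : ℝ) ≤ dst x y := Nat.cast_nonneg _
        nlinarith
    _ ≤ ∑ y ∈ Fintype.piFinset fun i => Finset.Icc (x i - r) (x i + r),
          Real.exp (-(dst x y : ℝ)) :=
        Finset.sum_le_sum_of_subset_of_nonneg (hr.trans (Finset.filter_subset _ _))
          fun _ _ _ => (Real.exp_pos _).le
    _ = ∑ y ∈ Fintype.piFinset fun i => Finset.Icc (x i - r) (x i + r),
          ∏ i, Real.exp (-(|(y i : ℝ) - x i| / 1)) := by
        refine Finset.sum_congr rfl fun y _ => ?_
        rw [← Real.exp_sum]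
        congr 1
        simp only [dst, Nat.cast_sum, Finset.sum_neg_distrib, div_one]
        congr 1
        refine Finset.sum_congr rfl fun i _ => ?_
        rw [Nat.cast_natAbs, abs_sub_comm]
        push_cast; rfl
    _ = ∏ i, ∑ n ∈ Finset.Icc (x i - r) (x i + r), Real.exp (-(|(n : ℝ) - x i| / 1)) := by
        rw [Finset.prod_univ_sum]
    _ ≤ ∏ _i : Fin d, (4 * 1 : ℝ) :=
        Finset.prod_le_prod (fun i _ => Finset.sum_nonneg fun _ _ => (Real.exp_pos _).le)
          fun i _ => sum_exp_abs_le le_rfl _ _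
    _ = 4 ^ d := by simp

end Lattice

/-! ### The discretised graph -/

section FineGraph

variable {d : ℕ}

/-- Points of the lattice `ℤ^d × ℤ`. -/
abbrev Site (d : ℕ) : Type := Vertex d × ℤ

/-- Edges of the lattice `ℤ^d × ℤ`; `(w, n)` is vertical if `w` is a vertex and horizontal if `w`
is an edge. -/
abbrev FineEdge (d : ℕ) : Type := Graph d × ℤ

/-- The end points of an edge. -/
def ends : FineEdge d → Site d × Site d
  | (Sum.inl x, n) => ((x, n), (x, n + 1))
  | (Sum.inr u, n) => ((u.1, n), (u.1 + Pi.single u.2 1, n))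

/-- `e` joins `X` and `Y`. -/
def Joins (e : FineEdge d) (X Y : Site d) : Prop := ends e = (X, Y) ∨ ends e = (Y, X)

lemma Joins.symm {e : FineEdge d} {X Y : Site d} (h : Joins e X Y) : Joins e Y X := Or.symm h

lemma Joins.eq_or_eq {e : FineEdge d} {X Y Z W : Site d} (h : Joins e X Y) (h' : Joins e Z W) :
    X = Z ∨ X = W := by
  rcases h with h | h <;> rcases h' with h' | h' <;> rw [h] at h' <;>
    simp only [Prod.mk.injEq] at h' <;> tauto

lemma Joins.cases {e : FineEdge d} {X Y : Site d} (h : Joins e X Y) :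
    (X.1 = Y.1 ∧ e = (Sum.inl X.1, min X.2 Y.2) ∧ (Y.2 = X.2 + 1 ∨ X.2 = Y.2 + 1)) ∨
    (X.2 = Y.2 ∧ dst X.1 Y.1 = 1 ∧ ∃ i, (e = (Sum.inr (X.1, i), X.2) ∧ Y.1 = X.1 + Pi.single i 1) ∨
      (e = (Sum.inr (Y.1, i), X.2) ∧ X.1 = Y.1 + Pi.single i 1)) := by
  obtain ⟨x, n⟩ := X
  obtain ⟨y, l⟩ := Y
  rcases e with ⟨z | ⟨z, i⟩, k⟩
  · left
    rcases h with h | h <;> simp only [ends, Prod.mk.injEq] at h <;>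
      obtain ⟨⟨rfl, rfl⟩, rfl, rfl⟩ := h <;> simp
  · right
    rcases h with h | h <;> simp only [ends, Prod.mk.injEq] at h <;>
      obtain ⟨⟨rfl, rfl⟩, rfl, rfl⟩ := h
    · exact ⟨rfl, dst_add_single _ _, i, Or.inl ⟨rfl, rfl⟩⟩
    · exact ⟨rfl, by rw [dst_comm]; exact dst_add_single _ _, i, Or.inr ⟨rfl, rfl⟩⟩

lemma Joins.dst_le {e : FineEdge d} {X Y : Site d} (h : Joins e X Y) : dst X.1 Y.1 ≤ 1 := by
  rcases h.cases with h | h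
  · rw [h.1, dst_self]; omega
  · exact h.2.1.le

lemma Joins.abs_le {e : FineEdge d} {X Y : Site d} (h : Joins e X Y) :
    Y.2 ≤ X.2 + 1 ∧ X.2 ≤ Y.2 + 1 := by
  rcases h.cases with h | h <;> omega

/-- One step along an edge of `S` inside `A`. -/
def Step (S : Set (FineEdge d)) (A : Set (Site d)) (X Y : Site d) : Prop :=
  X ∈ A ∧ Y ∈ A ∧ ∃ e ∈ S, Joins e X Y

/-- `X` and `Y` are connected by edges of `S` inside `A`. -/
def Conn (S : Set (FineEdge d)) (A : Set (Site d)) (X Y : Site d) : Prop :=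
  Relation.ReflTransGen (Step S A) X Y

variable {S S' : Set (FineEdge d)} {A A' Q : Set (Site d)} {X Y Z : Site d}

lemma Conn.mono (h : Conn S A X Y) (hS : S ⊆ S') (hA : A ⊆ A') : Conn S' A' X Y :=
  Relation.ReflTransGen.mono (fun _ _ ⟨h1, h2, e, he, hj⟩ => ⟨hA h1, hA h2, e, hS he, hj⟩) _ _ h

lemma Conn.symm (h : Conn S A X Y) : Conn S A Y X := by
  refine Relation.ReflTransGen.mono ?_ _ _ h.swap
  rintro _ _ ⟨h1, h2, e, he, hj⟩
  exact ⟨h2, h1, e, he, hj.symm⟩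

lemma Conn.eq_or_mem (h : Conn S A X Y) : X = Y ∨ (X ∈ A ∧ Y ∈ A) := by
  induction h with
  | refl => exact Or.inl rfl
  | tail _ hs ih =>
    rcases ih with rfl | h
    · exact Or.inr ⟨hs.1, hs.2.1⟩
    · exact Or.inr ⟨h.1, hs.2.1⟩

/-- A connection inside `A` uses only edges with both ends in `A`. -/
lemma Conn.restrict (h : Conn S A X Y) :
    Conn {e ∈ S | ∃ Z ∈ A, ∃ W ∈ A, Joins e Z W} A X Y :=
  Relation.ReflTransGen.mono
    (fun _ _ ⟨h1, h2, e, he, hj⟩ => ⟨h1, h2, e, ⟨he, _, h1, _, h2, hj⟩, hj⟩) _ _ h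

/-- Cutting at the last exit from `C`, not the first, makes the rest of the chain avoid `C`
altogether. With `C` a cluster this yields edge-disjoint pieces. -/
lemma exists_last_exit {α : Type*} {r : α → α → Prop} {C : α → Prop} {a b : α}
    (h : Relation.ReflTransGen r a b) (ha : C a) (hb : ¬ C b) :
    ∃ w z, C w ∧ ¬ C z ∧ r w z ∧ Relation.ReflTransGen (fun u v => r u v ∧ ¬ C u ∧ ¬ C v) z b := by
  induction h with
  | refl => exact absurd ha hb
  | @tail b c hab hbc ih =>
    by_cases hC : C b
    · exact ⟨b, c, hC, hb, hbc, .refl⟩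
    · obtain ⟨w, z, h1, h2, h3, h4⟩ := ih hC
      exact ⟨w, z, h1, h2, h3, h4.tail ⟨hbc, hC, hb⟩⟩

/-- If `X` is connected to `Y` in `A` but not in `A ∩ Q`, then it is connected in `A ∩ Q` to the
inner end of an edge leaving `Q`, whose outer end is connected to `Y` by other edges. -/
lemma Conn.exists_exit (h : Conn S A X Y) (hX : X ∈ Q) (hY : ¬ Conn S (A ∩ Q) X Y) :
    ∃ w z e T T', T ⊆ S ∧ T' ⊆ S ∧ Disjoint T T' ∧ Conn T (A ∩ Q) X w ∧ w ∈ A ∩ Q ∧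
      e ∈ T ∧ Joins e w z ∧ z ∈ A ∧ z ∉ Q ∧ Conn T' A z Y := by
  obtain ⟨w, z, hw, hz, ⟨hwA, hzA, e, he, hj⟩, hzY⟩ :=
    exists_last_exit (C := fun W => Conn S (A ∩ Q) X W) h .refl hY
  have hwQ : w ∈ Q := by
    rcases hw.eq_or_mem with rfl | hw'
    · exact hX
    · exact hw'.2.2
  have hzQ : z ∉ Q := fun hzQ => hz (hw.tail ⟨⟨hwA, hwQ⟩, ⟨hzA, hzQ⟩, e, he, hj⟩)
  -- The witness `T` consists of the open edges touching the cluster of `X` in `A ∩ Q`, and `T'` of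
  -- all others. After its last exit from the cluster the connection touches no edge of `T`.
  refine ⟨w, z, e, {e ∈ S | ∃ W W', Conn S (A ∩ Q) X W ∧ Joins e W W'},
    S \ {e ∈ S | ∃ W W', Conn S (A ∩ Q) X W ∧ Joins e W W'}, Set.sep_subset _ _, Set.sdiff_subset,
    Set.disjoint_sdiff_right, ?_, ⟨hwA, hwQ⟩, ⟨he, w, z, hw, hj⟩, hj, hzA, hzQ, ?_⟩
  · clear hz hj he hwQ hwA hzA hzQ hzY
    induction hw with
    | refl => exact .refl
    | @tail b c hb hbc ih =>
      obtain ⟨h1, h2, f, hf, hjf⟩ := hbc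
      exact ih.tail ⟨h1, h2, f, ⟨hf, b, c, hb, hjf⟩, hjf⟩
  · refine Relation.ReflTransGen.mono ?_ _ _ hzY
    rintro a b ⟨⟨h1, h2, f, hf, hjf⟩, ha, hb⟩
    refine ⟨h1, h2, f, ⟨hf, ?_⟩, hjf⟩
    rintro ⟨-, W, W', hW, hWj⟩
    rcases hWj.eq_or_eq hjf with rfl | rfl
    · exact ha hW
    · exact hb hW

/-- The part of a connection above the level `lo` of a function with steps at most one. -/
lemma Conn.exists_above {f : Site d → ℤ} (hf : ∀ e X Y, Joins e X Y → f Y ≤ f X + 1) {lo : ℤ}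
    (h : Conn S A X Y) (hX : f X ≤ lo) (hY : lo ≤ f Y) :
    ∃ X', f X' = lo ∧ Conn S (A ∩ {Z | lo ≤ f Z}) X' Y ∧ Conn S A X X' := by
  induction h with
  | refl => exact ⟨X, le_antisymm hX hY, .refl, .refl⟩
  | @tail b c hb hbc ih =>
    obtain ⟨h1, h2, e, he, hj⟩ := hbc
    by_cases hlo : lo ≤ f b
    · obtain ⟨X', e1, e2, e3⟩ := ih hlo
      exact ⟨X', e1, e2.tail ⟨⟨h1, hlo⟩, ⟨h2, hY⟩, e, he, hj⟩, e3⟩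
    · refine ⟨c, ?_, .refl, hb.tail ⟨h1, h2, e, he, hj⟩⟩
      have := hf e _ _ hj
      omega

/-- A connection across the levels `lo ≤ f ≤ hi` has a part which crosses inside them. -/
lemma Conn.exists_crossing {f : Site d → ℤ} (hf : ∀ e X Y, Joins e X Y → f Y ≤ f X + 1)
    {lo hi : ℤ} (h : Conn S A X Y) (hX : f X ≤ lo) (hl : lo ≤ hi) (hY : hi ≤ f Y) :
    ∃ X' Y', f X' = lo ∧ f Y' = hi ∧ Conn S (A ∩ {Z | lo ≤ f Z ∧ f Z ≤ hi}) X' Y' := by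
  obtain ⟨X', e1, e2, -⟩ := h.exists_above hf hX (hl.trans hY)
  obtain ⟨Y', e3, e4, -⟩ := e2.symm.exists_above (f := fun Z => - f Z) (lo := -hi)
    (fun e X Y hj => by have := hf e Y X hj.symm; omega) (by simpa using hY)
    (by simpa [e1] using hl)
  refine ⟨X', Y', e1, by omega, e4.symm.mono le_rfl ?_⟩
  rintro Z ⟨⟨h1, h2⟩, h3⟩
  simp only [Set.mem_ofPred_eq, neg_le_neg_iff] at h2 h3
  exact ⟨h1, h2, h3⟩

/-- If `X` is connected to a point outside `Q`, it is connected inside `Q` to the inner end of an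
edge leaving `Q`. -/
lemma Conn.exists_boundary (h : Conn S A X Y) (hX : X ∈ Q) (hY : ¬ Conn S (A ∩ Q) X Y) :
    ∃ w z e, Conn S (A ∩ Q) X w ∧ w ∈ A ∩ Q ∧ e ∈ S ∧ Joins e w z ∧ z ∈ A ∧ z ∉ Q := by
  obtain ⟨w, z, e, T, T', hT, -, -, h1, h2, h3, h4, h5, h6, -⟩ := h.exists_exit hX hY
  exact ⟨w, z, e, h1.mono hT le_rfl, h2, hT h3, h4, h5, h6⟩

/-- The unit block of time containing a site, when time has mesh `1 / M`. -/
def cell (M : ℕ) (X : Site d) : Site d := (X.1, X.2 / M)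

lemma cell_fst (M : ℕ) (X : Site d) : (cell M X).1 = X.1 := rfl

lemma cell_snd (M : ℕ) (X : Site d) : (cell M X).2 = X.2 / M := rfl

lemma Joins.ediv_le {M : ℕ} (hM : 0 < M) {e : FineEdge d} {X Y : Site d} (h : Joins e X Y) :
    Y.2 / (M : ℤ) ≤ X.2 / M + 1 := by
  have hM' : (0 : ℤ) < M := by exact_mod_cast hM
  have h1 := h.abs_le.1
  have h2 : Y.2 ≤ X.2 + M * 1 := by omega
  calc Y.2 / (M : ℤ) ≤ (X.2 + M * 1) / M := Int.ediv_le_ediv hM' h2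
    _ = X.2 / M + 1 := Int.add_mul_ediv_left _ _ hM'.ne'

/-- Two cells are connected by edges of `S` inside `A`. -/
def CellConn (M : ℕ) (A : Set (Site d)) (c c' : Site d) (S : Set (FineEdge d)) : Prop :=
  ∃ X Y, cell M X = c ∧ cell M Y = c' ∧ Conn S A X Y

lemma cellConn_monotone (M : ℕ) (A : Set (Site d)) (c c' : Site d) :
    Monotone (CellConn M A c c') := by
  rintro S T h ⟨X, Y, h1, h2, h3⟩
  exact ⟨X, Y, h1, h2, h3.mono h le_rfl⟩

end FineGraph

/-! ### Consequences of the van den Berg–Kesten inequality -/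

section Percolation

variable {d : ℕ} {F : Finset (FineEdge d)} {p : FineEdge d → ℝ} {M : ℕ}

/-- The cell `c` is connected inside `Q` to an edge which leaves `Q` to the cell `c'`. -/
def ExitAt (M : ℕ) (A Q : Set (Site d)) (c c' : Site d) (S : Set (FineEdge d)) : Prop :=
  c' ∉ Q ∧ ∃ X w z e, cell M X = c ∧ Conn S (A ∩ cell M ⁻¹' Q) X w ∧ w ∈ A ∧ z ∈ A ∧
    cell M w ∈ Q ∧ e ∈ S ∧ Joins e w z ∧ cell M z = c'

lemma exitAt_monotone (M : ℕ) (A Q : Set (Site d)) (c c' : Site d) :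
    Monotone (ExitAt M A Q c c') := by
  rintro S T h ⟨h0, X, w, z, e, h1, h2, h3, h4, h5, h6, h7⟩
  exact ⟨h0, X, w, z, e, h1, h2.mono h le_rfl, h3, h4, h5, h h6, h7⟩

/-- Exponential decay from summable exit probabilities. -/
lemma prob_cellConn_le_exp (hp : ∀ e, 0 ≤ p e ∧ p e ≤ 1) {A : Set (Site d)}
    {φ : Site d → Site d → ℝ} (hφ : ∀ c c', 0 ≤ φ c c')
    (tri : ∀ c c' c'', φ c c'' ≤ φ c c' + φ c' c'') {B : ℝ}
    (Q : Site d → Set (Site d)) (D : Site d → Finset (Site d)) (hself : ∀ c, c ∈ Q c)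
    (hB : ∀ c, ∀ c' ∈ Q c, φ c c' ≤ B)
    (hD : ∀ c w z e, Joins e w z → w ∈ A → z ∈ A → cell M w ∈ Q c → cell M z ∉ Q c →
      cell M z ∈ D c)
    (hsum : ∀ c, ∑ c' ∈ D c, prob F p (ExitAt M A (Q c) c c') * Real.exp (φ c c') ≤ 1 / 2)
    (c c' : Site d) : prob F p (CellConn M A c c') ≤ Real.exp (B - φ c c') := by
  -- Every exit gains a factor 1/2, so the trivial bound 1 contributes only `(1/2)^n` after `n`
  -- exits. When `c'` lies in `Q c` the claim is trivial, because `B` dominates `φ c c'`.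
  have key : ∀ n : ℕ, ∀ c, prob F p (CellConn M A c c') ≤ Real.exp (B - φ c c') + (1 / 2) ^ n := by
    intro n
    induction n with
    | zero =>
      intro c
      have := prob_le_one (F := F) hp (CellConn M A c c')
      have := Real.exp_pos (B - φ c c')
      simp only [pow_zero]; linarith
    | succ n ih =>
      intro c
      by_cases hc : c' ∈ Q c
      · have h1 := prob_le_one (F := F) hp (CellConn M A c c')
        have h2 : 1 ≤ Real.exp (B - φ c c') := Real.one_le_exp (by linarith [hB c c' hc])
        have : (0 : ℝ) ≤ (1 / 2) ^ (n + 1) := by positivity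
        linarith
      · have h1 : prob F p (CellConn M A c c') ≤ ∑ b ∈ D c,
            prob F p (DisjointOcc (ExitAt M A (Q c) c b) (CellConn M A b c')) := by
          refine le_trans (prob_mono hp ?_) (prob_exists_le hp (D c)
            fun b => DisjointOcc (ExitAt M A (Q c) c b) (CellConn M A b c'))
          rintro S - ⟨X, Y, hX, hY, hXY⟩
          obtain ⟨w, z, e, T, T', hT, hT', hd, e1, e2, e3, e4, e5, e6, e7⟩ :=
            hXY.exists_exit (Q := cell M ⁻¹' Q c) (by simpa [hX] using hself c) (by
              intro h
              rcases h.eq_or_mem with rfl | h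
              · rw [← hY, hX] at hc; exact hc (hself c)
              · exact hc (by simpa [hY] using h.2.2))
          exact ⟨cell M z, hD c w z e e4 e2.1 e5 e2.2 e6, T, T', hT, hT', hd,
            ⟨e6, X, w, z, e, hX, e1, e2.1, e5, e2.2, e3, e4, rfl⟩, z, Y, rfl, hY, e7⟩
        refine h1.trans ?_
        have h2 : ∀ b ∈ D c,
            prob F p (DisjointOcc (ExitAt M A (Q c) c b) (CellConn M A b c')) ≤
            (prob F p (ExitAt M A (Q c) c b) * Real.exp (φ c b)) *
              (Real.exp (B - φ c c') + (1 / 2) ^ n) := by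
          intro b _
          refine (prob_disjointOcc_le hp (exitAt_monotone _ _ _ _ _)
            (cellConn_monotone _ _ _ _)).trans ?_
          rw [mul_assoc]
          refine mul_le_mul_of_nonneg_left ((ih b).trans ?_) (prob_nonneg hp _)
          rw [mul_add, ← Real.exp_add]
          refine add_le_add (Real.exp_le_exp.2 (by linarith [tri c b c'])) ?_
          exact le_mul_of_one_le_left (by positivity) (Real.one_le_exp (hφ _ _))
        refine (Finset.sum_le_sum h2).trans ?_
        rw [← Finset.sum_mul]
        have h3 : (0 : ℝ) ≤ Real.exp (B - φ c c') + (1 / 2) ^ n := by positivity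
        refine (mul_le_mul_of_nonneg_right (hsum c) h3).trans ?_
        rw [pow_succ]
        have := Real.exp_pos (B - φ c c')
        linarith
  have lim : Tendsto (fun n : ℕ => Real.exp (B - φ c c') + (1 / 2 : ℝ) ^ n) atTop
      (𝓝 (Real.exp (B - φ c c') + 0)) :=
    tendsto_const_nhds.add (tendsto_pow_atTop_nhds_zero_of_lt_one (by norm_num) (by norm_num))
  rw [add_zero] at lim
  exact ge_of_tendsto' lim fun n => key n c

/-- A connection either avoids the line of `v` or has disjoint parts before the first and after
the last visit. -/
lemma Conn.off_line_or {S : Set (FineEdge d)} {A : Set (Site d)} {X Y : Site d}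
    (h : Conn S A X Y) (v : Vertex d) :
    Conn S (A \ {Z | Z.1 = v}) X Y ∨ ∃ w w', dst v w.1 ≤ 1 ∧ dst v w'.1 ≤ 1 ∧
      (w = X ∨ w ∈ A) ∧ (w' = Y ∨ w' ∈ A) ∧
      DisjointOcc (fun T => Conn T (A \ {Z | Z.1 = v}) X w)
        (fun T => Conn T (A \ {Z | Z.1 = v}) w' Y) S := by
  have aux : ∀ {T : Set (FineEdge d)} {z Y : Site d}, Conn T A z Y → z.1 = v →
      ∃ w', dst v w'.1 ≤ 1 ∧ (w' = Y ∨ w' ∈ A) ∧ Conn T (A \ {Z | Z.1 = v}) w' Y := by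
    intro T z Y hzY hz
    by_cases hY : Y.1 = v
    · exact ⟨Y, by rw [hY, dst_self]; omega, Or.inl rfl, .refl⟩
    · obtain ⟨w, z', e, h1, h2, h3, h4, h5, h6⟩ :=
        hzY.symm.exists_boundary (Q := {Z | Z.1 ≠ v}) hY (by
          intro hc
          rcases hc.eq_or_mem with h | h
          · exact hY (h ▸ hz)
          · exact h.2.2 hz)
      refine ⟨w, ?_, Or.inr h2.1, h1.symm⟩
      have h6' : z'.1 = v := not_not.1 h6
      rw [← h6', dst_comm]; exact h4.dst_le
  by_cases hc : Conn S (A \ {Z | Z.1 = v}) X Y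
  · exact Or.inl hc
  right
  by_cases hX : X.1 = v
  · obtain ⟨w', h1, h2, h3⟩ := aux h hX
    exact ⟨X, w', by rw [hX, dst_self]; omega, h1, Or.inl rfl, h2, ∅, S, Set.empty_subset _,
      le_rfl, Set.empty_disjoint _, .refl, h3⟩
  · obtain ⟨w, z, e, T, T', hT, hT', hd, e1, e2, e3, e4, e5, e6, e7⟩ :=
      h.exists_exit (Q := {Z | Z.1 ≠ v}) hX hc
    have e6' : z.1 = v := not_not.1 e6
    obtain ⟨w', h1, h2, h3⟩ := aux e7 e6'
    refine ⟨w, w', ?_, h1, Or.inr e2.1, h2, T, T', hT, hT', hd, e1, h3⟩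
    rw [← e6', dst_comm]; exact e4.dst_le

/-- The effect of adding one line on the two-point function in a bounded interval of time. -/
lemma prob_cellConn_add_line (hp : ∀ e, 0 ≤ p e ∧ p e ≤ 1) {A : Set (Site d)} (v : Vertex d)
    {m K a : ℝ} (hm : 0 ≤ m) (I : Finset ℤ) (hA : ∀ X ∈ A, X.2 / M ∈ I)
    (ha : 2 * ((3 ^ d * I.card : ℕ) * Real.exp m) ^ 2 ≤ a) (ha2 : 2 ≤ a) (hK : a ≤ K)
    (h : ∀ c c', c.2 ∈ I → c'.2 ∈ I → a * prob F p (CellConn M (A \ {X | X.1 = v}) c c') ≤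
      K * Real.exp (-(m * dst c.1 c'.1))) (c c' : Site d) (hc : c.2 ∈ I) (hc' : c'.2 ∈ I) :
    a * prob F p (CellConn M A c c') ≤ K ^ 2 * Real.exp (-(m * dst c.1 c'.1)) := by
  classical
  have ha0 : 0 < a := by linarith
  set G : Site d → Site d → ℝ := fun b b' => prob F p (CellConn M (A \ {X | X.1 = v}) b b') with hG
  set N : Finset (Site d) := ballF v 1 ×ˢ I with hN
  have h1 : prob F p (CellConn M A c c') ≤ G c c' + ∑ b ∈ N, ∑ b' ∈ N, G c b * G b' c' := by
    have e1 : prob F p (CellConn M A c c') ≤ prob F p (fun S =>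
        CellConn M (A \ {X | X.1 = v}) c c' S ∨ ∃ q ∈ N ×ˢ N,
          DisjointOcc (CellConn M (A \ {X | X.1 = v}) c q.1)
            (CellConn M (A \ {X | X.1 = v}) q.2 c') S) := by
      refine prob_mono hp ?_
      rintro S - ⟨X, Y, hX, hY, hXY⟩
      rcases hXY.off_line_or v with h | ⟨w, w', h1, h2, h3, h4, T, T', hT, hT', hd, h5, h6⟩
      · exact Or.inl ⟨X, Y, hX, hY, h⟩
      · refine Or.inr ⟨(cell M w, cell M w'), ?_, T, T', hT, hT', hd, ⟨X, w, hX, rfl, h5⟩,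
          ⟨w', Y, rfl, hY, h6⟩⟩
        simp only [hN, Finset.mem_product, mem_ballF, cell_fst, cell_snd]
        refine ⟨⟨h1, ?_⟩, h2, ?_⟩
        · rcases h3 with rfl | h3
          · rw [← hX] at hc; exact hc
          · exact hA _ h3
        · rcases h4 with rfl | h4
          · rw [← hY] at hc'; exact hc'
          · exact hA _ h4
    refine e1.trans ((prob_or_le hp _ _).trans (add_le_add_right ?_ _))
    refine (prob_exists_le hp _ _).trans ?_
    rw [Finset.sum_product]
    exact Finset.sum_le_sum fun b _ => Finset.sum_le_sum fun b' _ =>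
      prob_disjointOcc_le hp (cellConn_monotone _ _ _ _) (cellConn_monotone _ _ _ _)
  -- Both `b` and `b'` lie within distance 1 of `v`, so the two decay factors combine to the full
  -- decay up to `exp (2 * m)`: the spatial rate is unchanged. The factor `a` pays for this loss and
  -- for the number of pairs, so that adding a line just squares `K`.
  have h2 : ∀ b ∈ N, ∀ b' ∈ N, a ^ 2 * (G c b * G b' c') ≤
      K ^ 2 * (Real.exp m ^ 2 * Real.exp (-(m * dst c.1 c'.1))) := by
    intro b hb b' hb'
    simp only [hN, Finset.mem_product, mem_ballF] at hb hb'
    have f1 := h c b hc hb.2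
    have f2 := h b' c' hb'.2 hc'
    have f3 := mul_le_mul f1 f2 (mul_nonneg ha0.le (prob_nonneg hp _))
      (mul_nonneg (ha0.le.trans hK) (Real.exp_pos _).le)
    calc a ^ 2 * (G c b * G b' c') = a * G c b * (a * G b' c') := by ring
      _ ≤ _ := f3
      _ = K ^ 2 * Real.exp (-(m * dst c.1 b.1) + -(m * dst b'.1 c'.1)) := by
          rw [Real.exp_add]; ring
      _ ≤ _ := by
          refine mul_le_mul_of_nonneg_left ?_ (sq_nonneg _)
          rw [← Real.exp_nat_mul, ← Real.exp_add]
          refine Real.exp_le_exp.2 ?_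
          have t1 := dst_triangle c.1 b.1 c'.1
          have t2 := dst_triangle b.1 v c'.1
          have t3 := dst_triangle v b'.1 c'.1
          have t4 := dst_comm v b.1
          have t : (dst c.1 c'.1 : ℝ) ≤ dst c.1 b.1 + dst b'.1 c'.1 + 2 := by
            exact_mod_cast (by omega : dst c.1 c'.1 ≤ dst c.1 b.1 + dst b'.1 c'.1 + 2)
          push_cast
          nlinarith
  have hcard : (N.card : ℝ) ≤ (3 ^ d * I.card : ℕ) := by
    rw [hN, Finset.card_product]
    exact_mod_cast Nat.mul_le_mul_right _ (by simpa using card_ballF_le v 1)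
  have h3 : a ^ 2 * ∑ b ∈ N, ∑ b' ∈ N, G c b * G b' c' ≤
      (N.card : ℝ) * (N.card * (K ^ 2 * (Real.exp m ^ 2 * Real.exp (-(m * dst c.1 c'.1))))) := by
    rw [Finset.mul_sum]
    refine (Finset.sum_le_card_nsmul _ _ _ fun b hb => ?_).trans (by rw [nsmul_eq_mul])
    rw [Finset.mul_sum]
    exact (Finset.sum_le_card_nsmul _ _ _ fun b' hb' => h2 b hb b' hb').trans
      (by rw [nsmul_eq_mul])
  set E := Real.exp (-(m * dst c.1 c'.1)) with hE
  have hE0 : 0 < E := Real.exp_pos _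
  have h4 : a ^ 2 * ∑ b ∈ N, ∑ b' ∈ N, G c b * G b' c' ≤ a / 2 * (K ^ 2 * E) := by
    refine h3.trans ?_
    have : ((N.card : ℝ) * Real.exp m) ^ 2 ≤ a / 2 := by
      have := pow_le_pow_left₀ (by positivity) (mul_le_mul_of_nonneg_right hcard
        (Real.exp_pos m).le) 2
      linarith
    calc _ = ((N.card : ℝ) * Real.exp m) ^ 2 * (K ^ 2 * E) := by ring
      _ ≤ _ := mul_le_mul_of_nonneg_right this (by positivity)
  have h5 : a * ∑ b ∈ N, ∑ b' ∈ N, G c b * G b' c' ≤ 1 / 2 * (K ^ 2 * E) := by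
    have : a * (a * ∑ b ∈ N, ∑ b' ∈ N, G c b * G b' c') ≤ a * (1 / 2 * (K ^ 2 * E)) := by
      linarith
    exact le_of_mul_le_mul_left this ha0
  have h6 := h c c' hc hc'
  have h7 : K * E ≤ 1 / 2 * (K ^ 2 * E) := by
    have : 0 ≤ (K - 2) * K * E := by
      refine mul_nonneg (mul_nonneg (by linarith) (by linarith)) hE0.le
    nlinarith
  calc a * prob F p (CellConn M A c c') ≤ a * (G c c' + ∑ b ∈ N, ∑ b' ∈ N, G c b * G b' c') :=
        mul_le_mul_of_nonneg_left h1 ha0.le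
    _ = a * G c c' + a * ∑ b ∈ N, ∑ b' ∈ N, G c b * G b' c' := by ring
    _ ≤ K * E + 1 / 2 * (K ^ 2 * E) := add_le_add h6 h5
    _ ≤ _ := by linarith

/-- The effect of adding finitely many lines. -/
lemma prob_cellConn_add_lines (hp : ∀ e, 0 ≤ p e ∧ p e ≤ 1) (V : Finset (Vertex d))
    {m K a : ℝ} (hm : 0 ≤ m) (I : Finset ℤ)
    (ha : 2 * ((3 ^ d * I.card : ℕ) * Real.exp m) ^ 2 ≤ a) (ha2 : 2 ≤ a) (hK : a ≤ K)
    {A : Set (Site d)} (hA : ∀ X ∈ A, X.2 / M ∈ I)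
    (h : ∀ c c', c.2 ∈ I → c'.2 ∈ I → a * prob F p (CellConn M (A \ {X | X.1 ∈ V}) c c') ≤
      K * Real.exp (-(m * dst c.1 c'.1))) (c c' : Site d) (hc : c.2 ∈ I) (hc' : c'.2 ∈ I) :
    a * prob F p (CellConn M A c c') ≤ K ^ 2 ^ V.card * Real.exp (-(m * dst c.1 c'.1)) := by
  classical
  induction V using Finset.induction_on generalizing A K c c' with
  | empty =>
    have := h c c' hc hc'
    simpa using this
  | insert v V hv ih =>
    rw [Finset.card_insert_of_notMem hv, pow_succ', pow_mul]
    refine ih (A := A) (K := K ^ 2) ?_ hA ?_ c c' hc hc'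
    · have : 1 ≤ K := by linarith
      nlinarith
    · refine prob_cellConn_add_line hp v hm I (fun X hX => hA X hX.1) ha ha2 hK ?_
      intro b b' hb hb'
      have e : (A \ {X | X.1 ∈ V}) \ {X : Site d | X.1 = v} = A \ {X | X.1 ∈ insert v V} := by
        ext X
        simp only [Set.mem_sdiff, Set.mem_ofPred_eq, Finset.mem_insert]
        tauto
      rw [e]
      exact h b b' hb hb'

/-- Events in disjoint regions. -/
lemma prob_forall_lt_le_pow (hp : ∀ e, 0 ≤ p e ∧ p e ≤ 1) (R : ℕ → Set (Site d))
    (hR : Pairwise fun s t => Disjoint (R s) (R t)) (C : ℕ → Set (FineEdge d) → Prop)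
    (hC : ∀ t, Monotone (C t))
    (hloc : ∀ t S, C t S → C t {e ∈ S | ∃ Z ∈ R t, ∃ W ∈ R t, Joins e Z W})
    {q : ℝ} (hq : ∀ t, prob F p (C t) ≤ q) (n : ℕ) :
    prob F p (fun S => ∀ t < n, C t S) ≤ q ^ n := by
  have hq0 : 0 ≤ q := (prob_nonneg hp _).trans (hq 0)
  induction n with
  | zero => simpa using prob_le_one hp _
  | succ n ih =>
    rw [pow_succ]
    refine le_trans ?_ ((prob_disjointOcc_le (A := fun S => ∀ t < n, C t S) (B := C n) hp
      (fun S T h hS t ht => hC t h (hS t ht)) (hC n)).trans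
      (mul_le_mul ih (hq n) (prob_nonneg hp _) (by positivity)))
    refine prob_mono hp fun S _ h => ⟨{e ∈ S | ∃ t < n, ∃ Z ∈ R t, ∃ W ∈ R t, Joins e Z W},
      {e ∈ S | ∃ Z ∈ R n, ∃ W ∈ R n, Joins e Z W}, Set.sep_subset _ _, Set.sep_subset _ _,
      ?_, ?_, hloc n S (h n (Nat.lt_succ_self n))⟩
    · rw [Set.disjoint_left]
      rintro e ⟨-, t, ht, Z, hZ, W, hW, hj⟩ ⟨-, Z', hZ', W', hW', hj'⟩
      have hd := hR (Nat.ne_of_lt ht)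
      rcases hj.eq_or_eq hj' with rfl | rfl
      · exact Set.disjoint_left.1 hd hZ hZ'
      · exact Set.disjoint_left.1 hd hZ hW'
    · intro t ht
      refine hC t ?_ (hloc t S (h t (ht.trans (Nat.lt_succ_self n))))
      rintro e ⟨he, h'⟩
      exact ⟨he, t, ht, h'⟩

end Percolation

/-! ### The discretised model -/

section Model

variable {d : ℕ}

/-- Probabilities of edges for time of mesh `1 / M`, when the death rate at `x` is at least
`g x / κ` and the bond rates at `x` are at most `κ / g x`. -/
structure IsModel (g : Vertex d → ℝ) (κ : ℝ) (M : ℕ) (p : FineEdge d → ℝ) : Prop where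
  mem_unit : ∀ e, 0 ≤ p e ∧ p e ≤ 1
  vert : ∀ x n, p (Sum.inl x, n) ≤ Real.exp (-(g x / (κ * M)))
  bond_left : ∀ x i n, Real.exp (-(κ / (M * g x))) ≤ 1 - p (Sum.inr (x, i), n)
  bond_right : ∀ x i n, Real.exp (-(κ / (M * g (x + Pi.single i 1)))) ≤ 1 - p (Sum.inr (x, i), n)

/-- The edges at a vertex. -/
def incEdge (v : Vertex d) (k : Fin d × Bool) : Edge d :=
  if k.2 then (v, k.1) else (v - Pi.single k.1 1, k.1)

/-- The neighbours of a vertex. -/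
def nbr (v : Vertex d) (k : Fin d × Bool) : Vertex d :=
  if k.2 then v + Pi.single k.1 1 else v - Pi.single k.1 1

lemma dst_nbr (v : Vertex d) (k : Fin d × Bool) : dst v (nbr v k) = 1 := by
  rcases k with ⟨i, _ | _⟩
  · have := dst_add_single (v - Pi.single i 1) i
    rw [sub_add_cancel, dst_comm] at this
    simpa [nbr] using this
  · simpa [nbr] using dst_add_single v i

/-- A horizontal edge. -/
lemma Joins.exists_incEdge {e : FineEdge d} {X Y : Site d} (h : Joins e X Y) (hne : X.1 ≠ Y.1) :
    ∃ k, e = (Sum.inr (incEdge X.1 k), X.2) ∧ Y.1 = nbr X.1 k ∧ X.2 = Y.2 := by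
  rcases h.cases with h | ⟨h1, h2, i, ⟨h3, h4⟩ | ⟨h3, h4⟩⟩
  · exact absurd h.1 hne
  · exact ⟨(i, true), by simp [incEdge, h3], by simp [nbr, h4], h1⟩
  · exact ⟨(i, false), by simp [incEdge, h3, h4], by simp [nbr, h4], h1⟩

variable {F : Finset (FineEdge d)} {p : FineEdge d → ℝ} {M : ℕ} {g : Vertex d → ℝ} {κ : ℝ}

lemma IsModel.bond (h : IsModel g κ M p) (v : Vertex d) (k : Fin d × Bool) (n : ℤ) :
    Real.exp (-(κ / (M * g v))) ≤ 1 - p (Sum.inr (incEdge v k), n) ∧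
    Real.exp (-(κ / (M * g (nbr v k)))) ≤ 1 - p (Sum.inr (incEdge v k), n) := by
  rcases k with ⟨i, _ | _⟩
  · have := h.bond_left (v - Pi.single i 1) i n
    have := h.bond_right (v - Pi.single i 1) i n
    rw [sub_add_cancel] at this
    constructor <;> simpa [incEdge, nbr]
  · have := h.bond_left v i n
    have := h.bond_right v i n
    constructor <;> simpa [incEdge, nbr]

/-- The probability that there is no death in an interval of time. -/
lemma IsModel.prob_no_death_le (h : IsModel g κ M p) (x : Vertex d) (a : ℤ) (l : ℕ) :
    prob F p (fun S => ∀ n ∈ Finset.Ico a (a + l), ((Sum.inl x, n) : FineEdge d) ∈ S) ≤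
      Real.exp (-(l * (g x / (κ * M)))) := by
  classical
  have := prob_forall_mem_le (F := F) h.mem_unit
    ((Finset.Ico a (a + l)).image fun n => ((Sum.inl x, n) : FineEdge d))
  refine le_trans (prob_mono h.mem_unit ?_) (this.trans ?_)
  · intro S _ hS e he
    obtain ⟨n, hn, rfl⟩ := Finset.mem_image.1 he
    exact hS n hn
  · rw [Finset.prod_image (by intro a _ b _ hab; simpa using hab)]
    refine (Finset.prod_le_prod (fun n _ => (h.mem_unit _).1) fun n _ => h.vert x n).trans ?_
    rw [Finset.prod_const, ← Real.exp_nat_mul, Int.card_Ico]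
    simp

/-- The probability that there is no bond in an interval of time. -/
lemma IsModel.le_prob_no_bond (h : IsModel g κ M p) (u : Edge d) {q : ℝ} (a : ℤ) (l : ℕ)
    (hq : ∀ n, Real.exp (-q) ≤ 1 - p (Sum.inr u, n)) :
    Real.exp (-(l * q)) ≤
      prob F p (fun S => ∀ n ∈ Finset.Ico a (a + l), ((Sum.inr u, n) : FineEdge d) ∉ S) := by
  classical
  have := prod_le_prob_forall_notMem (F := F) h.mem_unit
    ((Finset.Ico a (a + l)).image fun n => ((Sum.inr u, n) : FineEdge d))
  refine le_trans ?_ (this.trans (prob_mono h.mem_unit ?_))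
  · rw [Finset.prod_image (by intro a _ b _ hab; simpa using hab)]
    refine le_trans (le_of_eq ?_)
      (Finset.prod_le_prod (fun n _ => (Real.exp_pos (-q)).le) fun n _ => hq n)
    rw [Finset.prod_const, ← Real.exp_nat_mul, Int.card_Ico]
    simp
  · intro S _ hS n hn
    exact hS _ (Finset.mem_image_of_mem _ hn)

/-- A connection inside one line. -/
lemma Conn.vert_mem {S : Set (FineEdge d)} {x : Vertex d} {X Y : Site d}
    (h : Conn S {Z | Z.1 = x} X Y) {n : ℤ} (h1 : X.2 ≤ n) (h2 : n < Y.2) :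
    ((Sum.inl x, n) : FineEdge d) ∈ S := by
  induction h with
  | refl => omega
  | @tail b c _ hbc ih =>
    obtain ⟨hb, hc, e, he, hj⟩ := hbc
    by_cases hn : n < b.2
    · exact ih hn
    · have := hj.abs_le
      rcases hj.cases with ⟨-, h4, h5⟩ | ⟨h3, h4, -⟩
      · have hb' : b.1 = x := hb
        have : min b.2 c.2 = n := by omega
        rw [this, hb'] at h4
        rwa [← h4]
      · have hb' : b.1 = x := hb
        have hc' : c.1 = x := hc
        rw [hb', hc', dst_self] at h4
        omega

/-- The weight of the exponential decay. -/
def weight (m T : ℝ) (c c' : Site d) : ℝ := m * dst c.1 c'.1 + |(c.2 : ℝ) - c'.2| / T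

lemma weight_nonneg {m T : ℝ} (hm : 0 ≤ m) (hT : 0 ≤ T) (c c' : Site d) : 0 ≤ weight m T c c' := by
  unfold weight; positivity

lemma weight_triangle {m T : ℝ} (hm : 0 ≤ m) (hT : 0 ≤ T) (c c' c'' : Site d) :
    weight m T c c'' ≤ weight m T c c' + weight m T c' c'' := by
  unfold weight
  have h1 : (dst c.1 c''.1 : ℝ) ≤ dst c.1 c'.1 + dst c'.1 c''.1 := by
    exact_mod_cast dst_triangle _ _ _
  have h2 := div_le_div_of_nonneg_right (abs_sub_le (c.2 : ℝ) c'.2 c''.2) hT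
  have h3 := mul_le_mul_of_nonneg_left h1 hm
  rw [add_div] at h2
  linarith

/-- Decay where the environment is good. -/
lemma IsModel.prob_cellConn_le_of_good (h : IsModel g κ M p) (hM : 0 < M) {η m : ℝ} (hη : 0 < η)
    (hκ : 0 < κ) (hm : 0 ≤ m)
    (hs : (5 * 3 ^ d : ℕ) * ((6 * d * (κ / η) + 2 * Real.exp (-(η / κ))) * Real.exp (m + 2)) ≤ 1 / 2)
    (c c' : Site d) :
    prob F p (CellConn M {X | η ≤ g X.1} c c') ≤ Real.exp (1 - weight m 1 c c') := by
  classical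
  have hM' : (0 : ℤ) < M := by exact_mod_cast hM
  have hMr : (0 : ℝ) < M := by exact_mod_cast hM
  -- The box is a single line over three unit blocks of time. It is left through a bond, at a cost
  -- of 2d edges times 3M cells times κ/(Mη), or by surviving the whole of the block above or below.
  -- There are at most `5 * 3 ^ d` exit cells, each of weight at most `m + 2`.
  refine prob_cellConn_le_exp h.mem_unit (weight_nonneg hm zero_le_one)
    (weight_triangle hm zero_le_one)
    (fun c => {b | b.1 = c.1 ∧ c.2 - 1 ≤ b.2 ∧ b.2 ≤ c.2 + 1})
    (fun c => ballF c.1 1 ×ˢ Finset.Icc (c.2 - 2) (c.2 + 2)) ?_ ?_ ?_ ?_ c c'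
  · intro c; simp
  · rintro c b ⟨h1, h2, h3⟩
    rw [weight, h1, dst_self]
    have : |(c.2 : ℝ) - b.2| ≤ 1 := by
      rw [abs_le]
      have h2' : ((c.2 - 1 : ℤ) : ℝ) ≤ b.2 := by exact_mod_cast h2
      have h3' : (b.2 : ℝ) ≤ (c.2 + 1 : ℤ) := by exact_mod_cast h3
      push_cast at h2' h3'
      constructor <;> linarith
    simpa using this
  · rintro c w z e hj - - ⟨h1, h2, h3⟩ -
    have e1 := hj.ediv_le hM
    have e2 := hj.symm.ediv_le hM
    have e3 := hj.dst_le
    rw [cell_fst] at h1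
    rw [cell_snd] at h2 h3
    rw [h1] at e3
    simp only [Finset.mem_product, mem_ballF, cell_fst, cell_snd, Finset.mem_Icc]
    omega
  intro c
  have hexit : ∀ b, prob F p (ExitAt M {X | η ≤ g X.1}
      {b | b.1 = c.1 ∧ c.2 - 1 ≤ b.2 ∧ b.2 ≤ c.2 + 1} c b) ≤
      6 * d * (κ / η) + 2 * Real.exp (-(η / κ)) := by
    intro b
    by_cases hg : η ≤ g c.1
    swap
    · rw [prob_false]
      · positivity
      · rintro S - ⟨-, X, w, z, e, -, -, hw, -, ⟨hwQ, -⟩, -⟩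
        rw [cell_fst] at hwQ
        exact hg (hwQ ▸ hw)
    set E : Finset ((Fin d × Bool) × ℤ) :=
      Finset.univ ×ˢ Finset.Ico ((c.2 - 1) * M) ((c.2 + 2) * M) with hE
    have e1 : prob F p (ExitAt M {X | η ≤ g X.1}
        {b | b.1 = c.1 ∧ c.2 - 1 ≤ b.2 ∧ b.2 ≤ c.2 + 1} c b) ≤
        prob F p (fun S => (∃ k ∈ E, ((Sum.inr (incEdge c.1 k.1), k.2) : FineEdge d) ∈ S) ∨
          ((∀ n ∈ Finset.Ico ((c.2 + 1) * M) ((c.2 + 1) * M + M),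
            ((Sum.inl c.1, n) : FineEdge d) ∈ S) ∨
          (∀ n ∈ Finset.Ico ((c.2 - 1) * M) ((c.2 - 1) * M + M),
            ((Sum.inl c.1, n) : FineEdge d) ∈ S))) := by
      refine prob_mono h.mem_unit ?_
      rintro S - ⟨hb, X, w, z, e, hX, hXw, hw, hz, ⟨hw1, hw2, hw3⟩, he, hj, rfl⟩
      rw [cell_fst] at hw1
      rw [cell_snd] at hw2 hw3
      have b1 := Int.emod_add_mul_ediv w.2 M
      have b2 := Int.emod_nonneg w.2 hM'.ne'
      have b3 := Int.emod_lt_of_pos w.2 hM'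
      by_cases hzx : w.1 = z.1
      · right
        have hline : Conn S {Z | Z.1 = c.1} X z := by
          refine Relation.ReflTransGen.tail (hXw.mono le_rfl ?_) ⟨hw1, hzx.symm.trans hw1, e, he, hj⟩
          rintro Z ⟨-, h1, -⟩
          exact h1
        have c1 := Int.emod_add_mul_ediv z.2 M
        have c2 := Int.emod_nonneg z.2 hM'.ne'
        have c3 := Int.emod_lt_of_pos z.2 hM'
        have a1 := Int.emod_add_mul_ediv X.2 M
        have a2 := Int.emod_nonneg X.2 hM'.ne'
        have a3 := Int.emod_lt_of_pos X.2 hM'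
        have hXc : X.2 / M = c.2 := by rw [← hX]; rfl
        rw [hXc] at a1
        have hz' : z.2 / M < c.2 - 1 ∨ c.2 + 1 < z.2 / M := by
          by_contra hcon
          push Not at hcon
          exact hb ⟨by rw [cell_fst, ← hzx, hw1], hcon⟩
        rcases hz' with hz' | hz'
        · right
          intro n hn
          rw [Finset.mem_Ico] at hn
          refine hline.symm.vert_mem ?_ ?_
          · nlinarith
          · nlinarith
        · left
          intro n hn
          rw [Finset.mem_Ico] at hn
          refine hline.vert_mem ?_ ?_
          · nlinarith
          · nlinarith
      · left
        obtain ⟨k, hk1, -, -⟩ := hj.exists_incEdge hzx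
        refine ⟨(k, w.2), ?_, ?_⟩
        · simp only [hE, Finset.mem_product, Finset.mem_univ, true_and, Finset.mem_Ico]
          constructor <;> nlinarith
        · simp only
          rw [← hw1, ← hk1]; exact he
    refine e1.trans ((prob_or_le h.mem_unit _ _).trans (add_le_add ?_ ?_))
    · refine (prob_exists_le h.mem_unit _ _).trans ?_
      have hle : ∀ k ∈ E, prob F p (fun S => ((Sum.inr (incEdge c.1 k.1), k.2) : FineEdge d) ∈ S) ≤
          κ / (M * η) := by
        intro k _
        refine (prob_mem_le h.mem_unit _).trans ?_
        have q1 := (h.bond c.1 k.1 k.2).1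
        have q2 := Real.add_one_le_exp (-(κ / (M * g c.1)))
        have q3 : κ / (M * g c.1) ≤ κ / (M * η) := by gcongr
        linarith
      refine (Finset.sum_le_card_nsmul _ _ _ hle).trans (le_of_eq ?_)
      have hcard : E.card = 2 * d * (3 * M) := by
        rw [hE, Finset.card_product, Int.card_Ico]
        simp only [Finset.card_univ, Fintype.card_prod, Fintype.card_fin, Fintype.card_bool]
        have : ((c.2 + 2) * M - (c.2 - 1) * M : ℤ).toNat = 3 * M := by
          have : ((c.2 + 2) * M - (c.2 - 1) * M : ℤ) = ((3 * M : ℕ) : ℤ) := by push_cast; ring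
          rw [this, Int.toNat_natCast]
        rw [this]; ring
      rw [hcard, nsmul_eq_mul]
      push_cast
      field_simp
      ring
    · refine (prob_or_le h.mem_unit _ _).trans ?_
      have hv : ∀ a : ℤ, prob F p (fun S => ∀ n ∈ Finset.Ico a (a + M),
          ((Sum.inl c.1, n) : FineEdge d) ∈ S) ≤ Real.exp (-(η / κ)) := by
        intro a
        refine (h.prob_no_death_le c.1 a M).trans (Real.exp_le_exp.2 ?_)
        have : (M : ℝ) * (g c.1 / (κ * M)) = g c.1 / κ := by field_simp
        rw [this]
        have : η / κ ≤ g c.1 / κ := by gcongr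
        linarith
      linarith [hv ((c.2 + 1) * M), hv ((c.2 - 1) * M)]
  have hq : 0 ≤ 6 * d * (κ / η) + 2 * Real.exp (-(η / κ)) := by positivity
  refine (Finset.sum_le_card_nsmul _ _
    ((6 * d * (κ / η) + 2 * Real.exp (-(η / κ))) * Real.exp (m + 2)) fun b hb => ?_).trans ?_
  · refine mul_le_mul (hexit b) (Real.exp_le_exp.2 ?_) (Real.exp_pos _).le hq
    simp only [Finset.mem_product, mem_ballF, Finset.mem_Icc] at hb
    have h1 : (dst c.1 b.1 : ℝ) ≤ 1 := by exact_mod_cast hb.1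
    have h2 : |(c.2 : ℝ) - b.2| ≤ 2 := by
      rw [abs_le]
      have h2' : ((c.2 - 2 : ℤ) : ℝ) ≤ b.2 := by exact_mod_cast hb.2.1
      have h3' : (b.2 : ℝ) ≤ (c.2 + 2 : ℤ) := by exact_mod_cast hb.2.2
      push_cast at h2' h3'
      constructor <;> linarith
    unfold weight
    rw [div_one]
    nlinarith
  · rw [nsmul_eq_mul]
    refine le_trans (mul_le_mul_of_nonneg_right ?_ (by positivity)) hs
    rw [Finset.card_product, Int.card_Icc]
    have h1 : (c.2 + 2 + 1 - (c.2 - 2)).toNat = 5 := by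
      have : c.2 + 2 + 1 - (c.2 - 2) = (5 : ℕ) := by push_cast; ring
      rw [this]; rfl
    rw [h1, mul_comm]
    exact_mod_cast Nat.mul_le_mul_left 5 (by simpa using card_ballF_le c.1 1)

end Model

/-! ### Blocking a slab of time -/

section Blocking

variable {d : ℕ} {F : Finset (FineEdge d)} {p : FineEdge d → ℝ} {M : ℕ} {g : Vertex d → ℝ} {κ : ℝ}

/-- If every line of `V` has a death shortly after time `s`, without bonds at `V` around it, and no
connection off `V` goes from the bottom, or from near `V` before time `s`, to the time `t`, then no
connection goes from the bottom to the time `t`. -/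
lemma Conn.lt_of_blocked {S : Set (FineEdge d)} {A : Set (Site d)} {V : Finset (Vertex d)}
    {bot : Site d → Prop} {s t : ℤ} {J : Vertex d → ℤ} (hJ : ∀ v ∈ V, s + J v ≤ t)
    (hdeath : ∀ v ∈ V, ∃ n, s ≤ n ∧ n < s + J v ∧ ((Sum.inl v, n) : FineEdge d) ∉ S)
    (hin : ∀ v ∈ V, ∀ k n, s ≤ n → n < s + J v →
      ((Sum.inr (incEdge v k), n) : FineEdge d) ∉ S)
    (hout : ∀ v ∈ V, ∀ k n, nbr v k ∉ V → (nbr v k, n) ∈ A → s ≤ n → n < t →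
      ((Sum.inr (incEdge v k), n) : FineEdge d) ∉ S)
    (hexc : ∀ v ∈ V, ∀ k X Y, X.1 = nbr v k → nbr v k ∉ V → X.2 < s →
      Conn S (A \ {Z | Z.1 ∈ V}) X Y → Y.2 < t)
    (hbot : ∀ X Y, bot X → X.1 ∉ V → Conn S (A \ {Z | Z.1 ∈ V}) X Y → Y.2 < t)
    (hbs : ∀ X, bot X → X.2 < s)
    {X Y : Site d} (hX : bot X) (h : Conn S A X Y) : Y.2 < t := by
  classical
  choose! δ hδ1 hδ2 hδ3 using hdeath
  have hoff : ∀ X₀ Y : Site d, (bot X₀ ∧ X₀.1 ∉ V ∨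
      ∃ v ∈ V, ∃ k, X₀.1 = nbr v k ∧ nbr v k ∉ V ∧ X₀.2 < s) →
      Conn S (A \ {Z | Z.1 ∈ V}) X₀ Y → Y.2 < t := by
    rintro X₀ Y (⟨h1, h2⟩ | ⟨v, hv, k, h1, h2, h3⟩) hc
    · exact hbot X₀ Y h1 h2 hc
    · exact hexc v hv k X₀ Y h1 h2 h3 hc
  -- The invariant along the connection: on `V` it stays below the chosen death of its line; off `V`
  -- it is on an excursion that began at the bottom or beside `V` before time `s`.
  have key : (Y.1 ∈ V ∧ Y.2 ≤ δ Y.1) ∨ (Y.1 ∉ V ∧ ∃ X₀, (bot X₀ ∧ X₀.1 ∉ V ∨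
      ∃ v ∈ V, ∃ k, X₀.1 = nbr v k ∧ nbr v k ∉ V ∧ X₀.2 < s) ∧
      Conn S (A \ {Z | Z.1 ∈ V}) X₀ Y) := by
    induction h with
    | refl =>
      by_cases hV : X.1 ∈ V
      · exact Or.inl ⟨hV, by linarith [hbs X hX, hδ1 _ hV]⟩
      · exact Or.inr ⟨hV, X, Or.inl ⟨hX, hV⟩, .refl⟩
    | @tail b c _ hbc ih =>
      obtain ⟨hbA, hcA, e, he, hj⟩ := hbc
      rcases ih with ⟨hbV, hb⟩ | ⟨hbV, X₀, hX₀, hc₀⟩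
      · by_cases hbc1 : b.1 = c.1
        · left
          rw [← hbc1]
          refine ⟨hbV, ?_⟩
          rcases hj.cases with ⟨-, h1, h2⟩ | ⟨-, h1, -⟩
          · rcases h2 with h2 | h2
            · by_contra hcon
              have h3 : min b.2 c.2 = δ b.1 := by omega
              rw [h3] at h1
              exact hδ3 _ hbV (h1 ▸ he)
            · omega
          · rw [hbc1, dst_self] at h1; omega
        · obtain ⟨k, hk1, hk2, hk3⟩ := hj.exists_incEdge hbc1
          by_cases hcV : c.1 ∈ V
          · refine Or.inl ⟨hcV, ?_⟩
            by_contra hcon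
            have h1 := hδ1 _ hcV
            have h2 := hδ2 _ hbV
            exact hin _ hbV k b.2 (by omega) (by omega) (hk1 ▸ he)
          · refine Or.inr ⟨hcV, c, Or.inr ⟨b.1, hbV, k, hk2, hk2 ▸ hcV, ?_⟩, .refl⟩
            by_contra hcon
            have h2 := hδ2 _ hbV
            have h3 := hJ _ hbV
            refine hout _ hbV k b.2 (hk2 ▸ hcV) ?_ (by omega) (by omega) (hk1 ▸ he)
            rw [← hk2, hk3]; exact hcA
      · have hbt := hoff X₀ b hX₀ hc₀
        by_cases hcV : c.1 ∈ V
        · have hne : c.1 ≠ b.1 := fun h => hbV (h ▸ hcV)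
          obtain ⟨k, hk1, hk2, hk3⟩ := hj.symm.exists_incEdge hne
          refine Or.inl ⟨hcV, ?_⟩
          by_contra hcon
          have h1 := hδ1 _ hcV
          refine hout _ hcV k c.2 (hk2 ▸ hbV) ?_ (by omega) (by omega) (hk1 ▸ he)
          rw [← hk2, hk3]; exact hbA
        · exact Or.inr ⟨hcV, X₀, hX₀, hc₀.tail ⟨⟨hbA, hbV⟩, ⟨hcA, hcV⟩, e, he, hj⟩⟩
  rcases key with ⟨h1, h2⟩ | ⟨-, X₀, h1, h2⟩
  · linarith [hδ2 _ h1, hJ _ h1]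
  · exact hoff X₀ Y h1 h2

/-- A connection off `V` from the line of `b` before time `s` to the time `t`. -/
def Excursion (A : Set (Site d)) (V : Finset (Vertex d)) (s t : ℤ) (b : Vertex d)
    (S : Set (FineEdge d)) : Prop :=
  ∃ X Y : Site d, X.1 = b ∧ X.2 < s ∧ t ≤ Y.2 ∧ Conn S (A \ {Z | Z.1 ∈ V}) X Y

lemma excursion_monotone (A : Set (Site d)) (V : Finset (Vertex d)) (s t : ℤ) (b : Vertex d) :
    Monotone (Excursion A V s t b) := by
  rintro S T h ⟨X, Y, h1, h2, h3, h4⟩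
  exact ⟨X, Y, h1, h2, h3, h4.mono h le_rfl⟩

/-- A lower bound for the probability that a slab is not crossed. -/
lemma IsModel.prob_crossing_le (h : IsModel g κ M p) (hκ : 0 < κ) (hκ1 : κ ≤ 1) {A : Set (Site d)}
    {V : Finset (Vertex d)} {bot : Site d → Prop} {s : ℤ} {a : ℕ} (ha : 1 ≤ a) {η : ℝ}
    (hη : 0 < η) (hκa : κ * a ≤ η) (hη1 : η ≤ (1 / 2) * (Real.exp (-2) * (1 / 2)) ^ (2 * d))
    (hV : ∀ v ∈ V, 0 < g v ∧ g v ≤ η ∧ 1 ≤ M * g v)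
    (hout : ∀ v ∈ V, ∀ X ∈ A, X.1 ∉ V → dst v X.1 = 1 → η ≤ g X.1)
    (hexc : ∀ v ∈ V, ∀ k, nbr v k ∉ V →
      prob F p (Excursion A V (s * M) ((s + a) * M) (nbr v k)) ≤ 1 / 2)
    (hbot : prob F p (fun S => ∃ X Y, bot X ∧ X.1 ∉ V ∧ (s + a) * M ≤ Y.2 ∧
      Conn S (A \ {Z | Z.1 ∈ V}) X Y) ≤ 1 / 2)
    (hbs : ∀ X, bot X → X.2 < s * M) :
    prob F p (fun S => ∃ X Y, bot X ∧ (s + a) * M ≤ Y.2 ∧ Conn S A X Y) ≤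
      1 - (1 / 2) * ∏ v ∈ V, g v ^ 3 := by
  classical
  have hM : V.Nonempty → 0 < M := by
    rintro ⟨v, hv⟩
    by_contra hcon
    have : M = 0 := by omega
    have := (hV v hv).2.2
    simp_all
    linarith
  have hc1 : (Real.exp (-2) * (1 / 2)) ^ (2 * d) ≤ (1 : ℝ) := by
    refine pow_le_one₀ (by positivity) ?_
    have : Real.exp (-2) ≤ 1 := Real.exp_le_one_iff.2 (by norm_num)
    linarith
  have hη2 : η ≤ 1 / 2 := by linarith
  -- A window of real length about `g v`. It is short enough that bonds at rate at most `κ / g v`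
  -- are absent with probability bounded below, and long enough for a death with probability at
  -- least `g v ^ 2 / 2`.
  set J : Vertex d → ℕ := fun v => ⌈g v * M⌉₊ with hJdef
  -- Edges to good neighbours outside `V` have to stay closed up to the top of the slab, since the
  -- excursions come back through them; at a bond rate of at most `κ / η` this is affordable by
  -- `hκa`. For the other edges the short window of `v` is enough.
  set len : Vertex d → (Fin d × Bool) → ℕ := fun v k =>
    if nbr v k ∉ V ∧ η ≤ g (nbr v k) then a * M else J v with hlen
  have hJM : ∀ v ∈ V, J v ≤ M := by
    intro v hv
    refine Nat.ceil_le.2 ?_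
    have := (hV v hv).2.1
    have hMr : (0 : ℝ) ≤ M := Nat.cast_nonneg _
    nlinarith
  have hJlen : ∀ v ∈ V, ∀ k, J v ≤ len v k := by
    intro v hv k
    simp only [hlen]
    split_ifs
    · exact (hJM v hv).trans (Nat.le_mul_of_pos_left _ ha)
    · exact le_rfl
  set D : Vertex d → Set (FineEdge d) → Prop := fun v S =>
    ¬ ∀ n ∈ Finset.Ico (s * M) (s * M + J v), ((Sum.inl v, n) : FineEdge d) ∈ S with hD
  set I : Vertex d → (Fin d × Bool) → Set (FineEdge d) → Prop := fun v k S =>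
    ∀ n ∈ Finset.Ico (s * M) (s * M + len v k), ((Sum.inr (incEdge v k), n) : FineEdge d) ∉ S
    with hI
  set X : Vertex d → (Fin d × Bool) → Set (FineEdge d) → Prop := fun v k S =>
    ¬ (nbr v k ∉ V ∧ Excursion A V (s * M) ((s + a) * M) (nbr v k) S) with hXdef
  set B : Set (FineEdge d) → Prop := fun S => ¬ ∃ X Y, bot X ∧ X.1 ∉ V ∧ (s + a) * M ≤ Y.2 ∧
      Conn S (A \ {Z | Z.1 ∈ V}) X Y with hB
  have aD : ∀ v, Antitone (D v) := fun v S T hST hT hS => hT fun n hn => hST (hS n hn)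
  have aI : ∀ v k, Antitone (I v k) := fun v k S T hST hT n hn hS => hT n hn (hST hS)
  have aX : ∀ v k, Antitone (X v k) := fun v k S T hST hT hS =>
    hT ⟨hS.1, excursion_monotone _ _ _ _ _ hST hS.2⟩
  have aB : Antitone B := by
    rintro S T hST hT ⟨X, Y, h1, h2, h3, h4⟩
    exact hT ⟨X, Y, h1, h2, h3, h4.mono hST le_rfl⟩
  have pD : ∀ v ∈ V, g v ^ 2 / 2 ≤ prob F p (D v) := by
    intro v hv
    obtain ⟨g1, g2, g3⟩ := hV v hv
    have hM0 : (0 : ℝ) < M := by exact_mod_cast hM ⟨v, hv⟩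
    rw [hD, prob_not]
    have e1 := h.prob_no_death_le (F := F) v (s * M) (J v)
    have e2 : g v ^ 2 ≤ J v * (g v / (κ * M)) := by
      have : g v * M ≤ J v := Nat.le_ceil _
      calc g v ^ 2 ≤ g v ^ 2 / κ := by rw [le_div_iff₀ hκ]; nlinarith [sq_nonneg (g v)]
        _ = g v * M * (g v / (κ * M)) := by field_simp
        _ ≤ _ := mul_le_mul_of_nonneg_right this (by positivity)
    have e3 : Real.exp (-(J v * (g v / (κ * M)))) ≤ Real.exp (-(g v ^ 2)) :=
      Real.exp_le_exp.2 (by linarith)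
    have e4 : Real.exp (-(g v ^ 2)) ≤ 1 - g v ^ 2 / 2 := by
      have e5 : Real.exp (-(g v ^ 2)) ≤ (1 + g v ^ 2)⁻¹ := by
        rw [Real.exp_neg]
        exact inv_anti₀ (by positivity) (by linarith [Real.add_one_le_exp (g v ^ 2)])
      refine e5.trans ?_
      rw [inv_le_iff_one_le_mul₀ (by positivity)]
      have : g v ^ 2 ≤ 1 := by nlinarith
      nlinarith [sq_nonneg (g v)]
    linarith
  have pI : ∀ v ∈ V, ∀ k, Real.exp (-2) ≤ prob F p (I v k) := by
    intro v hv k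
    obtain ⟨g1, g2, g3⟩ := hV v hv
    have hM0 : (0 : ℝ) < M := by exact_mod_cast hM ⟨v, hv⟩
    simp only [hI, hlen]
    split_ifs with hc
    · refine le_trans (Real.exp_le_exp.2 ?_) (h.le_prob_no_bond (F := F) (incEdge v k) (s * M) (a * M)
        fun n => (h.bond v k n).2)
      have e1 : ((a * M : ℕ) : ℝ) * (κ / (M * g (nbr v k))) = κ * a / g (nbr v k) := by
        have := hη.trans_le hc.2
        push_cast; field_simp
      rw [e1]
      have : κ * a / g (nbr v k) ≤ 1 := by
        rw [div_le_one (hη.trans_le hc.2)]; linarith [hc.2]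
      linarith
    · refine le_trans (Real.exp_le_exp.2 ?_) (h.le_prob_no_bond (F := F) (incEdge v k) (s * M) (J v)
        fun n => (h.bond v k n).1)
      have e1 : (J v : ℝ) < g v * M + 1 := Nat.ceil_lt_add_one (by positivity)
      have e2 : (J v : ℝ) * (κ / (M * g v)) ≤ 2 * (M * g v) * (κ / (M * g v)) :=
        mul_le_mul_of_nonneg_right (by linarith) (by positivity)
      have e3 : 2 * (M * g v) * (κ / (M * g v)) = 2 * κ := by field_simp
      linarith
  have pX : ∀ v ∈ V, ∀ k, 1 / 2 ≤ prob F p (X v k) := by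
    intro v hv k
    rw [hXdef, prob_not]
    by_cases hk : nbr v k ∈ V
    · rw [prob_false (by intro S _ hS; exact hS.1 hk)]; norm_num
    · have := prob_mono (F := F) h.mem_unit (A := fun S => nbr v k ∉ V ∧
        Excursion A V (s * M) ((s + a) * M) (nbr v k) S) (B := Excursion A V (s * M) ((s + a) * M)
          (nbr v k)) fun S _ hS => hS.2
      linarith [hexc v hv k hk]
  have pB : 1 / 2 ≤ prob F p B := by rw [hB, prob_not]; linarith
  have pIX : ∀ v ∈ V, (Real.exp (-2) * (1 / 2)) ^ (2 * d) ≤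
      prob F p (fun S => ∀ k ∈ Finset.univ, I v k S ∧ X v k S) := by
    intro v hv
    refine le_trans (le_of_eq ?_) ((Finset.prod_le_prod (s := Finset.univ)
      (f := fun _ : Fin d × Bool => Real.exp (-2) * (1 / 2)) (fun _ _ => by positivity)
      fun k _ => (mul_le_mul (pI v hv k) (pX v hv k) (by norm_num) (prob_nonneg h.mem_unit _)).trans
        (prob_mul_le_and h.mem_unit (aI v k) (aX v k))).trans
      (prod_prob_le_forall h.mem_unit _ fun k _ => ?_))
    · rw [Finset.prod_const, Finset.card_univ, Fintype.card_prod, Fintype.card_fin,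
        Fintype.card_bool, mul_comm d]
    · intro S T hST hT; exact ⟨aI v k hST hT.1, aX v k hST hT.2⟩
  set K : Vertex d → Set (FineEdge d) → Prop := fun v S =>
    D v S ∧ ∀ k ∈ Finset.univ, I v k S ∧ X v k S with hK
  have aIX : ∀ v, Antitone fun S => ∀ k ∈ Finset.univ, I v k S ∧ X v k S :=
    fun v S T hST hT k hk => ⟨aI v k hST (hT k hk).1, aX v k hST (hT k hk).2⟩
  have aK : ∀ v, Antitone (K v) := fun v S T hST hT => ⟨aD v hST hT.1, aIX v hST hT.2⟩
  -- The death costs `g v ^ 2 / 2` and the remaining events a constant. The smallness of `η` lets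
  -- one further factor `g v` absorb all constants.
  have pK : ∀ v ∈ V, g v ^ 3 ≤ prob F p (K v) := by
    intro v hv
    obtain ⟨g1, g2, g3⟩ := hV v hv
    refine le_trans ?_ ((mul_le_mul (pD v hv) (pIX v hv) (by positivity)
      (prob_nonneg h.mem_unit _)).trans (prob_mul_le_and h.mem_unit (aD v) (aIX v)))
    have : g v ≤ (1 / 2) * (Real.exp (-2) * (1 / 2)) ^ (2 * d) := g2.trans hη1
    calc g v ^ 3 = g v ^ 2 * g v := by ring
      _ ≤ g v ^ 2 * ((1 / 2) * (Real.exp (-2) * (1 / 2)) ^ (2 * d)) :=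
        mul_le_mul_of_nonneg_left this (sq_nonneg _)
      _ = _ := by ring
  have pall : (∏ v ∈ V, g v ^ 3) * (1 / 2) ≤ prob F p (fun S => (∀ v ∈ V, K v S) ∧ B S) := by
    have e1 := (Finset.prod_le_prod (fun v hv => by have := (hV v hv).1; positivity) pK).trans
      (prod_prob_le_forall h.mem_unit V fun v _ => aK v)
    refine (mul_le_mul e1 pB (by norm_num) (prob_nonneg h.mem_unit _)).trans
      (prob_mul_le_and h.mem_unit ?_ aB)
    intro S T hST hT v hv
    exact aK v hST (hT v hv)
  have hfin : prob F p (fun S => (∀ v ∈ V, K v S) ∧ B S) ≤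
      prob F p (fun S => ¬ ∃ X Y, bot X ∧ (s + a) * M ≤ Y.2 ∧ Conn S A X Y) := by
    refine prob_mono h.mem_unit ?_
    rintro S - ⟨hKS, hBS⟩ ⟨X₀, Y₀, hX₀, hY₀, hc⟩
    refine absurd (Conn.lt_of_blocked (V := V) (bot := bot) (s := s * M) (t := (s + a) * M)
      (J := fun v => J v) ?_ ?_ ?_ ?_ ?_ ?_ hbs hX₀ hc) (not_lt.2 hY₀)
    · intro v hv
      have e1 : (J v : ℤ) ≤ M := by exact_mod_cast hJM v hv
      have e2 : (1 : ℤ) ≤ a := by exact_mod_cast ha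
      have e3 : (0 : ℤ) ≤ M := Int.natCast_nonneg _
      nlinarith
    · intro v hv
      have := (hKS v hv).1
      simp only [hD, not_forall, Finset.mem_Ico] at this
      obtain ⟨n, hn, hnS⟩ := this
      exact ⟨n, hn.1, hn.2, hnS⟩
    · intro v hv k n h1 h2
      refine ((hKS v hv).2 k (Finset.mem_univ _)).1 n (Finset.mem_Ico.2 ⟨h1, h2.trans_le ?_⟩)
      have : (J v : ℤ) ≤ len v k := by exact_mod_cast hJlen v hv k
      linarith
    · intro v hv k n hk hA h1 h2
      refine ((hKS v hv).2 k (Finset.mem_univ _)).1 n (Finset.mem_Ico.2 ⟨h1, h2.trans_le ?_⟩)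
      have : len v k = a * M := by
        simp only [hlen]
        rw [if_pos ⟨hk, hout v hv _ hA hk (dst_nbr v k)⟩]
      rw [this]; push_cast; linarith
    · intro v hv k X Y hX hk hXs hcon
      by_contra hY
      exact ((hKS v hv).2 k (Finset.mem_univ _)).2 ⟨hk, X, Y, hX, hXs, not_lt.1 hY, hcon⟩
    · intro X Y hX hXV hcon
      by_contra hY
      exact hBS ⟨X, Y, hX, hXV, not_lt.1 hY, hcon⟩
  rw [prob_not] at hfin
  linarith

end Blocking

/-! ### Scales -/

section Scales

/-- The ratio of the logarithms of consecutive scales. -/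
def ratio (N : ℕ) : ℕ := 2 * (N + 1)

/-- The sequence of scales. -/
def scale (b N k : ℕ) : ℕ := b ^ ratio N ^ k

/-- The threshold of badness at level `k`. -/
def thr (b N β k : ℕ) : ℝ := ((scale b N k : ℝ) ^ β)⁻¹

/-- The correlation time at level `k`. -/
def corrTime (b N β k : ℕ) : ℕ := scale b N k ^ (β * (12 * N + 1))

variable {b N β : ℕ}

lemma scale_succ (k : ℕ) : scale b N (k + 1) = scale b N k ^ ratio N := by
  rw [scale, scale, pow_succ, pow_mul]

lemma scale_pos (hb : 0 < b) (k : ℕ) : 0 < scale b N k := Nat.pow_pos hb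

lemma ratio_pos : 0 < ratio N := by unfold ratio; omega

lemma le_scale (k : ℕ) : b ≤ scale b N k :=
  Nat.le_self_pow (pow_ne_zero _ ratio_pos.ne') b

lemma scale_mono : Monotone (scale b N) := by
  refine monotone_nat_of_le_succ fun k => ?_
  rw [scale_succ]
  exact Nat.le_self_pow ratio_pos.ne' _

lemma two_pow_le_scale (hb : 2 ≤ b) (k : ℕ) : 2 ^ (k + 1) ≤ scale b N k := by
  refine (Nat.pow_le_pow_left hb _).trans (Nat.pow_le_pow_right (by omega) ?_)
  have h2 : 1 < ratio N := by unfold ratio; omega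
  exact Nat.lt_pow_self h2

lemma thr_pos (hb : 0 < b) (k : ℕ) : 0 < thr b N β k := by
  have : (0 : ℝ) < scale b N k := by exact_mod_cast scale_pos hb k
  unfold thr; positivity

lemma thr_succ (k : ℕ) : thr b N β (k + 1) = thr b N β k ^ ratio N := by
  rw [thr, thr, scale_succ, inv_pow, ← pow_mul, Nat.cast_pow, ← pow_mul, mul_comm]

lemma thr_anti (hb : 0 < b) : Antitone (thr b N β) := by
  intro j k hjk
  have h1 : (0 : ℝ) < scale b N j := by exact_mod_cast scale_pos hb j
  have h2 : (scale b N j : ℝ) ≤ scale b N k := by exact_mod_cast scale_mono hjk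
  unfold thr
  exact inv_anti₀ (by positivity) (pow_le_pow_left₀ h1.le h2 _)

lemma thr_le_one (hb : 0 < b) (k : ℕ) : thr b N β k ≤ 1 := by
  have h1 : (1 : ℝ) ≤ scale b N k := by exact_mod_cast scale_pos hb k
  exact inv_le_one_of_one_le₀ (one_le_pow₀ h1)

lemma corrTime_pos (hb : 0 < b) (k : ℕ) : 0 < corrTime b N β k := Nat.pow_pos (scale_pos hb k)

lemma corrTime_mono : Monotone (corrTime b N β) :=
  fun _ _ h => Nat.pow_le_pow_left (scale_mono h) _

end Scales

/-! ### Separated environments -/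

section Closure

variable {d : ℕ}

/-- With factors in [0, 1], repeated or superfluous factors only decrease a product. Hence overlaps
between closures need no bookkeeping. -/
lemma prod_mul_prod_le_prod_of_subset {ι : Type*} [DecidableEq ι] {f : ι → ℝ} {s t u : Finset ι}
    (hu : u ⊆ s ∪ t) (h : ∀ i ∈ s ∪ t, 0 ≤ f i ∧ f i ≤ 1) :
    (∏ i ∈ s, f i) * ∏ i ∈ t, f i ≤ ∏ i ∈ u, f i := by
  have h1 : ∏ i ∈ s ∪ t, f i ≤ ∏ i ∈ u, f i := by
    rw [← Finset.prod_sdiff hu]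
    exact mul_le_of_le_one_left (Finset.prod_nonneg fun i hi => (h i (hu hi)).1)
      (Finset.prod_le_one (fun i hi => (h i (Finset.mem_sdiff.1 hi).1).1)
        fun i hi => (h i (Finset.mem_sdiff.1 hi).1).2)
  refine le_trans ?_ h1
  have h2 := Finset.prod_union_inter (s₁ := s) (s₂ := t) (f := f)
  rw [← h2]
  refine mul_le_of_le_one_right (Finset.prod_nonneg fun i hi => (h i hi).1)
    (Finset.prod_le_one (fun i hi => (h i ?_).1) fun i hi => (h i ?_).2) <;>
  exact Finset.mem_union_left _ (Finset.mem_inter.1 hi).1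

lemma prod_prod_le_prod_biUnion {ι κ : Type*} [DecidableEq ι] [DecidableEq κ] {f : ι → ℝ}
    (s : Finset κ) (t : κ → Finset ι) (h : ∀ k ∈ s, ∀ i ∈ t k, 0 ≤ f i ∧ f i ≤ 1) :
    ∏ k ∈ s, ∏ i ∈ t k, f i ≤ ∏ i ∈ s.biUnion t, f i := by
  induction s using Finset.induction_on with
  | empty => simp
  | insert k s hk ih =>
    rw [Finset.prod_insert hk]
    refine (mul_le_mul_of_nonneg_left (ih fun j hj => h j (Finset.mem_insert_of_mem hj))
      (Finset.prod_nonneg fun i hi => (h k (Finset.mem_insert_self _ _) i hi).1)).trans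
      (prod_mul_prod_le_prod_of_subset (by rw [Finset.biUnion_insert]) ?_)
    intro i hi
    rcases Finset.mem_union.1 hi with hi | hi
    · exact h k (Finset.mem_insert_self _ _) i hi
    · obtain ⟨j, hj, hij⟩ := Finset.mem_biUnion.1 hi
      exact h j (Finset.mem_insert_of_mem hj) i hij

variable {b N β : ℕ} {g : Vertex d → ℝ}

/-- Bad vertices of each level are scarce. -/
def IsSeparated (b N β : ℕ) (g : Vertex d → ℝ) : Prop :=
  ∀ k x, ((ballF x (scale b N k ^ 5)).filter fun z => g z < thr b N β k).card ≤ N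

/-- `z` is bad of level `k`. -/
def HasLevel (b N β : ℕ) (g : Vertex d → ℝ) (k : ℕ) (z : Vertex d) : Prop :=
  thr b N β (k + 1) ≤ g z ∧ g z < thr b N β k

/-- `V` contains the bad vertices of levels less than `k` near its elements. -/
def IsClosedBelow (b N β : ℕ) (g : Vertex d → ℝ) (k : ℕ) (V : Finset (Vertex d)) : Prop :=
  ∀ j < k, ∀ z, HasLevel b N β g j z → ∀ v ∈ V, dst v z ≤ scale b N j ^ 4 → z ∈ V

/-- Induction on the level: to the closure of `a` one adds, greedily, the closures of bad vertices
of level `k` found nearby. Separation stops this after at most `N` additions. The vertex `a` is left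
out of the product because nothing is assumed about `g a`. -/
lemma IsSeparated.exists_closure (hg : IsSeparated b N β g) (hb : 0 < b) (hN : 2 ≤ N)
    (hball : ∀ y ≥ b, (N + 1) * (2 * y + y ^ 4) ≤ y ^ 5) (k : ℕ) (a : Vertex d) :
    ∃ V : Finset (Vertex d), a ∈ V ∧ (∀ v ∈ V, dst a v ≤ scale b N k) ∧
      (∀ v ∈ V, v ≠ a → g v < thr b N β 0 ∧ thr b N β k ≤ g v) ∧ IsClosedBelow b N β g k V ∧
      thr b N β k ^ (6 * N) ≤ ∏ v ∈ V.erase a, g v ^ 3 := by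
  classical
  induction k generalizing a with
  | zero =>
    refine ⟨{a}, by simp, by simp [dst_self], ?_, fun j hj => absurd hj (Nat.not_lt_zero j), ?_⟩
    · intro v hv hne; exact absurd (Finset.mem_singleton.1 hv) hne
    · simp only [Finset.erase_singleton, Finset.prod_empty]
      exact pow_le_one₀ (thr_pos hb _).le (thr_le_one hb _)
  | succ k ih =>
    choose cl hcl1 hcl2 hcl3 hcl4 hcl5 using ih
    set y := scale b N k with hy
    have hyb : b ≤ y := le_scale k
    set V : Finset (Vertex d) → Finset (Vertex d) := fun Y => cl a ∪ Y.biUnion cl with hV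
    set Ok : Finset (Vertex d) → Prop := fun Y =>
      (∀ z ∈ Y, HasLevel b N β g k z) ∧ (∀ z ∈ Y, dst a z ≤ Y.card * (2 * y + y ^ 4)) with hOk
    have hdist : ∀ Y, Ok Y → ∀ v ∈ V Y, dst a v ≤ Y.card * (2 * y + y ^ 4) + y := by
      intro Y hY v hv
      rcases Finset.mem_union.1 hv with hv | hv
      · exact (hcl2 a v hv).trans (Nat.le_add_left _ _)
      · obtain ⟨z, hz, hvz⟩ := Finset.mem_biUnion.1 hv
        exact (dst_triangle a z v).trans (add_le_add (hY.2 z hz) (hcl2 z v hvz))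
    have hcard : ∀ Y, Ok Y → Y.card ≤ N + 1 → Y.card ≤ N := by
      intro Y hY hYc
      refine le_trans (Finset.card_le_card fun z hz => ?_) (hg k a)
      refine Finset.mem_filter.2 ⟨mem_ballF.2 ((hY.2 z hz).trans ?_), (hY.1 z hz).2⟩
      exact (Nat.mul_le_mul_right _ hYc).trans (hball y hyb)
    -- Either the greedy process has stopped or it has found `n` vertices. Reaching `N + 1` is
    -- impossible: by `hball` they would all lie in the ball of radius `y ^ 5` around `a`.
    have key : ∀ n ≤ N + 1, (∃ Y, Ok Y ∧ Y.card = n) ∨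
        ∃ Y, Ok Y ∧ Y.card ≤ N ∧ ∀ z, HasLevel b N β g k z →
          ∀ v ∈ V Y, dst v z ≤ y ^ 4 → z ∈ V Y := by
      intro n
      induction n with
      | zero => exact fun _ => Or.inl ⟨∅, by simp [hOk], rfl⟩
      | succ n ihn =>
        intro hn
        rcases ihn (by omega) with ⟨Y, hY, hYn⟩ | h
        swap
        · exact Or.inr h
        by_cases hdone : ∀ z, HasLevel b N β g k z → ∀ v ∈ V Y, dst v z ≤ y ^ 4 → z ∈ V Y
        · exact Or.inr ⟨Y, hY, by omega, hdone⟩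
        · push Not at hdone
          obtain ⟨z, hz, v, hv, hvz, hzV⟩ := hdone
          have hzY : z ∉ Y := fun h =>
            hzV (Finset.mem_union_right _ (Finset.mem_biUnion.2 ⟨z, h, hcl1 z⟩))
          refine Or.inl ⟨insert z Y, ⟨?_, ?_⟩, by rw [Finset.card_insert_of_notMem hzY, hYn]⟩
          · intro w hw
            rcases Finset.mem_insert.1 hw with rfl | hw
            · exact hz
            · exact hY.1 w hw
          · intro w hw
            rw [Finset.card_insert_of_notMem hzY, add_mul, one_mul]
            rcases Finset.mem_insert.1 hw with rfl | hw
            · have h1 := hdist Y hY v hv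
              have h2 := dst_triangle a v w
              omega
            · have := hY.2 w hw
              omega
    obtain ⟨Y, hY, hYN, hclosed⟩ : ∃ Y, Ok Y ∧ Y.card ≤ N ∧ ∀ z, HasLevel b N β g k z →
          ∀ v ∈ V Y, dst v z ≤ y ^ 4 → z ∈ V Y := by
      rcases key (N + 1) le_rfl with ⟨Y, hY, hYn⟩ | h
      · have := hcard Y hY hYn.le; omega
      · exact h
    have hbad : ∀ v ∈ (cl a).erase a ∪ Y.biUnion cl, g v < thr b N β 0 ∧ thr b N β (k + 1) ≤ g v := by
      intro v hv
      have hanti := thr_anti (N := N) (β := β) hb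
      rcases Finset.mem_union.1 hv with hv | hv
      · have := hcl3 a v (Finset.mem_of_mem_erase hv) (Finset.ne_of_mem_erase hv)
        exact ⟨this.1, (hanti (Nat.le_succ k)).trans this.2⟩
      · obtain ⟨z, hz, hvz⟩ := Finset.mem_biUnion.1 hv
        by_cases hvz' : v = z
        · rw [hvz']
          exact ⟨(hY.1 z hz).2.trans_le (hanti (Nat.zero_le k)), (hY.1 z hz).1⟩
        · have := hcl3 z v hvz hvz'
          exact ⟨this.1, (hanti (Nat.le_succ k)).trans this.2⟩
    have hsub : (V Y).erase a ⊆ (cl a).erase a ∪ Y.biUnion cl := by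
      intro v hv
      have h1 := Finset.ne_of_mem_erase hv
      rcases Finset.mem_union.1 (Finset.mem_of_mem_erase hv) with h2 | h2
      · exact Finset.mem_union_left _ (Finset.mem_erase.2 ⟨h1, h2⟩)
      · exact Finset.mem_union_right _ h2
    have h01 : ∀ v ∈ (cl a).erase a ∪ Y.biUnion cl, 0 ≤ g v ^ 3 ∧ g v ^ 3 ≤ 1 := by
      intro v hv
      have h1 := hbad v hv
      have h2 : 0 ≤ g v := (thr_pos hb _).le.trans h1.2
      exact ⟨by positivity, pow_le_one₀ h2 (h1.1.le.trans (thr_le_one hb _))⟩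
    refine ⟨V Y, Finset.mem_union_left _ (hcl1 a), ?_, ?_, ?_, ?_⟩
    · intro v hv
      refine (hdist Y hY v hv).trans ?_
      have h1 : Y.card * (2 * y + y ^ 4) + y ≤ (N + 1) * (2 * y + y ^ 4) := by
        have := Nat.mul_le_mul_right (2 * y + y ^ 4) hYN
        rw [add_mul, one_mul]; omega
      refine h1.trans ((hball y hyb).trans ?_)
      rw [scale_succ]
      exact Nat.pow_le_pow_right (by omega) (by unfold ratio; omega)
    · intro v hv hne
      exact hbad v (hsub (Finset.mem_erase.2 ⟨hne, hv⟩))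
    · intro j hj z hz v hv hvz
      rcases Nat.lt_succ_iff_lt_or_eq.1 hj with hj | rfl
      · rcases Finset.mem_union.1 hv with hv | hv
        · exact Finset.mem_union_left _ (hcl4 a j hj z hz v hv hvz)
        · obtain ⟨w, hw, hvw⟩ := Finset.mem_biUnion.1 hv
          exact Finset.mem_union_right _
            (Finset.mem_biUnion.2 ⟨w, hw, hcl4 w j hj z hz v hvw hvz⟩)
      · exact hclosed z hz v hv hvz
    · refine le_trans ?_ (prod_mul_prod_le_prod_of_subset hsub h01)
      have hthr := thr_pos (N := N) (β := β) hb k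
      have hthr' := thr_pos (N := N) (β := β) hb (k + 1)
      have h1 : (thr b N β (k + 1) ^ 3 * thr b N β k ^ (6 * N)) ^ N ≤
          ∏ i ∈ Y.biUnion cl, g i ^ 3 := by
        refine le_trans ?_ (prod_prod_le_prod_biUnion Y cl fun z hz i hi =>
          h01 i (Finset.mem_union_right _ (Finset.mem_biUnion.2 ⟨z, hz, hi⟩)))
        have h2 : ∀ z ∈ Y, thr b N β (k + 1) ^ 3 * thr b N β k ^ (6 * N) ≤ ∏ i ∈ cl z, g i ^ 3 := by
          intro z hz
          rw [← Finset.mul_prod_erase _ _ (hcl1 z)]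
          exact mul_le_mul (pow_le_pow_left₀ hthr'.le (hY.1 z hz).1 3) (hcl5 z) (by positivity)
            (h01 z (Finset.mem_union_right _ (Finset.mem_biUnion.2 ⟨z, hz, hcl1 z⟩))).1
        refine le_trans ?_ (Finset.prod_le_prod (fun z _ => by positivity) h2)
        rw [Finset.prod_const]
        exact pow_le_pow_of_le_one (by positivity) (mul_le_one₀
          (pow_le_one₀ hthr'.le (thr_le_one hb _)) (by positivity)
          (pow_le_one₀ hthr.le (thr_le_one hb _))) hYN
      -- This identity determines `ratio`: the closure of `a` and the `N` added ones give the power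
      -- 6N + 6N² = 6N(N+1) of the threshold of level `k`, that is, the power 3N of the next one,
      -- and the added vertices themselves give another 3N.
      refine le_trans (le_of_eq ?_) (mul_le_mul (hcl5 a) h1 (by positivity)
        (Finset.prod_nonneg fun i hi => (h01 i (Finset.mem_union_left _ hi)).1))
      rw [thr_succ]
      simp only [← pow_mul, ← pow_add]
      congr 1
      unfold ratio
      ring

/-- The union of the closures of all bad vertices of level `k` in the ball. This is the set to be
blocked in one slab: a bad vertex of lower level `j` outside it is farther than `scale b N j ^ 4`
from it. The product bounds the cost of blocking from below. -/
lemma IsSeparated.exists_blocking (hg : IsSeparated b N β g) (hb : 0 < b) (hN : 2 ≤ N)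
    (hball : ∀ y ≥ b, (N + 1) * (2 * y + y ^ 4) ≤ y ^ 5) (k : ℕ) (x : Vertex d) :
    ∃ V : Finset (Vertex d), (∀ v ∈ V, g v < thr b N β 0 ∧ thr b N β (k + 1) ≤ g v) ∧
      (∀ z ∈ ballF x (scale b N k ^ 4), HasLevel b N β g k z → z ∈ V) ∧
      IsClosedBelow b N β g k V ∧ thr b N β (k + 1) ^ (6 * N) ≤ ∏ v ∈ V, g v ^ 3 := by
  classical
  choose cl hcl1 hcl2 hcl3 hcl4 hcl5 using hg.exists_closure hb hN hball k
  set Y := (ballF x (scale b N k ^ 4)).filter fun z => HasLevel b N β g k z with hYdef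
  have hyb : b ≤ scale b N k := le_scale k
  have hYN : Y.card ≤ N := by
    refine le_trans (Finset.card_le_card fun z hz => ?_) (hg k x)
    have hz' := Finset.mem_filter.1 hz
    refine Finset.mem_filter.2 ⟨mem_ballF.2 ((mem_ballF.1 hz'.1).trans ?_), hz'.2.2⟩
    exact Nat.pow_le_pow_right (by omega) (by omega)
  have hY : ∀ z ∈ Y, HasLevel b N β g k z := fun z hz => (Finset.mem_filter.1 hz).2
  have hanti := thr_anti (N := N) (β := β) hb
  have hbad : ∀ v ∈ Y.biUnion cl, g v < thr b N β 0 ∧ thr b N β (k + 1) ≤ g v := by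
    intro v hv
    obtain ⟨z, hz, hvz⟩ := Finset.mem_biUnion.1 hv
    by_cases hvz' : v = z
    · rw [hvz']
      exact ⟨(hY z hz).2.trans_le (hanti (Nat.zero_le k)), (hY z hz).1⟩
    · have := hcl3 z v hvz hvz'
      exact ⟨this.1, (hanti (Nat.le_succ k)).trans this.2⟩
  have h01 : ∀ v ∈ Y.biUnion cl, 0 ≤ g v ^ 3 ∧ g v ^ 3 ≤ 1 := by
    intro v hv
    have h1 := hbad v hv
    have h2 : 0 ≤ g v := (thr_pos hb _).le.trans h1.2
    exact ⟨by positivity, pow_le_one₀ h2 (h1.1.le.trans (thr_le_one hb _))⟩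
  refine ⟨Y.biUnion cl, hbad, ?_, ?_, ?_⟩
  · intro z hz hlev
    exact Finset.mem_biUnion.2 ⟨z, Finset.mem_filter.2 ⟨hz, hlev⟩, hcl1 z⟩
  · intro j hj z hz v hv hvz
    obtain ⟨w, hw, hvw⟩ := Finset.mem_biUnion.1 hv
    exact Finset.mem_biUnion.2 ⟨w, hw, hcl4 w j hj z hz v hvw hvz⟩
  · have hthr := thr_pos (N := N) (β := β) hb k
    have hthr' := thr_pos (N := N) (β := β) hb (k + 1)
    refine le_trans ?_ (prod_prod_le_prod_biUnion Y cl fun z hz i hi =>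
      h01 i (Finset.mem_biUnion.2 ⟨z, hz, hi⟩))
    have h2 : ∀ z ∈ Y, thr b N β (k + 1) ^ 3 * thr b N β k ^ (6 * N) ≤ ∏ i ∈ cl z, g i ^ 3 := by
      intro z hz
      rw [← Finset.mul_prod_erase _ _ (hcl1 z)]
      exact mul_le_mul (pow_le_pow_left₀ hthr'.le (hY z hz).1 3) (hcl5 z) (by positivity)
        (h01 z (Finset.mem_biUnion.2 ⟨z, hz, hcl1 z⟩)).1
    refine le_trans ?_ (Finset.prod_le_prod (fun z _ => by positivity) h2)
    rw [Finset.prod_const]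
    refine le_trans ?_ (pow_le_pow_of_le_one (by positivity) (mul_le_one₀
      (pow_le_one₀ hthr'.le (thr_le_one hb _)) (by positivity)
      (pow_le_one₀ hthr.le (thr_le_one hb _))) hYN)
    rw [thr_succ]
    simp only [← pow_mul, ← pow_add]
    refine pow_le_pow_of_le_one hthr.le (thr_le_one hb _) ?_
    unfold ratio
    nlinarith

end Closure

/-! ### Excursions -/

section Excursions

variable {d : ℕ} {F : Finset (FineEdge d)} {p : FineEdge d → ℝ} {M : ℕ} {g : Vertex d → ℝ}

/-- The inequalities between the parameters needed to pass from one scale to the next. -/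
structure IsLarge (d N β : ℕ) (m : ℝ) (b : ℕ) : Prop where
  seven_le : 7 ≤ b
  ball : ∀ y ≥ b, (N + 1) * (2 * y + y ^ 4) ≤ y ^ 5
  thr_bound : thr b N β 0 ≤ (1 / 2) * (Real.exp (-2) * (1 / 2)) ^ (2 * d)
  tail : ∀ y : ℕ, b ≤ y → (2 * (y : ℝ) ^ 4 + 1) ^ d *
    (4 ^ (d + 1) * (y : ℝ) ^ (β * (12 * N + 1)) * Real.exp (y - (y : ℝ) ^ 2)) ≤ 1 / (8 * y)
  far : ∀ y : ℕ, b ≤ y → (y : ℝ) ^ (ratio N * (β * (12 * N + 1) + 2)) *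
    (4 ^ (d + 1) * (y : ℝ) ^ (β * (12 * N + 1)) * Real.exp (y + 1 - (y : ℝ) ^ 4)) ≤ 1 / (8 * y)
  lateral : ∀ y : ℕ, b ≤ y → (2 * (y : ℝ) ^ 4 + 3) ^ d *
    (3 * (y : ℝ) ^ (ratio N * (β * (12 * N + 1)))) *
    (3 ^ d * (2 * (3 ^ d * (2 * (y : ℝ) ^ (ratio N * (β * (12 * N + 1)))) * Real.exp (m + 1)) ^ 2 *
      Real.exp y) ^ 2 ^ N * Real.exp (-(y : ℝ) ^ 3 + m + 2)) ≤ 1 / 4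
  time : ∀ y : ℕ, b ≤ y → (2 * (y : ℝ) ^ 4 + 3) ^ d *
    (3 * (y : ℝ) ^ (ratio N * (β * (12 * N + 1)))) *
    Real.exp (-(y : ℝ) ^ 5 + (m + 1) * ((y : ℝ) ^ 4 + 1) + 1) ≤ 1 / 8
  mass_bound : ∀ y : ℕ, b ≤ y → (m + 1) * (y : ℝ) ^ 4 + 1 ≤ (y : ℝ) ^ 5

/-- The rate of exponential decay at level `k`. -/
def mass (m : ℝ) (k : ℕ) : ℝ := m + (1 / 2) ^ k

lemma le_mass (m : ℝ) (k : ℕ) : m ≤ mass m k := by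
  have : (0 : ℝ) ≤ (1 / 2) ^ k := by positivity
  unfold mass; linarith

lemma mass_le (m : ℝ) (k : ℕ) : mass m k ≤ m + 1 := by
  have : ((1 : ℝ) / 2) ^ k ≤ 1 := pow_le_one₀ (by norm_num) (by norm_num)
  unfold mass; linarith

/-- The sites over vertices which are not bad of level `k` or worse. -/
def goodSites (b N β : ℕ) (g : Vertex d → ℝ) (k : ℕ) : Set (Site d) := {X | thr b N β k ≤ g X.1}

/-- Decay of the two-point function at level `k`. -/
def Decays (b N β : ℕ) (m : ℝ) (g : Vertex d → ℝ) (M : ℕ) (F : Finset (FineEdge d))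
    (p : FineEdge d → ℝ) (k : ℕ) : Prop :=
  ∀ c c', prob F p (CellConn M (goodSites b N β g k) c c') ≤
    Real.exp (scale b N k - weight (mass m k) (corrTime b N β k) c c')

/-- The probability of a long connection in time. -/
lemma prob_time_tail_le (hM : 0 < M) (hp : ∀ e, 0 ≤ p e ∧ p e ≤ 1) {A A' : Set (Site d)} {y m T : ℝ}
    (hm : 1 ≤ m) (hT : 1 ≤ T)
    (h : ∀ c c', prob F p (CellConn M A c c') ≤ Real.exp (y - weight m T c c'))
    (hA : A' ⊆ A) (Λ : Finset (Vertex d)) (hΛ : ∀ X ∈ A', X.1 ∈ Λ) (b : Vertex d) (I : Finset ℤ)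
    {s : ℤ} {w : ℝ} (hw : 0 ≤ w) (hI : ∀ i ∈ I, (i : ℝ) + w ≤ s) :
    prob F p (fun S => ∃ X Y : Site d, X.1 = b ∧ X.2 / M ∈ I ∧ s ≤ Y.2 / M ∧ Conn S A' X Y) ≤
      4 ^ (d + 1) * T * Real.exp (y - w / T) := by
  classical
  have hT0 : 0 < T := by linarith
  have e1 : prob F p (fun S => ∃ X Y : Site d, X.1 = b ∧ X.2 / M ∈ I ∧ s ≤ Y.2 / M ∧
      Conn S A' X Y) ≤ prob F p (fun S => ∃ q ∈ I ×ˢ insert b Λ,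
        CellConn M A (b, q.1) (q.2, s) S) := by
    refine prob_mono hp ?_
    rintro S - ⟨X, Y, hX, hXI, hY, hc⟩
    have hXs : X.2 / M ≤ s := by
      have := hI _ hXI
      have : ((X.2 / M : ℤ) : ℝ) ≤ s := by linarith
      exact_mod_cast this
    obtain ⟨Y', hY', -, hc'⟩ := hc.exists_above (f := fun X => X.2 / M)
      (fun e X Y hj => hj.ediv_le hM) hXs hY
    refine ⟨(X.2 / M, Y'.1), ?_, X, Y', by rw [← hX]; rfl, by rw [← hY']; rfl,
      hc'.mono le_rfl hA⟩
    simp only [Finset.mem_product, Finset.mem_insert]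
    refine ⟨hXI, ?_⟩
    rcases hc'.eq_or_mem with rfl | h'
    · exact Or.inl hX
    · exact Or.inr (hΛ _ h'.2)
  refine e1.trans ((prob_exists_le hp _ _).trans ?_)
  rw [Finset.sum_product]
  -- The latest admissible starting time. Measuring decay from `j` leaves the factor `exp (-w / T)`
  -- and a sum over starting times of at most `4 * T`, however large `I` is.
  set j : ℤ := ⌊(s : ℝ) - w⌋ with hj
  have e2 : ∀ i ∈ I, ∀ x, prob F p (CellConn M A (b, i) (x, s)) ≤
      Real.exp (y - w / T) * Real.exp (-(|(i : ℝ) - j| / T)) * Real.exp (-(m * dst b x)) := by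
    intro i hi x
    refine (h _ _).trans ?_
    rw [← Real.exp_add, ← Real.exp_add]
    refine Real.exp_le_exp.2 ?_
    unfold weight
    simp only
    have f1 : (j : ℝ) ≤ s - w := Int.floor_le _
    have f2 : i ≤ j := Int.le_floor.2 (by linarith [hI i hi])
    have f3 : (i : ℝ) ≤ j := by exact_mod_cast f2
    have f4 : w + |(i : ℝ) - j| ≤ |(i : ℝ) - s| := by
      rw [abs_of_nonpos (by linarith), abs_of_nonpos (by linarith)]; linarith
    have f5 := div_le_div_of_nonneg_right f4 hT0.le
    rw [add_div] at f5
    linarith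
  calc ∑ i ∈ I, ∑ x ∈ insert b Λ, prob F p (CellConn M A (b, i) (x, s))
      ≤ ∑ i ∈ I, ∑ x ∈ insert b Λ,
          Real.exp (y - w / T) * Real.exp (-(|(i : ℝ) - j| / T)) * Real.exp (-(m * dst b x)) :=
        Finset.sum_le_sum fun i hi => Finset.sum_le_sum fun x _ => e2 i hi x
    _ = Real.exp (y - w / T) * (∑ i ∈ I, Real.exp (-(|(i : ℝ) - j| / T))) *
          ∑ x ∈ insert b Λ, Real.exp (-(m * dst b x)) := by
        simp only [← Finset.mul_sum, ← Finset.sum_mul]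
    _ ≤ Real.exp (y - w / T) * (4 * T) * 4 ^ d := by
        refine mul_le_mul (mul_le_mul_of_nonneg_left (sum_exp_abs_le hT _ _) (Real.exp_pos _).le)
          (sum_exp_dst_le hm _ _) (Finset.sum_nonneg fun _ _ => (Real.exp_pos _).le)
          (by positivity)
    _ = _ := by ring

/-- The probability of a connection to large distance. -/
lemma prob_far_le (hp : ∀ e, 0 ≤ p e ∧ p e ≤ 1) {A A' : Set (Site d)} {y m T : ℝ}
    (hm : 2 ≤ m) (hT : 1 ≤ T)
    (h : ∀ c c', prob F p (CellConn M A c c') ≤ Real.exp (y - weight m T c c'))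
    (hA : A' ⊆ A) (Λ : Finset (Vertex d)) (I' : Finset ℤ)
    (hΛ : ∀ X ∈ A', X.1 ∈ Λ ∧ X.2 / M ∈ I') (b : Vertex d) (I : Finset ℤ) {r : ℝ} :
    prob F p (fun S => ∃ X Y : Site d, X.1 = b ∧ X.2 / M ∈ I ∧ Y ∈ A' ∧ r ≤ dst b Y.1 ∧
      Conn S A' X Y) ≤ I.card * (4 ^ (d + 1) * T * Real.exp (y - r)) := by
  classical
  have hT0 : 0 < T := by linarith
  set Λ' := Λ.filter fun x => r ≤ dst b x with hΛ'
  have e1 : prob F p (fun S => ∃ X Y : Site d, X.1 = b ∧ X.2 / M ∈ I ∧ Y ∈ A' ∧ r ≤ dst b Y.1 ∧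
      Conn S A' X Y) ≤ prob F p (fun S => ∃ q ∈ I ×ˢ (I' ×ˢ Λ'),
        CellConn M A (b, q.1) (q.2.2, q.2.1) S) := by
    refine prob_mono hp ?_
    rintro S - ⟨X, Y, hX, hXI, hY, hr, hc⟩
    refine ⟨(X.2 / M, Y.2 / M, Y.1), ?_, X, Y, by rw [← hX]; rfl, rfl, hc.mono le_rfl hA⟩
    simp only [Finset.mem_product, hΛ', Finset.mem_filter]
    exact ⟨hXI, (hΛ Y hY).2, (hΛ Y hY).1, hr⟩
  refine e1.trans ((prob_exists_le hp _ _).trans ?_)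
  rw [Finset.sum_product]
  refine (Finset.sum_le_card_nsmul _ _ _ fun i _ => ?_).trans (by rw [nsmul_eq_mul])
  rw [Finset.sum_product]
  -- Of the rate `m ≥ 2`, one unit produces `exp (-r)` and another makes the sum over `x` converge.
  have e2 : ∀ j ∈ I', ∀ x ∈ Λ', prob F p (CellConn M A (b, i) (x, j)) ≤
      Real.exp (y - r) * Real.exp (-(|(j : ℝ) - i| / T)) * Real.exp (-(1 * dst b x)) := by
    intro j _ x hx
    refine (h _ _).trans ?_
    rw [← Real.exp_add, ← Real.exp_add]
    refine Real.exp_le_exp.2 ?_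
    unfold weight
    simp only
    have hr : r ≤ dst b x := (Finset.mem_filter.1 hx).2
    have h0 : (0 : ℝ) ≤ dst b x := Nat.cast_nonneg _
    rw [abs_sub_comm (j : ℝ)]
    nlinarith
  calc ∑ j ∈ I', ∑ x ∈ Λ', prob F p (CellConn M A (b, i) (x, j))
      ≤ ∑ j ∈ I', ∑ x ∈ Λ',
          Real.exp (y - r) * Real.exp (-(|(j : ℝ) - i| / T)) * Real.exp (-(1 * dst b x)) :=
        Finset.sum_le_sum fun i hi => Finset.sum_le_sum fun x hx => e2 i hi x hx
    _ = Real.exp (y - r) * (∑ j ∈ I', Real.exp (-(|(j : ℝ) - i| / T))) *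
          ∑ x ∈ Λ', Real.exp (-(1 * dst b x)) := by
        simp only [← Finset.mul_sum, ← Finset.sum_mul]
    _ ≤ Real.exp (y - r) * (4 * T) * 4 ^ d := by
        refine mul_le_mul (mul_le_mul_of_nonneg_left (sum_exp_abs_le hT _ _) (Real.exp_pos _).le)
          (sum_exp_dst_le le_rfl _ _) (Finset.sum_nonneg fun _ _ => (Real.exp_pos _).le)
          (by positivity)
    _ = _ := by ring

variable {b N β : ℕ} {m : ℝ}

/-- The length of time after which connections at level `k` are unlikely. -/
def waitTime (b N β k : ℕ) : ℕ := corrTime b N β k * scale b N k ^ 2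

/-- The waiting time is `scale ^ 2` correlation times, so the tail is `exp (y - y ^ 2)`. This beats
the prefactor, the volume of the ball and the correlation time, which are at most exponential in
`y`. -/
lemma IsLarge.tail_le (hL : IsLarge d N β m b) (k : ℕ) :
    (2 * (scale b N k : ℝ) ^ 4 + 1) ^ d * (4 ^ (d + 1) * (corrTime b N β k : ℝ) *
      Real.exp (scale b N k - waitTime b N β k / corrTime b N β k)) ≤ 1 / (8 * scale b N k) := by
  have hb : 0 < b := by linarith [hL.seven_le]
  have := hL.tail (scale b N k) (le_scale k)
  have h0 : (corrTime b N β k : ℝ) ≠ 0 := by exact_mod_cast (corrTime_pos hb k).ne'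
  have h1 : (waitTime b N β k : ℝ) / corrTime b N β k = (scale b N k : ℝ) ^ 2 := by
    unfold waitTime; push_cast; field_simp
  rw [h1]
  unfold corrTime
  push_cast
  exact this

lemma IsLarge.tail_le' (hL : IsLarge d N β m b) (k : ℕ) :
    4 ^ (d + 1) * (corrTime b N β k : ℝ) *
      Real.exp (scale b N k - waitTime b N β k / corrTime b N β k) ≤ 1 / (8 * scale b N k) := by
  refine le_trans ?_ (hL.tail_le k)
  refine le_mul_of_one_le_left (by positivity) (one_le_pow₀ ?_)
  have : (0 : ℝ) ≤ (scale b N k : ℝ) ^ 4 := by positivity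
  linarith

/-- Excursions off a set which is closed for the lower levels are unlikely to last long. -/
lemma IsLarge.prob_excursion_le (hL : IsLarge d N β m b) (hm : 2 ≤ m) (hM : 0 < M)
    (hp : ∀ e, 0 ≤ p e ∧ p e ≤ 1) (k : ℕ) (hdec : ∀ j ≤ k, Decays b N β m g M F p j)
    (V : Finset (Vertex d)) (v : Vertex d)
    (hV : ∀ j < k, ∀ z, HasLevel b N β g j z → dst v z < scale b N j ^ 4 → z ∈ V)
    (Λ : Finset (Vertex d)) (I : Finset ℤ) (s : ℤ) :
    prob F p (fun S => ∃ X Y : Site d, X.1 = v ∧ X.2 / M ∈ I ∧ X.2 / M < s ∧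
      s + waitTime b N β 0 ≤ Y.2 / M ∧
      Conn S ({X | X.1 ∉ V ∧ X.1 ∈ Λ ∧ X.2 / M ∈ I} ∩ goodSites b N β g k) X Y) ≤
      1 / 2 - (1 / 4) * (1 / 2) ^ k := by
  classical
  have hb : 0 < b := by linarith [hL.seven_le]
  have hT1 : ∀ k, (1 : ℝ) ≤ corrTime b N β k := fun k => by exact_mod_cast corrTime_pos hb k
  have hmass1 : ∀ k, 2 ≤ mass m k := fun k => hm.trans (le_mass m k)
  induction k with
  | zero =>
    have e1 := prob_time_tail_le (F := F) (A' := {X | X.1 ∉ V ∧ X.1 ∈ Λ ∧ X.2 / M ∈ I} ∩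
      goodSites b N β g 0) hM hp (by linarith [hmass1 0]) (hT1 0) (hdec 0 le_rfl)
      Set.inter_subset_right Λ (fun X hX => hX.1.2.1) v (I.filter fun i => i < s)
      (s := s + waitTime b N β 0) (w := waitTime b N β 0) (Nat.cast_nonneg _) (by
        intro i hi
        have : (i : ℝ) < s := by exact_mod_cast (Finset.mem_filter.1 hi).2
        push_cast; linarith)
    have e2 := hL.tail_le' 0
    have e3 : 1 / (8 * (scale b N 0 : ℝ)) ≤ 1 / 4 := by
      have : (1 : ℝ) ≤ scale b N 0 := by exact_mod_cast scale_pos hb 0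
      rw [div_le_div_iff₀ (by positivity) (by norm_num)]; linarith
    refine le_trans (prob_mono hp ?_) (e1.trans (e2.trans (e3.trans (by norm_num))))
    rintro S - ⟨X, Y, h1, h2, h3, h4, h5⟩
    exact ⟨X, Y, h1, Finset.mem_filter.2 ⟨h2, h3⟩, h4, h5⟩
  | succ k ih =>
    have ih' := ih (fun j hj => hdec j (by omega)) (fun j hj => hV j (by omega))
    set A : Set (Site d) := {X | X.1 ∉ V ∧ X.1 ∈ Λ ∧ X.2 / M ∈ I} with hA
    set w := waitTime b N β (k + 1) with hw
    set I₁ := I.filter fun i => i + w ≤ s + waitTime b N β 0 with hI₁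
    set I₂ : Finset ℤ := Finset.Ico (s - w) s with hI₂
    have e1 := prob_time_tail_le (F := F) (A' := A ∩ goodSites b N β g (k + 1)) hM hp
      (by linarith [hmass1 (k + 1)]) (hT1 (k + 1)) (hdec (k + 1) le_rfl)
      Set.inter_subset_right Λ (fun X hX => hX.1.2.1) v I₁
      (s := s + waitTime b N β 0) (w := w) (Nat.cast_nonneg _) (by
        intro i hi
        have : ((i + w : ℤ) : ℝ) ≤ (s + waitTime b N β 0 : ℤ) := by
          exact_mod_cast (Finset.mem_filter.1 hi).2
        push_cast at this ⊢; linarith)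
    have e2 := prob_far_le (F := F) (A' := A ∩ goodSites b N β g k) hp (hmass1 k) (hT1 k)
      (hdec k (Nat.le_succ k)) Set.inter_subset_right Λ I (fun X hX => ⟨hX.1.2.1, hX.1.2.2⟩) v I₂
      (r := (scale b N k : ℝ) ^ 4 - 1)
    -- An excursion either starts at least one waiting time of level `k + 1` before the final time,
    -- or starts later and gets as far as the nearest bad vertex of level `k` outside `V`, or avoids
    -- such vertices and is an excursion of level `k`. In the second case it is cut at the inner end
    -- of the step to that vertex, hence the `- 1` in the distance.
    have hsplit : prob F p (fun S => ∃ X Y : Site d, X.1 = v ∧ X.2 / M ∈ I ∧ X.2 / M < s ∧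
        s + waitTime b N β 0 ≤ Y.2 / M ∧ Conn S (A ∩ goodSites b N β g (k + 1)) X Y) ≤
        prob F p (fun S => (∃ X Y : Site d, X.1 = v ∧ X.2 / M ∈ I₁ ∧
            s + waitTime b N β 0 ≤ Y.2 / M ∧ Conn S (A ∩ goodSites b N β g (k + 1)) X Y) ∨
          ((∃ X Y : Site d, X.1 = v ∧ X.2 / M ∈ I₂ ∧ Y ∈ A ∩ goodSites b N β g k ∧
            (scale b N k : ℝ) ^ 4 - 1 ≤ dst v Y.1 ∧ Conn S (A ∩ goodSites b N β g k) X Y) ∨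
          (∃ X Y : Site d, X.1 = v ∧ X.2 / M ∈ I ∧ X.2 / M < s ∧
            s + waitTime b N β 0 ≤ Y.2 / M ∧ Conn S (A ∩ goodSites b N β g k) X Y))) := by
      refine prob_mono hp ?_
      rintro S - ⟨X, Y, h1, h2, h3, h4, h5⟩
      by_cases hX1 : X.2 / M ∈ I₁
      · exact Or.inl ⟨X, Y, h1, hX1, h4, h5⟩
      right
      have hX2 : X.2 / M ∈ I₂ := by
        simp only [hI₁, Finset.mem_filter, h2, true_and, not_le] at hX1
        simp only [hI₂, Finset.mem_Ico]
        have := Nat.zero_le (waitTime b N β 0)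
        omega
      have hset : A ∩ goodSites b N β g (k + 1) ∩ goodSites b N β g k =
          A ∩ goodSites b N β g k := by
        ext Z
        simp only [Set.mem_inter_iff, goodSites, Set.mem_ofPred_eq]
        have := thr_anti (N := N) (β := β) hb (Nat.le_succ k)
        constructor
        · rintro ⟨⟨a1, -⟩, a2⟩; exact ⟨a1, a2⟩
        · rintro ⟨a1, a2⟩; exact ⟨⟨a1, this.trans a2⟩, a2⟩
      by_cases hc : Conn S (A ∩ goodSites b N β g k) X Y
      · exact Or.inr ⟨X, Y, h1, h2, h3, h4, hc⟩
      left
      have hfar : ∀ z : Site d, z ∈ A ∩ goodSites b N β g (k + 1) → z ∉ goodSites b N β g k →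
          scale b N k ^ 4 ≤ dst v z.1 := by
        intro z hz hz'
        by_contra hcon
        exact hz.1.1 (hV k (Nat.lt_succ_self k) z.1 ⟨hz.2, not_le.1 hz'⟩ (not_le.1 hcon))
      have hXA : X ∈ A ∩ goodSites b N β g (k + 1) := by
        rcases h5.eq_or_mem with rfl | h
        · exact absurd .refl hc
        · exact h.1
      have hXg : X ∈ goodSites b N β g k := by
        by_contra hX'
        have h6 := hfar X hXA hX'
        rw [h1, dst_self] at h6
        have : 0 < scale b N k ^ 4 := Nat.pow_pos (scale_pos hb k)
        omega
      obtain ⟨w', z, e, f1, f2, f3, f4, f5, f6⟩ := h5.exists_boundary hXg (by rwa [hset])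
      rw [hset] at f1 f2
      refine ⟨X, w', h1, hX2, f2, ?_, f1⟩
      have h6 := hfar z f5 f6
      have h7 := dst_triangle v w'.1 z.1
      have h8 := f4.dst_le
      have h9 : ((scale b N k ^ 4 : ℕ) : ℝ) ≤ dst v w'.1 + 1 := by exact_mod_cast by omega
      push_cast at h9
      linarith
    refine hsplit.trans ((prob_or_le hp _ _).trans ?_)
    have e3 := (prob_or_le hp _ _).trans (add_le_add e2 ih')
    refine (add_le_add (e1.trans (hL.tail_le' (k + 1))) e3).trans ?_
    have hy0 : (0 : ℝ) < scale b N k := by exact_mod_cast scale_pos hb k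
    have hfar := hL.far (scale b N k) (le_scale k)
    have hcard : (I₂.card : ℝ) = (scale b N k : ℝ) ^ (ratio N * (β * (12 * N + 1) + 2)) := by
      rw [hI₂, Int.card_Ico]
      have : (s - (s - (w : ℤ))).toNat = w := by simp
      rw [this, hw, waitTime, corrTime, scale_succ]
      push_cast
      rw [← pow_mul, ← pow_mul, ← pow_add]
      congr 1; ring
    have e4 : (I₂.card : ℝ) * (4 ^ (d + 1) * (corrTime b N β k : ℝ) *
        Real.exp (scale b N k - ((scale b N k : ℝ) ^ 4 - 1))) ≤ 1 / (8 * scale b N k) := by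
      rw [hcard]
      unfold corrTime
      push_cast
      refine le_trans (le_of_eq ?_) hfar
      congr 3; ring
    have e5 : 1 / (8 * (scale b N (k + 1) : ℝ)) ≤ 1 / (8 * scale b N k) := by
      have : (scale b N k : ℝ) ≤ scale b N (k + 1) := by
        exact_mod_cast scale_mono (Nat.le_succ k)
      gcongr
    -- Two errors of this size make up exactly the increase of `1/2 - (1/4) * (1/2)^k` from `k` to
    -- `k + 1`, so the bound stays below 1/2 at every level.
    have e6 : 1 / (8 * (scale b N k : ℝ)) ≤ (1 / 8) * (1 / 2) ^ (k + 1) := by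
      have : ((2 ^ (k + 1) : ℕ) : ℝ) ≤ scale b N k := by
        exact_mod_cast two_pow_le_scale (by linarith [hL.seven_le]) k
      push_cast at this
      rw [one_div_pow, ← div_eq_mul_one_div, div_div, div_le_div_iff₀ (by positivity) (by positivity)]
      linarith
    have e7 : (1 : ℝ) / 4 * (1 / 2) ^ k = 1 / 2 * (1 / 2) ^ (k + 1) := by rw [pow_succ]; ring
    linarith

end Excursions

/-! ### Decay at all scales -/

section Induction

variable {d : ℕ} {F : Finset (FineEdge d)} {p : FineEdge d → ℝ} {M : ℕ} {g : Vertex d → ℝ} {κ : ℝ}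
  {b N β : ℕ} {m : ℝ}

lemma exists_hasLevel {z : Vertex d} {k : ℕ} (h1 : thr b N β (k + 1) ≤ g z)
    (h2 : g z < thr b N β 0) : ∃ j ≤ k, HasLevel b N β g j z := by
  induction k with
  | zero => exact ⟨0, le_rfl, h1, h2⟩
  | succ k ih =>
    by_cases h : thr b N β (k + 1) ≤ g z
    · obtain ⟨j, hj, hl⟩ := ih h
      exact ⟨j, hj.trans (Nat.le_succ k), hl⟩
    · exact ⟨k + 1, le_rfl, h1, not_le.1 h⟩

/-- The sites over a ball in a slab of time, at level `k + 1`. -/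
def slab (b N β : ℕ) (g : Vertex d → ℝ) (M k : ℕ) (x : Vertex d) (lo : ℤ) : Set (Site d) :=
  {X | X.1 ∈ ballF x (scale b N k ^ 4) ∧ lo ≤ X.2 / M ∧
    X.2 / M ≤ lo + waitTime b N β k + waitTime b N β 0} ∩ goodSites b N β g (k + 1)

/-- A slab is crossed from the bottom to the top. -/
def SlabCrossed (b N β : ℕ) (g : Vertex d → ℝ) (M k : ℕ) (x : Vertex d) (lo : ℤ)
    (S : Set (FineEdge d)) : Prop :=
  ∃ X Y : Site d, (X.1 ∈ ballF x (scale b N k ^ 4) ∧ X.2 / M = lo) ∧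
    lo + waitTime b N β k + waitTime b N β 0 ≤ Y.2 / M ∧ Conn S (slab b N β g M k x lo) X Y

lemma waitTime_pos (hb : 0 < b) (k : ℕ) : 0 < waitTime b N β k :=
  Nat.mul_pos (corrTime_pos hb k) (Nat.pow_pos (scale_pos hb k))

lemma waitTime_mono : Monotone (waitTime b N β) := fun _ _ h =>
  Nat.mul_le_mul (corrTime_mono h) (Nat.pow_le_pow_left (scale_mono h) 2)

/-- The slab has two phases. It first lasts `waitTime b N β k`, to separate the bottom from the
blocking time, and then `waitTime b N β 0`, which starts with the deaths on `V` and outlasts the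
excursions off `V`. Off `V` the slab contains only sites good at level `k`, where decay is already
known. -/
lemma IsLarge.prob_slabCrossed_le (hL : IsLarge d N β m b) (hm : 2 ≤ m) (hN : 2 ≤ N) (hM : 0 < M)
    (h : IsModel g κ M p) (hκ : 0 < κ) (hκ1 : κ ≤ 1) (hκη : κ * waitTime b N β 0 ≤ thr b N β 0)
    (hg : IsSeparated b N β g) (k : ℕ) (hMk : 1 ≤ M * thr b N β (k + 1))
    (hdec : ∀ j ≤ k, Decays b N β m g M F p j) (x : Vertex d) (lo : ℤ) :
    prob F p (SlabCrossed b N β g M k x lo) ≤ 1 - (1 / 2) * thr b N β (k + 1) ^ (6 * N) := by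
  classical
  have hb : 0 < b := by linarith [hL.seven_le]
  have hM' : (0 : ℤ) < M := by exact_mod_cast hM
  have hMr : (0 : ℝ) < M := by exact_mod_cast hM
  obtain ⟨V, hV1, hV2, hV3, hV4⟩ := hg.exists_blocking hb hN hL.ball k x
  set Λ := ballF x (scale b N k ^ 4) with hΛ
  set W := waitTime b N β k with hW
  set a := waitTime b N β 0 with ha
  set A := slab b N β g M k x lo with hA
  set I : Finset ℤ := Finset.Icc lo (lo + W + a) with hI
  have hWpos : 0 < W := waitTime_pos hb k
  have hoff : A \ {Z | Z.1 ∈ V} ⊆ {X | X.1 ∉ V ∧ X.1 ∈ Λ ∧ X.2 / M ∈ I} ∩ goodSites b N β g k := by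
    rintro X ⟨⟨⟨h1, h2, h3⟩, h4⟩, h5⟩
    refine ⟨⟨h5, h1, Finset.mem_Icc.2 ⟨h2, h3⟩⟩, ?_⟩
    by_contra hcon
    exact h5 (hV2 X.1 h1 ⟨h4, not_le.1 hcon⟩)
  have hdiv : ∀ (s n : ℤ), s * M ≤ n ↔ s ≤ n / M := fun s n => (Int.le_ediv_iff_mul_le hM').symm
  have hdiv' : ∀ (s n : ℤ), n < s * M ↔ n / M < s := fun s n => (Int.ediv_lt_iff_lt_mul hM').symm
  have key := h.prob_crossing_le (F := F) hκ hκ1 (A := A) (V := V)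
    (bot := fun X => X.1 ∈ Λ ∧ X.2 / M = lo) (s := lo + W) (a := a) (waitTime_pos hb 0)
    (thr_pos hb 0) hκη hL.thr_bound ?_ ?_ ?_ ?_ ?_
  · refine le_trans (prob_mono h.mem_unit ?_) (key.trans (by linarith))
    rintro S - ⟨X, Y, h1, h2, h3⟩
    exact ⟨X, Y, h1, (hdiv _ _).2 h2, h3⟩
  · intro v hv
    have h1 := hV1 v hv
    exact ⟨(thr_pos hb _).trans_le h1.2, h1.1.le,
      hMk.trans (mul_le_mul_of_nonneg_left h1.2 hMr.le)⟩
  · intro v hv X hX hXV hdst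
    by_contra hcon
    obtain ⟨j, hj, hlev⟩ := exists_hasLevel hX.2 (not_le.1 hcon)
    rcases Nat.lt_or_eq_of_le hj with hj | rfl
    · refine hXV (hV3 j hj X.1 hlev v hv ?_)
      rw [hdst]
      exact Nat.one_le_pow _ _ (scale_pos hb j)
    · exact hXV (hV2 X.1 hX.1.1 hlev)
  · intro v hv i hi
    -- The excursion starts at a neighbour of `v`, one step away. A vertex strictly closer than
    -- `scale ^ 4` to this neighbour is within `scale ^ 4` of `v`, so the closedness of `V` applies.
    have e1 := hL.prob_excursion_le (F := F) (g := g) hm hM h.mem_unit k hdec V (nbr v i) (by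
      intro j hj z hz hdst
      refine hV3 j hj z hz v hv ?_
      have h1 := dst_triangle v (nbr v i) z
      have h2 := dst_nbr v i
      omega) Λ I (lo + W)
    have e2 : (0 : ℝ) ≤ (1 / 4) * (1 / 2) ^ k := by positivity
    refine le_trans (prob_mono h.mem_unit ?_) (e1.trans (by linarith))
    rintro S - ⟨X, Y, h1, h2, h3, h4⟩
    have h5 := (hdiv' _ _).1 h2
    have h6 := (hdiv _ _).1 h3
    have h7 := h4.mono le_rfl hoff
    have hXI : X.2 / M ∈ I := by
      rcases h7.eq_or_mem with rfl | h8
      · omega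
      · exact h8.1.1.2.2
    exact ⟨X, Y, h1, hXI, h5, h6, h7⟩
  · have e1 : ∀ y ∈ Λ, prob F p (fun S => ∃ X Y : Site d, X.1 = y ∧ X.2 / M ∈ ({lo} : Finset ℤ) ∧
        lo + W + a ≤ Y.2 / M ∧ Conn S (A \ {Z | Z.1 ∈ V}) X Y) ≤
        4 ^ (d + 1) * (corrTime b N β k : ℝ) *
          Real.exp (scale b N k - waitTime b N β k / corrTime b N β k) := by
      intro y _
      refine prob_time_tail_le hM h.mem_unit (by linarith [le_mass m k])
        (by exact_mod_cast corrTime_pos hb k) (hdec k le_rfl)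
        (hoff.trans Set.inter_subset_right) Λ (fun X hX => (hoff hX).1.2.1) y {lo}
        (Nat.cast_nonneg _) ?_
      intro i hi
      rw [Finset.mem_singleton.1 hi]
      have : (0 : ℝ) ≤ a := Nat.cast_nonneg _
      push_cast
      linarith
    have e2 : prob F p (fun S => ∃ X Y : Site d, (X.1 ∈ Λ ∧ X.2 / M = lo) ∧ X.1 ∉ V ∧
        (lo + W + a) * M ≤ Y.2 ∧ Conn S (A \ {Z | Z.1 ∈ V}) X Y) ≤
        Λ.card * (4 ^ (d + 1) * (corrTime b N β k : ℝ) *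
          Real.exp (scale b N k - waitTime b N β k / corrTime b N β k)) := by
      refine le_trans (prob_mono h.mem_unit ?_) ((prob_exists_le h.mem_unit Λ _).trans
        ((Finset.sum_le_card_nsmul _ _ _ e1).trans (by rw [nsmul_eq_mul])))
      rintro S - ⟨X, Y, ⟨h1, h2⟩, h3, h4, h5⟩
      exact ⟨X.1, h1, X, Y, rfl, Finset.mem_singleton.2 h2, (hdiv _ _).1 h4, h5⟩
    refine e2.trans (le_trans ?_ ((hL.tail_le k).trans ?_))
    · refine mul_le_mul_of_nonneg_right ?_ (by positivity)
      have := card_ballF_le x (scale b N k ^ 4)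
      exact_mod_cast this
    · have : (1 : ℝ) ≤ scale b N k := by exact_mod_cast scale_pos hb k
      rw [div_le_div_iff₀ (by positivity) (by norm_num)]; linarith
  · rintro X ⟨-, hX⟩
    rw [hdiv', hX]
    omega

/-- Long connections over a ball cross many slabs. -/
lemma IsLarge.prob_long_le (hL : IsLarge d N β m b) (hm : 2 ≤ m) (hN : 2 ≤ N) (hM : 0 < M)
    (h : IsModel g κ M p) (hκ : 0 < κ) (hκ1 : κ ≤ 1) (hκη : κ * waitTime b N β 0 ≤ thr b N β 0)
    (hg : IsSeparated b N β g) (k : ℕ) (hMk : 1 ≤ M * thr b N β (k + 1))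
    (hdec : ∀ j ≤ k, Decays b N β m g M F p j) (x : Vertex d) (i : ℤ) (n : ℕ) :
    prob F p (fun S => ∃ X Y : Site d, X.2 / M ≤ i ∧
      i + n * (waitTime b N β k + waitTime b N β 0 + 1) ≤ Y.2 / M ∧
      Conn S ({X | X.1 ∈ ballF x (scale b N k ^ 4)} ∩ goodSites b N β g (k + 1)) X Y) ≤
      (1 - (1 / 2) * thr b N β (k + 1) ^ (6 * N)) ^ n := by
  classical
  have hb : 0 < b := by linarith [hL.seven_le]
  set W := waitTime b N β k with hW
  set a := waitTime b N β 0 with ha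
  have hWpos : 0 < W := waitTime_pos hb k
  -- A slab includes both its first and its last block of time, so the extra 1 is what makes
  -- consecutive slabs disjoint.
  set lo : ℕ → ℤ := fun t => i + t * (W + a + 1) with hlo
  have key := prob_forall_lt_le_pow (F := F) h.mem_unit
    (fun t => {Z : Site d | lo t ≤ Z.2 / M ∧ Z.2 / M ≤ lo t + W + a}) ?_
    (fun t => SlabCrossed b N β g M k x (lo t)) ?_ ?_
    (fun t => hL.prob_slabCrossed_le hm hN hM h hκ hκ1 hκη hg k hMk hdec x (lo t)) n
  · refine le_trans (prob_mono h.mem_unit ?_) key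
    rintro S - ⟨X, Y, hX, hY, hc⟩ t ht
    have ht' : ((t : ℤ) + 1) * (W + a + 1) ≤ n * (W + a + 1) := by
      have : (t : ℤ) + 1 ≤ n := by exact_mod_cast ht
      exact mul_le_mul_of_nonneg_right this (by positivity)
    have ht0 : (0 : ℤ) ≤ t * (W + a + 1) := by positivity
    obtain ⟨X', Y', h1, h2, h3⟩ := hc.exists_crossing (f := fun Z : Site d => Z.2 / (M : ℤ))
      (fun e X Y hj => hj.ediv_le hM) (lo := lo t) (hi := lo t + W + a)
      (by simp only [hlo]; linarith) (by omega) (by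
        simp only [hlo]; linarith)
    have h4 := h3.mono (A' := slab b N β g M k x (lo t)) le_rfl (by
      rintro Z ⟨⟨z1, z2⟩, z3, z4⟩
      exact ⟨⟨z1, z3, z4⟩, z2⟩)
    refine ⟨X', Y', ⟨?_, h1⟩, h2.ge, h4⟩
    rcases h4.eq_or_mem with h5 | h5
    · rw [h5] at h1
      have := h1.symm.trans h2
      omega
    · exact h5.1.1.1
  · intro s t hst
    refine Set.disjoint_left.2 ?_
    rintro Z ⟨z1, z2⟩ ⟨z3, z4⟩
    simp only [hlo] at z1 z2 z3 z4
    rcases Nat.lt_or_gt_of_ne hst with hlt | hlt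
    · have : ((s : ℤ) + 1) * (W + a + 1) ≤ t * (W + a + 1) :=
        mul_le_mul_of_nonneg_right (by exact_mod_cast hlt) (by positivity)
      linarith
    · have : ((t : ℤ) + 1) * (W + a + 1) ≤ s * (W + a + 1) :=
        mul_le_mul_of_nonneg_right (by exact_mod_cast hlt) (by positivity)
      linarith
  · rintro t S T hST ⟨X, Y, h1, h2, h3⟩
    exact ⟨X, Y, h1, h2, h3.mono hST le_rfl⟩
  · rintro t S ⟨X, Y, h1, h2, h3⟩
    refine ⟨X, Y, h1, h2, h3.restrict.mono ?_ le_rfl⟩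
    rintro e ⟨he, Z, hZ, W', hW', hj⟩
    exact ⟨he, Z, hZ.1.2, W', hW'.1.2, hj⟩

end Induction

/-! ### The step from one scale to the next -/

section Induction

variable {d : ℕ} {F : Finset (FineEdge d)} {p : FineEdge d → ℝ} {M : ℕ} {g : Vertex d → ℝ} {κ : ℝ}
  {b N β : ℕ} {m : ℝ}

/-- The number of slabs in a box at level `k`. -/
def numSlabs (b N β k : ℕ) : ℕ := 2 * scale b N k ^ 5 * scale b N (k + 1) ^ (β * (6 * N))

/-- The extension in time of a box at level `k`. -/
def boxTime (b N β k : ℕ) : ℕ := numSlabs b N β k * (waitTime b N β k + waitTime b N β 0 + 1)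

/-- This is the origin of the exponent 12N + 1. The number of slabs uses up 6Nβ powers of the next
scale; the remaining (6N+1)β powers, expressed through `ratio`, cover the duration of a slab of
level `k`, the factor `y ^ 5` and the constant 7. -/
lemma boxTime_lt_corrTime (hb : 7 ≤ b) (hN : 2 ≤ N) (hβ : 1 ≤ β) (k : ℕ) :
    boxTime b N β k + 1 ≤ corrTime b N β (k + 1) := by
  have hb0 : 0 < b := by omega
  set y := scale b N k with hy
  have hy7 : 7 ≤ y := hb.trans (le_scale k)
  have hW : waitTime b N β k + waitTime b N β 0 + 1 ≤ 3 * y ^ (β * (12 * N + 1) + 2) := by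
    have h1 : waitTime b N β k = y ^ (β * (12 * N + 1) + 2) := by
      rw [waitTime, corrTime, ← pow_add]
    have h2 := waitTime_mono (b := b) (N := N) (β := β) (Nat.zero_le k)
    have h3 := waitTime_pos (N := N) (β := β) hb0 k
    omega
  have h4 : boxTime b N β k + 1 ≤
      7 * (y ^ 5 * y ^ (ratio N * (β * (6 * N))) * y ^ (β * (12 * N + 1) + 2)) := by
    have h5 : boxTime b N β k ≤
        6 * (y ^ 5 * y ^ (ratio N * (β * (6 * N))) * y ^ (β * (12 * N + 1) + 2)) := by
      unfold boxTime numSlabs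
      rw [scale_succ, ← pow_mul, ← hy]
      refine (Nat.mul_le_mul_left _ hW).trans (le_of_eq (by ring))
    have h6 : 0 < y ^ 5 * y ^ (ratio N * (β * (6 * N))) * y ^ (β * (12 * N + 1) + 2) := by
      have : 0 < y := by omega
      positivity
    omega
  refine h4.trans ((Nat.mul_le_mul_right _ hy7).trans ?_)
  rw [corrTime, scale_succ, ← pow_mul, ← pow_add, ← pow_add, ← hy, ← pow_succ']
  refine Nat.pow_le_pow_right (by omega) ?_
  unfold ratio
  have h7 : 8 ≤ β * (12 * N ^ 2 + 2 * N + 1) := by nlinarith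
  nlinarith

/-- A connection leaves a box of radius `y ^ 4` either sideways, with probability `lat`, or in time,
with probability at most `2 * tim`. Both are small compared with the number of exit cells and their
weight, so `prob_cellConn_le_exp` applies. -/
lemma IsLarge.decays_succ (hL : IsLarge d N β m b) (hm : 2 ≤ m) (hN : 2 ≤ N) (hβ : 1 ≤ β)
    (hM : 0 < M) (h : IsModel g κ M p) (hκ : 0 < κ) (hκ1 : κ ≤ 1)
    (hκη : κ * waitTime b N β 0 ≤ thr b N β 0) (hg : IsSeparated b N β g) (k : ℕ)
    (hMk : 1 ≤ M * thr b N β (k + 1)) (hdec : ∀ j ≤ k, Decays b N β m g M F p j) :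
    Decays b N β m g M F p (k + 1) := by
  classical
  have hb : 0 < b := by linarith [hL.seven_le]
  set y := scale b N k with hy
  have hyb : b ≤ y := le_scale k
  have hy1 : (1 : ℝ) ≤ y := by exact_mod_cast scale_pos hb k
  set r := y ^ 4 with hr
  set T' := boxTime b N β k with hT'
  set T₁ := corrTime b N β (k + 1) with hT₁
  have hTT : T' + 1 ≤ T₁ := boxTime_lt_corrTime hL.seven_le hN hβ k
  have hTTr : (T' : ℝ) + 1 ≤ T₁ := by exact_mod_cast hTT
  have hT₁pos : (0 : ℝ) < T₁ := by exact_mod_cast corrTime_pos hb _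
  have hT₁eq : (T₁ : ℝ) = (y : ℝ) ^ (ratio N * (β * (12 * N + 1))) := by
    rw [hT₁, corrTime, scale_succ, ← pow_mul]; push_cast; rfl
  set m₀ := mass m k with hm₀
  set m₁ := mass m (k + 1) with hm₁
  have hm₀1 : 2 ≤ m₀ := hm.trans (le_mass m k)
  have hm₁1 : 2 ≤ m₁ := hm.trans (le_mass m (k + 1))
  have hm₁le : m₁ ≤ m + 1 := mass_le m (k + 1)
  have hm₀le : m₀ ≤ m + 1 := mass_le m k
  -- The rate drops by `(1/2)^(k+1)`, which is at least `1 / y`; over the distance `y ^ 4` this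
  -- gains `y ^ 3` in the exponent, enough for the prefactor raised to the power `2 ^ N`.
  have hgap : m₁ * r + y ^ 3 ≤ m₀ * r := by
    have e1 : m₀ - m₁ = (1 / 2) ^ (k + 1) := by
      simp only [hm₀, hm₁, mass, pow_succ]; ring
    have e2 : ((2 ^ (k + 1) : ℕ) : ℝ) ≤ y := by
      exact_mod_cast two_pow_le_scale (by linarith [hL.seven_le]) k
    have e3 : (1 : ℝ) ≤ (1 / 2) ^ (k + 1) * y := by
      push_cast at e2
      rw [one_div_pow, one_div_mul_eq_div, le_div_iff₀ (by positivity)]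
      linarith
    have e4 : (r : ℝ) = y * y ^ 3 := by rw [hr]; push_cast; ring
    have e5 : (0 : ℝ) ≤ (y : ℝ) ^ 3 := by positivity
    rw [e4]
    nlinarith
  set lat : ℝ := 3 ^ d * ((2 * (3 ^ d * (2 * (T₁ : ℝ)) * Real.exp (m + 1)) ^ 2 *
      Real.exp y) ^ 2 ^ N * Real.exp (-(m₀ * r))) with hlat
  set tim : ℝ := (1 - (1 / 2) * thr b N β (k + 1) ^ (6 * N)) ^ numSlabs b N β k with htim
  set Q : Site d → Set (Site d) := fun c =>
    {c' | c'.1 ∈ ballF c.1 r ∧ c.2 - T' ≤ c'.2 ∧ c'.2 ≤ c.2 + T'} with hQ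
  set A := goodSites b N β g (k + 1) with hA
  -- The number of slabs is chosen so that its product with the blocking probability `π` is exactly
  -- `y ^ 5`.
  have htim_le : tim ≤ Real.exp (-(y : ℝ) ^ 5) := by
    set π := (1 / 2) * thr b N β (k + 1) ^ (6 * N) with hπ
    have hs0 : (0 : ℝ) < scale b N (k + 1) := by exact_mod_cast scale_pos hb _
    have hπ1 : π ≤ 1 := by
      have := pow_le_one₀ (n := 6 * N) (thr_pos (N := N) (β := β) hb (k + 1)).le (thr_le_one hb _)
      rw [hπ]; linarith
    have e1 : 1 - π ≤ Real.exp (-π) := by linarith [Real.add_one_le_exp (-π)]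
    refine (pow_le_pow_left₀ (by linarith) e1 _).trans (le_of_eq ?_)
    rw [← Real.exp_nat_mul]
    congr 1
    rw [hπ, thr, numSlabs, inv_pow, ← pow_mul]
    push_cast
    field_simp
    rfl
  -- decay inside a box
  have hbox : ∀ c q : Site d, c.2 - T' ≤ q.2 → q.2 ≤ c.2 + T' →
      prob F p (CellConn M (A ∩ cell M ⁻¹' Q c) c q) ≤
      (2 * (3 ^ d * (2 * (T₁ : ℝ)) * Real.exp (m + 1)) ^ 2 * Real.exp y) ^ 2 ^ N *
        Real.exp (-(m₀ * dst c.1 q.1)) := by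
    intro c q hq1 hq2
    set I : Finset ℤ := Finset.Icc (c.2 - T') (c.2 + T') with hI
    -- Without these at most `N` lines the box has only sites good at level `k`, where the decay is
    -- known; the lines are then put back one by one.
    set V := (ballF c.1 r).filter fun z => HasLevel b N β g k z with hV
    have hVN : V.card ≤ N := by
      refine le_trans (Finset.card_le_card fun z hz => ?_) (hg k c.1)
      have hz' := Finset.mem_filter.1 hz
      refine Finset.mem_filter.2 ⟨mem_ballF.2 ((mem_ballF.1 hz'.1).trans ?_), hz'.2.2⟩
      exact Nat.pow_le_pow_right (by omega) (by omega)
    have hIcard : (I.card : ℝ) ≤ 2 * T₁ := by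
      rw [hI, Int.card_Icc]
      have : (c.2 + T' + 1 - (c.2 - T') : ℤ).toNat = 2 * T' + 1 := by omega
      rw [this]; push_cast; linarith
    set a := 2 * (3 ^ d * (2 * (T₁ : ℝ)) * Real.exp (m + 1)) ^ 2 with ha
    have ha2 : 2 ≤ a := by
      have e1 : (1 : ℝ) ≤ 3 ^ d := one_le_pow₀ (by norm_num)
      have e2 : (1 : ℝ) ≤ 2 * (T₁ : ℝ) := by
        have : (1 : ℝ) ≤ T₁ := by exact_mod_cast corrTime_pos hb _
        linarith
      have e3 : 1 ≤ Real.exp (m + 1) := Real.one_le_exp (by linarith)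
      have e4 : 1 ≤ 3 ^ d * (2 * (T₁ : ℝ)) * Real.exp (m + 1) :=
        one_le_mul_of_one_le_of_one_le (one_le_mul_of_one_le_of_one_le e1 e2) e3
      have := one_le_pow₀ e4 (n := 2)
      rw [ha]; linarith
    have hey : 1 ≤ Real.exp y := Real.one_le_exp (by linarith)
    have key := prob_cellConn_add_lines (F := F) (M := M) h.mem_unit V (m := m₀)
      (K := a * Real.exp y) (a := a) (by linarith) I ?_ ha2 (le_mul_of_one_le_right (by linarith) hey)
      (A := A ∩ cell M ⁻¹' Q c) (fun X hX => Finset.mem_Icc.2 hX.2.2) ?_ c q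
      (Finset.mem_Icc.2 (by constructor <;> omega)) (Finset.mem_Icc.2 ⟨hq1, hq2⟩)
    · have e1 : prob F p (CellConn M (A ∩ cell M ⁻¹' Q c) c q) ≤
          a * prob F p (CellConn M (A ∩ cell M ⁻¹' Q c) c q) :=
        le_mul_of_one_le_left (prob_nonneg h.mem_unit _) (by linarith)
      refine e1.trans (key.trans (mul_le_mul_of_nonneg_right ?_ (Real.exp_pos _).le))
      exact pow_le_pow_right₀ (one_le_mul_of_one_le_of_one_le (by linarith) hey)
        (Nat.pow_le_pow_right (by norm_num) hVN)
    · rw [ha]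
      push_cast
      gcongr
    · intro c₁ c₂ _ _
      rw [mul_assoc a]
      refine mul_le_mul_of_nonneg_left ?_ (show (0 : ℝ) ≤ a by linarith)
      refine le_trans (prob_mono h.mem_unit ?_) ((hdec k le_rfl c₁ c₂).trans ?_)
      · rintro S - ⟨X, Y, h1, h2, h3⟩
        refine ⟨X, Y, h1, h2, h3.mono le_rfl ?_⟩
        rintro Z ⟨⟨z1, z2⟩, z3⟩
        by_contra hcon
        exact z3 (Finset.mem_filter.2 ⟨z2.1, z1, not_le.1 hcon⟩)
      · rw [← Real.exp_add]
        refine Real.exp_le_exp.2 ?_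
        unfold weight
        have : 0 ≤ |(c₁.2 : ℝ) - c₂.2| / corrTime b N β k := by positivity
        linarith
  have hexit : ∀ c c', prob F p (ExitAt M A (Q c) c c') ≤ lat + 2 * tim := by
    intro c c'
    -- The possible last vertices before a sideways exit to `c'`. A horizontal edge does not change
    -- the time, so the inner cell has the time of `c'`.
    set L := (ballF c'.1 1).filter fun q => r ≤ dst c.1 q with hLdef
    have e1 : prob F p (ExitAt M A (Q c) c c') ≤ prob F p (fun S =>
        (∃ q ∈ L, (c.2 - T' ≤ c'.2 ∧ c'.2 ≤ c.2 + T') ∧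
          CellConn M (A ∩ cell M ⁻¹' Q c) c (q, c'.2) S) ∨
        ((∃ X Y : Site d, X.2 / M ≤ c.2 ∧
          c.2 + numSlabs b N β k * (waitTime b N β k + waitTime b N β 0 + 1) ≤ Y.2 / M ∧
          Conn S ({X | X.1 ∈ ballF c.1 (scale b N k ^ 4)} ∩ A) X Y) ∨
        (∃ X Y : Site d, X.2 / M ≤ c.2 - T' ∧
          c.2 - T' + numSlabs b N β k * (waitTime b N β k + waitTime b N β 0 + 1) ≤ Y.2 / M ∧
          Conn S ({X | X.1 ∈ ballF c.1 (scale b N k ^ 4)} ∩ A) X Y))) := by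
      have hTeq : (T' : ℤ) = numSlabs b N β k * (waitTime b N β k + waitTime b N β 0 + 1) := by
        rw [hT', boxTime]; push_cast; rfl
      refine prob_mono h.mem_unit ?_
      rintro S - ⟨hc', X, w, z, e, hX, hXw, hw, hz, ⟨hw1, hw2, hw3⟩, he, hj, rfl⟩
      rw [cell_fst] at hw1
      rw [cell_snd] at hw2 hw3
      by_cases hwz : w.1 = z.1
      · right
        have hzQ : z.2 / M < c.2 - T' ∨ c.2 + T' < z.2 / M := by
          by_contra hcon
          push Not at hcon
          exact hc' ⟨by rw [cell_fst, ← hwz]; exact hw1, hcon⟩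
        have hXc : X.2 / M = c.2 := by rw [← hX]; rfl
        have hcon : Conn S ({X | X.1 ∈ ballF c.1 (scale b N k ^ 4)} ∩ A) X w :=
          hXw.mono le_rfl fun Z hZ => ⟨hZ.2.1, hZ.1⟩
        have d1 := hj.ediv_le hM
        have d2 := hj.symm.ediv_le hM
        -- Slabs are crossed upwards, so an exit through the bottom is read backwards, from `w` up
        -- to `X`.
        rcases hzQ with hzQ | hzQ
        · right
          refine ⟨w, X, by omega, ?_, hcon.symm⟩
          rw [← hTeq]; omega
        · left
          refine ⟨X, w, by omega, ?_, hcon⟩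
          rw [← hTeq]; omega
      · left
        obtain ⟨i, -, -, hi⟩ := hj.exists_incEdge hwz
        have hcz : c.2 - T' ≤ (cell M z).2 ∧ (cell M z).2 ≤ c.2 + T' := by
          rw [cell_snd, ← hi]; exact ⟨hw2, hw3⟩
        refine ⟨w.1, Finset.mem_filter.2 ⟨mem_ballF.2 ?_, ?_⟩, hcz, X, w, hX, ?_, hXw⟩
        · rw [cell_fst, dst_comm]; exact hj.dst_le
        · have d1 : ¬ dst c.1 z.1 ≤ r := fun hcon => hc' ⟨mem_ballF.2 hcon, hcz⟩
          have d2 := dst_triangle c.1 w.1 z.1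
          have d3 := hj.dst_le
          omega
        · rw [cell, cell, hi]
    have e2 : prob F p (fun S => ∃ q ∈ L, (c.2 - T' ≤ c'.2 ∧ c'.2 ≤ c.2 + T') ∧
          CellConn M (A ∩ cell M ⁻¹' Q c) c (q, c'.2) S) ≤ lat := by
      refine (prob_exists_le h.mem_unit _ _).trans ?_
      refine (Finset.sum_le_card_nsmul _ _ ((2 * (3 ^ d * (2 * (T₁ : ℝ)) *
        Real.exp (m + 1)) ^ 2 * Real.exp y) ^ 2 ^ N * Real.exp (-(m₀ * r))) fun q hq => ?_).trans ?_
      · by_cases hc : c.2 - T' ≤ c'.2 ∧ c'.2 ≤ c.2 + T'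
        · refine le_trans (prob_mono h.mem_unit fun S _ hS => hS.2)
            ((hbox c (q, c'.2) hc.1 hc.2).trans (mul_le_mul_of_nonneg_left ?_ (by positivity)))
          refine Real.exp_le_exp.2 ?_
          have d1 : (r : ℝ) ≤ dst c.1 q := by exact_mod_cast (Finset.mem_filter.1 hq).2
          have := mul_le_mul_of_nonneg_left d1 (by linarith : (0 : ℝ) ≤ m₀)
          simp only; linarith
        · rw [prob_false fun S _ hS => hc hS.1]
          positivity
      · rw [nsmul_eq_mul, hlat]
        refine mul_le_mul_of_nonneg_right ?_ (by positivity)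
        have := (Finset.card_filter_le (ballF c'.1 1) fun q => r ≤ dst c.1 q).trans
          (card_ballF_le c'.1 1)
        exact_mod_cast this
    have e3 := fun i => hL.prob_long_le (F := F) hm hN hM h hκ hκ1 hκη hg k hMk hdec c.1 i
      (numSlabs b N β k)
    refine e1.trans ((prob_or_le h.mem_unit _ _).trans (add_le_add e2
      ((prob_or_le h.mem_unit _ _).trans ?_)))
    linarith [e3 c.2, e3 (c.2 - T')]
  intro c c'
  refine prob_cellConn_le_exp (F := F) (A := A) h.mem_unit (weight_nonneg (by linarith) hT₁pos.le)
    (weight_triangle (by linarith) hT₁pos.le) Q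
    (fun c => ballF c.1 (r + 1) ×ˢ Finset.Icc (c.2 - T' - 1) (c.2 + T' + 1)) ?_ ?_ ?_ ?_ c c'
  · intro c
    refine ⟨mem_ballF.2 (by rw [dst_self]; omega), by omega, by omega⟩
  · rintro c q ⟨h1, h2, h3⟩
    have d1 : (dst c.1 q.1 : ℝ) ≤ (y : ℝ) ^ 4 := by exact_mod_cast mem_ballF.1 h1
    have d2 : |(c.2 : ℝ) - q.2| ≤ T' := by
      rw [abs_le]
      have h2' : ((c.2 - T' : ℤ) : ℝ) ≤ q.2 := by exact_mod_cast h2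
      have h3' : (q.2 : ℝ) ≤ (c.2 + T' : ℤ) := by exact_mod_cast h3
      push_cast at h2' h3'
      constructor <;> linarith
    have d3 : |(c.2 : ℝ) - q.2| / T₁ ≤ 1 := by rw [div_le_one hT₁pos]; linarith
    have d4 : m₁ * dst c.1 q.1 ≤ (m + 1) * (y : ℝ) ^ 4 :=
      mul_le_mul hm₁le d1 (Nat.cast_nonneg _) (by linarith)
    have d5 := hL.mass_bound y hyb
    have d6 : (y : ℝ) ^ 5 ≤ scale b N (k + 1) := by
      rw [scale_succ]
      push_cast
      exact pow_le_pow_right₀ hy1 (by unfold ratio; omega)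
    unfold weight
    linarith
  · rintro c w z e hj - - ⟨h1, h2, h3⟩ -
    have e1 := hj.ediv_le hM
    have e2 := hj.symm.ediv_le hM
    have e3 := hj.dst_le
    have e4 := dst_triangle c.1 w.1 z.1
    have e5 := mem_ballF.1 h1
    rw [cell_fst] at e5
    rw [cell_snd] at h2 h3
    simp only [Finset.mem_product, mem_ballF, cell_fst, cell_snd, Finset.mem_Icc]
    omega
  · intro c
    have hlt0 : 0 ≤ lat + 2 * tim := (prob_nonneg h.mem_unit _).trans (hexit c c)
    have hlat0 : 0 ≤ lat := by rw [hlat]; positivity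
    refine (Finset.sum_le_card_nsmul _ _ ((lat + 2 * tim) * Real.exp (m₁ * (r + 1) + 1))
      fun q hq => ?_).trans ?_
    · refine mul_le_mul (hexit c q) (Real.exp_le_exp.2 ?_) (Real.exp_pos _).le hlt0
      simp only [Finset.mem_product, mem_ballF, Finset.mem_Icc] at hq
      have d1 : (dst c.1 q.1 : ℝ) ≤ r + 1 := by exact_mod_cast hq.1
      have d2 : |(c.2 : ℝ) - q.2| ≤ T' + 1 := by
        rw [abs_le]
        have h2' : ((c.2 - T' - 1 : ℤ) : ℝ) ≤ q.2 := by exact_mod_cast hq.2.1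
        have h3' : (q.2 : ℝ) ≤ (c.2 + T' + 1 : ℤ) := by exact_mod_cast hq.2.2
        push_cast at h2' h3'
        constructor <;> linarith
      have d3 : |(c.2 : ℝ) - q.2| / T₁ ≤ 1 := by rw [div_le_one hT₁pos]; linarith
      have d4 := mul_le_mul_of_nonneg_left d1 (by linarith : (0 : ℝ) ≤ m₁)
      unfold weight
      linarith
    · rw [nsmul_eq_mul]
      set C : ℝ := (2 * (y : ℝ) ^ 4 + 3) ^ d * (3 * (y : ℝ) ^ (ratio N * (β * (12 * N + 1)))) with hC
      have hcard : ((ballF c.1 (r + 1) ×ˢ Finset.Icc (c.2 - T' - 1) (c.2 + T' + 1)).card : ℝ) ≤ C := by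
        rw [Finset.card_product, Int.card_Icc, hC, ← hT₁eq]
        have d1 : (c.2 + T' + 1 + 1 - (c.2 - T' - 1) : ℤ).toNat = 2 * T' + 3 := by omega
        rw [d1]
        push_cast
        refine mul_le_mul ?_ (by linarith) (by positivity) (by positivity)
        have d2 := card_ballF_le c.1 (r + 1)
        have d3 : ((2 * (r + 1) + 1 : ℕ) : ℝ) = 2 * (y : ℝ) ^ 4 + 3 := by
          rw [hr]; push_cast; ring
        rw [← d3]; exact_mod_cast d2
      have hC0 : 0 ≤ C := by rw [hC]; positivity
      have f1 : C * (lat * Real.exp (m₁ * (r + 1) + 1)) ≤ 1 / 4 := by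
        refine le_trans (mul_le_mul_of_nonneg_left ?_ hC0) (hL.lateral y hyb)
        rw [hlat, ← hT₁eq]
        generalize (2 * (3 ^ d * (2 * (T₁ : ℝ)) * Real.exp (m + 1)) ^ 2 * Real.exp y) = B at *
        have d1 : 3 ^ d * (B ^ 2 ^ N * Real.exp (-(m₀ * r))) * Real.exp (m₁ * (r + 1) + 1) =
            3 ^ d * B ^ 2 ^ N * Real.exp (-(m₀ * r) + (m₁ * (r + 1) + 1)) := by
          rw [Real.exp_add (-(m₀ * r))]; ring
        rw [d1]
        have hB : 0 ≤ 3 ^ d * B ^ 2 ^ N :=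
          mul_nonneg (by positivity) (Even.pow_nonneg ((even_two).pow_of_ne_zero (by omega)) B)
        exact mul_le_mul_of_nonneg_left (Real.exp_le_exp.2 (by linarith)) hB
      have f2 : C * (tim * Real.exp (m₁ * (r + 1) + 1)) ≤ 1 / 8 := by
        refine le_trans (mul_le_mul_of_nonneg_left ?_ hC0) (hL.time y hyb)
        refine (mul_le_mul_of_nonneg_right htim_le (Real.exp_pos _).le).trans ?_
        rw [← Real.exp_add]
        refine Real.exp_le_exp.2 ?_
        have d1 : (r : ℝ) = (y : ℝ) ^ 4 := by rw [hr]; push_cast; rfl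
        rw [d1]
        have : m₁ * ((y : ℝ) ^ 4 + 1) ≤ (m + 1) * ((y : ℝ) ^ 4 + 1) :=
          mul_le_mul_of_nonneg_right hm₁le (by positivity)
        linarith
      refine (mul_le_mul_of_nonneg_right hcard (by positivity)).trans ?_
      linarith

/-- Decay at all scales. -/
theorem IsLarge.decays (hL : IsLarge d N β m b) (hm : 2 ≤ m) (hN : 2 ≤ N) (hβ : 1 ≤ β)
    (hM : 0 < M) (h : IsModel g κ M p) (hκ : 0 < κ) (hκ1 : κ ≤ 1)
    (hκη : κ * waitTime b N β 0 ≤ thr b N β 0)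
    (hκs : (5 * 3 ^ d : ℕ) * ((6 * d * (κ / thr b N β 0) + 2 * Real.exp (-(thr b N β 0 / κ))) *
      Real.exp (m + 1 + 2)) ≤ 1 / 2)
    (hg : IsSeparated b N β g) (k : ℕ) (hMk : 1 ≤ M * thr b N β k) :
    Decays b N β m g M F p k := by
  have hb : 0 < b := by linarith [hL.seven_le]
  induction k using Nat.strong_induction_on with
  | _ k ih =>
  rcases k with _ | k
  · intro c c'
    have e0 : mass m 0 = m + 1 := by simp [mass]
    have e1 := h.prob_cellConn_le_of_good (F := F) hM (thr_pos (N := N) (β := β) hb 0) hκ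
      (m := mass m 0) (by rw [e0]; linarith) (by rw [e0]; exact hκs) c c'
    refine e1.trans (Real.exp_le_exp.2 ?_)
    have e2 : (1 : ℝ) ≤ scale b N 0 := by exact_mod_cast scale_pos hb 0
    have e3 : (1 : ℝ) ≤ corrTime b N β 0 := by exact_mod_cast corrTime_pos hb 0
    unfold weight
    have := div_le_div_of_nonneg_left (abs_nonneg ((c.2 : ℝ) - c'.2)) one_pos e3
    linarith
  · refine hL.decays_succ hm hN hβ hM h hκ hκ1 hκη hg k hMk fun j hj => ih j (by omega) ?_
    refine hMk.trans (mul_le_mul_of_nonneg_left (thr_anti hb (by omega)) (Nat.cast_nonneg _))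

end Induction

/-! ### Largeness of the basic scale -/

section Numerics

lemma le_exp_self (x : ℝ) : x ≤ Real.exp x := by linarith [Real.add_one_le_exp x]

lemma pow_le_exp_mul {x : ℝ} (hx : 0 ≤ x) (n : ℕ) : x ^ n ≤ Real.exp (n * x) := by
  rw [Real.exp_nat_mul]
  exact pow_le_pow_left₀ hx (le_exp_self x) n

lemma add_pow_four_le_exp {y : ℝ} (hy : 1 ≤ y) : 2 * y ^ 4 + 3 ≤ Real.exp (4 * y + 5) := by
  have h1 := pow_le_exp_mul (zero_le_one.trans hy) 4
  have h2 := one_le_pow₀ hy (n := 4)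
  push_cast at h1
  rw [Real.exp_add]
  have h3 := le_exp_self 5
  nlinarith [Real.exp_pos (4 * y)]

lemma exp_neg_le_one_div {y : ℝ} (hy : 1 ≤ y) : Real.exp (-(y + 8)) ≤ 1 / (8 * y) := by
  rw [Real.exp_neg, ← one_div]
  refine one_div_le_one_div_of_le (by linarith) ?_
  rw [Real.exp_add]
  nlinarith [le_exp_self y, le_exp_self 8, Real.exp_pos y]

/-- Once all powers of `y` are bounded by exponentials of linear functions, the exponential
conditions in `IsLarge` reduce to comparisons of this kind. -/
lemma eventually_linear_le_sq (a c : ℝ) : ∀ᶠ y : ℕ in atTop, a * y + c ≤ (y : ℝ) ^ 2 := by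
  filter_upwards [eventually_ge_atTop (⌈|a| + |c| + 1⌉₊)] with y hy
  have h : |a| + |c| + 1 ≤ (y : ℝ) := Nat.ceil_le.1 hy
  have h1 := le_abs_self a
  have h2 := le_abs_self c
  have h3 := abs_nonneg a
  have h4 := abs_nonneg c
  nlinarith

lemma eventually_tail (d n : ℕ) : ∀ᶠ y : ℕ in atTop, (2 * (y : ℝ) ^ 4 + 1) ^ d *
    (4 ^ (d + 1) * (y : ℝ) ^ n * Real.exp (y - (y : ℝ) ^ 2)) ≤ 1 / (8 * y) := by
  filter_upwards [eventually_ge_atTop 1,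
    eventually_linear_le_sq (4 * d + n + 2) (5 * d + 4 * (d + 1) + 8)] with y hy1 hy
  have h1 : (1 : ℝ) ≤ y := by exact_mod_cast hy1
  refine le_trans ?_ (exp_neg_le_one_div h1)
  calc _ ≤ Real.exp (4 * y + 5) ^ d * (Real.exp ((d + 1 : ℕ) * 4) * Real.exp (n * y) *
        Real.exp (y - (y : ℝ) ^ 2)) := by
        gcongr
        · linarith [add_pow_four_le_exp h1]
        · exact pow_le_exp_mul (by norm_num) _
        · exact pow_le_exp_mul (by linarith) _
    _ = Real.exp (d * (4 * y + 5) + ((d + 1 : ℕ) * 4 + n * y + (y - (y : ℝ) ^ 2))) := by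
        rw [← Real.exp_nat_mul]; simp only [← Real.exp_add]
    _ ≤ _ := by
        refine Real.exp_le_exp.2 ?_
        push_cast
        linarith

lemma eventually_far (d n₁ n₂ : ℕ) : ∀ᶠ y : ℕ in atTop, (y : ℝ) ^ n₁ *
    (4 ^ (d + 1) * (y : ℝ) ^ n₂ * Real.exp (y + 1 - (y : ℝ) ^ 4)) ≤ 1 / (8 * y) := by
  filter_upwards [eventually_ge_atTop 1,
    eventually_linear_le_sq (n₁ + n₂ + 2) (4 * (d + 1) + 9)] with y hy1 hy
  have h1 : (1 : ℝ) ≤ y := by exact_mod_cast hy1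
  refine le_trans ?_ (exp_neg_le_one_div h1)
  calc _ ≤ Real.exp (n₁ * y) * (Real.exp ((d + 1 : ℕ) * 4) * Real.exp (n₂ * y) *
        Real.exp (y + 1 - (y : ℝ) ^ 4)) := by
        gcongr
        · exact pow_le_exp_mul (by linarith) _
        · exact pow_le_exp_mul (by norm_num) _
        · exact pow_le_exp_mul (by linarith) _
    _ = Real.exp (n₁ * y + ((d + 1 : ℕ) * 4 + n₂ * y + (y + 1 - (y : ℝ) ^ 4))) := by
        simp only [← Real.exp_add]
    _ ≤ _ := by
        refine Real.exp_le_exp.2 ?_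
        have := pow_le_pow_right₀ h1 (show 2 ≤ 4 by norm_num)
        push_cast
        linarith

lemma exp_neg_two_le : Real.exp (-2) ≤ 1 / 4 := by
  have h := Real.add_one_le_exp 1
  rw [Real.exp_neg, ← one_div, show (2 : ℝ) = 1 + 1 by norm_num, Real.exp_add]
  exact one_div_le_one_div_of_le (by norm_num) (by nlinarith)

lemma exp_neg_three_le : Real.exp (-3) ≤ 1 / 8 := by
  have h := Real.add_one_le_exp 1
  have h2 := exp_neg_two_le
  have h3 : Real.exp (-1) ≤ 1 / 2 := by
    rw [Real.exp_neg, ← one_div]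
    exact one_div_le_one_div_of_le (by norm_num) (by linarith)
  rw [show (-3 : ℝ) = -2 + -1 by norm_num, Real.exp_add]
  nlinarith [Real.exp_pos (-2), Real.exp_pos (-1)]

lemma eventually_lateral (d n N : ℕ) (m : ℝ) : ∀ᶠ y : ℕ in atTop, (2 * (y : ℝ) ^ 4 + 3) ^ d *
    (3 * (y : ℝ) ^ n) * (3 ^ d * (2 * (3 ^ d * (2 * (y : ℝ) ^ n) * Real.exp (m + 1)) ^ 2 *
      Real.exp y) ^ 2 ^ N * Real.exp (-(y : ℝ) ^ 3 + m + 2)) ≤ 1 / 4 := by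
  filter_upwards [eventually_ge_atTop 1,
    eventually_linear_le_sq (4 * d + n + 2 ^ N * (2 * n + 1))
      (5 * d + 3 + 3 * d + 2 ^ N * (2 + 2 * (3 * d + 2 + (m + 1))) + m + 4)] with y hy1 hy
  have h1 : (1 : ℝ) ≤ y := by exact_mod_cast hy1
  refine le_trans ?_ exp_neg_two_le
  calc _ ≤ Real.exp (4 * y + 5) ^ d * (Real.exp 3 * Real.exp (n * y)) *
        (Real.exp (d * 3) * (Real.exp 2 * (Real.exp (d * 3) * (Real.exp 2 * Real.exp (n * y)) *
          Real.exp (m + 1)) ^ 2 * Real.exp y) ^ 2 ^ N * Real.exp (-(y : ℝ) ^ 3 + m + 2)) := by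
        gcongr
        · linarith [add_pow_four_le_exp h1]
        · exact le_exp_self 3
        · exact pow_le_exp_mul (by linarith) _
        · exact pow_le_exp_mul (by norm_num) _
        · exact le_exp_self 2
        · exact pow_le_exp_mul (by norm_num) _
        · exact le_exp_self 2
        · exact pow_le_exp_mul (by linarith) _
    _ = Real.exp (d * (4 * y + 5) + (3 + n * y) + (d * 3 + ((2 ^ N : ℕ) * (2 + (2 : ℕ) * (d * 3 +
          (2 + n * y) + (m + 1)) + y)) + (-(y : ℝ) ^ 3 + m + 2))) := by
        simp only [← Real.exp_nat_mul, ← Real.exp_add]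
    _ ≤ _ := by
        refine Real.exp_le_exp.2 ?_
        have := pow_le_pow_right₀ h1 (show 2 ≤ 3 by norm_num)
        push_cast
        linarith

lemma eventually_time (d n : ℕ) (m : ℝ) : ∀ᶠ y : ℕ in atTop, (2 * (y : ℝ) ^ 4 + 3) ^ d *
    (3 * (y : ℝ) ^ n) *
    Real.exp (-(y : ℝ) ^ 5 + (m + 1) * ((y : ℝ) ^ 4 + 1) + 1) ≤ 1 / 8 := by
  filter_upwards [eventually_ge_atTop 1, eventually_ge_atTop ⌈m + 2⌉₊,
    eventually_linear_le_sq (4 * d + n) (5 * d + 3 + m + 1 + 4)] with y hy1 hy2 hy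
  have h1 : (1 : ℝ) ≤ y := by exact_mod_cast hy1
  have h2 : m + 2 ≤ y := Nat.ceil_le.1 hy2
  refine le_trans ?_ exp_neg_three_le
  calc _ ≤ Real.exp (4 * y + 5) ^ d * (Real.exp 3 * Real.exp (n * y)) *
        Real.exp (-(y : ℝ) ^ 5 + (m + 1) * ((y : ℝ) ^ 4 + 1) + 1) := by
        gcongr
        · linarith [add_pow_four_le_exp h1]
        · exact le_exp_self 3
        · exact pow_le_exp_mul (by linarith) _
    _ = Real.exp (d * (4 * y + 5) + (3 + n * y) +
          (-(y : ℝ) ^ 5 + (m + 1) * ((y : ℝ) ^ 4 + 1) + 1)) := by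
        simp only [← Real.exp_nat_mul, ← Real.exp_add]
    _ ≤ _ := by
        refine Real.exp_le_exp.2 ?_
        have h3 := pow_le_pow_right₀ h1 (show 2 ≤ 4 by norm_num)
        have h4 : (m + 2) * (y : ℝ) ^ 4 ≤ y * (y : ℝ) ^ 4 :=
          mul_le_mul_of_nonneg_right h2 (by positivity)
        have h5 : (y : ℝ) ^ 5 = y * y ^ 4 := by ring
        linarith

/-- The conditions on the basic length scale are satisfied by all large enough scales. -/
theorem eventually_isLarge (d N : ℕ) {β : ℕ} (hβ : 1 ≤ β) (m : ℝ) :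
    ∀ᶠ b : ℕ in atTop, IsLarge d N β m b := by
  have hthr : ∀ᶠ b : ℕ in atTop, thr b N β 0 ≤ (1 / 2) * (Real.exp (-2) * (1 / 2)) ^ (2 * d) := by
    have h1 : Tendsto (fun b : ℕ => ((b : ℝ) ^ β)⁻¹) atTop (𝓝 0) :=
      ((tendsto_pow_atTop (by omega)).comp tendsto_natCast_atTop_atTop).inv_tendsto_atTop
    have h2 : (0 : ℝ) < (1 / 2) * (Real.exp (-2) * (1 / 2)) ^ (2 * d) := by positivity
    filter_upwards [h1.eventually_le_const h2] with b hb
    simpa [thr, scale] using hb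
  have hball : ∀ᶠ y : ℕ in atTop, (N + 1) * (2 * y + y ^ 4) ≤ y ^ 5 := by
    filter_upwards [eventually_ge_atTop (3 * (N + 1))] with y hy
    have h1 : 2 * y + y ^ 4 ≤ 3 * y ^ 4 := by
      have := Nat.le_self_pow (show 4 ≠ 0 by norm_num) y
      omega
    calc (N + 1) * (2 * y + y ^ 4) ≤ (N + 1) * (3 * y ^ 4) := Nat.mul_le_mul_left _ h1
      _ = (3 * (N + 1)) * y ^ 4 := by ring
      _ ≤ y * y ^ 4 := Nat.mul_le_mul_right _ hy
      _ = y ^ 5 := by ring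
  have hmass : ∀ᶠ y : ℕ in atTop, (m + 1) * (y : ℝ) ^ 4 + 1 ≤ (y : ℝ) ^ 5 := by
    filter_upwards [eventually_ge_atTop 1, eventually_ge_atTop ⌈m + 2⌉₊] with y hy1 hy2
    have h1 : (1 : ℝ) ≤ y := by exact_mod_cast hy1
    have h2 : m + 2 ≤ y := Nat.ceil_le.1 hy2
    have h3 := one_le_pow₀ h1 (n := 4)
    have h4 : (m + 2) * (y : ℝ) ^ 4 ≤ y * (y : ℝ) ^ 4 :=
      mul_le_mul_of_nonneg_right h2 (by positivity)
    have h5 : (y : ℝ) ^ 5 = y * y ^ 4 := by ring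
    linarith
  filter_upwards [eventually_ge_atTop 7, hthr, eventually_forall_ge_atTop.2 hball,
    eventually_forall_ge_atTop.2 hmass, eventually_forall_ge_atTop.2 (eventually_tail d _),
    eventually_forall_ge_atTop.2 (eventually_far d _ _),
    eventually_forall_ge_atTop.2 (eventually_lateral d _ N m),
    eventually_forall_ge_atTop.2 (eventually_time d _ m)] with b h7 h1 h2 h3 h4 h5 h6 h8
  exact ⟨h7, h2, h1, h4, h5, h6, h8, h3⟩

end Numerics

/-! ### Paths in the continuum -/

section Paths

variable {d : ℕ} {ω : Config d} {A B : Set (Vertex d × ℝ)} {X Y Z : Vertex d × ℝ}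

/-- There are no deaths on the line of `x` between the times `s` and `t`. -/
def Config.NoDeath (ω : Config d) (x : Vertex d) (s t : ℝ) : Prop :=
  ∀ r ∈ Set.uIcc s t, (Sum.inl x, r) ∉ ω.1

/-- A step from `X` to `Y` inside `A`: along a line without meeting a death, or across a bond. -/
def Config.PathStep (ω : Config d) (A : Set (Vertex d × ℝ)) (X Y : Vertex d × ℝ) : Prop :=
  X ∈ A ∧ Y ∈ A ∧ ((X.1 = Y.1 ∧ ω.NoDeath X.1 X.2 Y.2) ∨
    (X.2 = Y.2 ∧ ∃ i, (Y.1 = X.1 + Pi.single i 1 ∧ (Sum.inr (X.1, i), X.2) ∈ ω.1) ∨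
      (X.1 = Y.1 + Pi.single i 1 ∧ (Sum.inr (Y.1, i), X.2) ∈ ω.1)))

/-- `X` and `Y` are joined by a path inside `A`. -/
def Config.HasPath (ω : Config d) (A : Set (Vertex d × ℝ)) (X Y : Vertex d × ℝ) : Prop :=
  Relation.ReflTransGen (ω.PathStep A) X Y

lemma Config.PathStep.symm (h : ω.PathStep A X Y) : ω.PathStep A Y X := by
  obtain ⟨h1, h2, ⟨h3, h4⟩ | ⟨h3, i, h4⟩⟩ := h
  · exact ⟨h2, h1, Or.inl ⟨h3.symm, fun r hr => by rw [← h3]; exact h4 r (by rwa [Set.uIcc_comm])⟩⟩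
  · exact ⟨h2, h1, Or.inr ⟨h3.symm, i, by rw [← h3]; exact h4.symm⟩⟩

lemma Config.PathStep.mono (h : ω.PathStep A X Y) (hAB : A ⊆ B) : ω.PathStep B X Y :=
  ⟨hAB h.1, hAB h.2.1, h.2.2⟩

lemma Config.HasPath.mono (h : ω.HasPath A X Y) (hAB : A ⊆ B) : ω.HasPath B X Y :=
  Relation.ReflTransGen.mono (fun _ _ h => h.mono hAB) _ _ h

/-- Points which are not deaths have neighbourhoods of points accessible in one step. -/
lemma Config.eventually_pathStep (ω : Config d) (X : ω.Alive) :
    ∀ᶠ Y : ω.Alive in 𝓝 X, ω.PathStep Set.univ X.1 Y.1 := by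
  have hfin := ω.2 (Sum.inl X.1.1) (X.1.2 - 1) (X.1.2 + 1)
  have hX : X.1.2 ∉ {t | (Sum.inl X.1.1, t) ∈ ω.1 ∧ X.1.2 - 1 ≤ t ∧ t ≤ X.1.2 + 1} :=
    fun h => X.2 h.1
  obtain ⟨ε, hε, hball⟩ := Metric.isOpen_iff.1 hfin.isClosed.isOpen_compl X.1.2 hX
  have h1 : ∀ᶠ Z : Vertex d × ℝ in 𝓝 X.1, Z.1 = X.1.1 ∧ |Z.2 - X.1.2| < min ε 1 := by
    have e1 : ∀ᶠ z : Vertex d in 𝓝 X.1.1, z = X.1.1 := by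
      rw [nhds_discrete]; exact Filter.eventually_pure.2 rfl
    have e2 : ∀ᶠ r : ℝ in 𝓝 X.1.2, |r - X.1.2| < min ε 1 :=
      Metric.ball_mem_nhds X.1.2 (lt_min hε one_pos)
    have := e1.prod_nhds e2
    exact this
  filter_upwards [continuous_subtype_val.continuousAt.eventually h1] with Y hY
  refine ⟨trivial, trivial, Or.inl ⟨hY.1.symm, fun r hr hmem => ?_⟩⟩
  have hr' : |r - X.1.2| ≤ |Y.1.2 - X.1.2| := Set.abs_sub_left_of_mem_uIcc hr
  have hlt := hr'.trans_lt hY.2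
  have h2 := abs_lt.1 (hlt.trans_le (min_le_right _ _))
  refine hball (show r ∈ Metric.ball X.1.2 ε from ?_) ⟨hmem, by linarith, by linarith⟩
  rw [Metric.mem_ball, Real.dist_eq]
  exact hlt.trans_le (min_le_left _ _)

/-- Points of the same connected component are joined by a path. -/
theorem Config.Connects.hasPath (h : ω.Connects X Y) : ω.HasPath Set.univ X Y := by
  obtain ⟨hX, hY, h⟩ := h
  have hbond : ∀ Z W : ω.Alive, ω.Bond Z W → ω.PathStep Set.univ Z.1 W.1 := by
    rintro Z W ⟨i, h1, h2, h3⟩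
    exact ⟨trivial, trivial, Or.inr ⟨h2.symm, i, Or.inl ⟨h1, h3⟩⟩⟩
  -- The set reachable by paths. It is well defined on the quotient because a bond is a step, and
  -- clopen because nearby points on a line are one step apart; so it contains the connected
  -- component.
  let U : Set ω.Space := {q | Quot.liftOn q (fun Z => ω.HasPath Set.univ X Z.1)
    fun Z W hZW => propext ⟨fun h => h.tail (hbond Z W hZW),
      fun h => h.tail (hbond Z W hZW).symm⟩}
  have hpre : Quot.mk ω.Bond ⁻¹' U = {Z : ω.Alive | ω.HasPath Set.univ X Z.1} := rfl
  have hU : IsClopen U := by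
    refine ⟨⟨?_⟩, ?_⟩
    · rw [← isQuotientMap_quot_mk.isOpen_preimage, Set.preimage_compl, hpre, isOpen_iff_mem_nhds]
      intro Z hZ
      filter_upwards [ω.eventually_pathStep Z] with W hW hXW
      exact hZ (hXW.tail hW.symm)
    · rw [← isQuotientMap_quot_mk.isOpen_preimage, hpre, isOpen_iff_mem_nhds]
      intro Z hZ
      filter_upwards [ω.eventually_pathStep Z] with W hW
      exact hZ.tail hW
  have hXU : (Quot.mk _ ⟨X, hX⟩ : ω.Space) ∈ U := Relation.ReflTransGen.refl
  exact hU.connectedComponent_subset hXU h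

/-- A path which leaves `Λ` reaches the boundary of `Λ` inside `Λ`. -/
lemma Config.HasPath.exists_exit {Λ : Set (Vertex d)} (h : ω.HasPath Set.univ X Y) (hX : X.1 ∈ Λ) :
    ω.HasPath {Z | Z.1 ∈ Λ} X Y ∨
      ∃ z ∈ Λ, ∃ z' ∉ Λ, dst z z' = 1 ∧ ∃ r, ω.HasPath {Z | Z.1 ∈ Λ} X (z, r) := by
  induction h with
  | refl => exact Or.inl .refl
  | @tail Y W _ hYW ih =>
    rcases ih with ih | ih
    · have hY : Y.1 ∈ Λ := by
        rcases Relation.ReflTransGen.cases_tail ih with h | ⟨_, _, h⟩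
        · rw [h]; exact hX
        · exact h.2.1
      by_cases hW : W.1 ∈ Λ
      · exact Or.inl (ih.tail ⟨hY, hW, hYW.2.2⟩)
      · refine Or.inr ⟨Y.1, hY, W.1, hW, ?_, Y.2, ih⟩
        rcases hYW.2.2 with ⟨h1, -⟩ | ⟨-, i, ⟨h1, -⟩ | ⟨h1, -⟩⟩
        · exact absurd (h1 ▸ hY) hW
        · rw [h1, dst_add_single]
        · rw [h1, dst_comm, dst_add_single]
    · exact Or.inr ih

/-- A path stays in a bounded window of time. -/
lemma Config.HasPath.exists_window (h : ω.HasPath A X Y) :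
    ∃ W : ℕ, ω.HasPath (A ∩ {Z | |Z.2| ≤ W}) X Y := by
  induction h with
  | refl => exact ⟨0, .refl⟩
  | @tail Y Z _ hYZ ih =>
    obtain ⟨W, hW⟩ := ih
    obtain ⟨W', hW'⟩ := exists_nat_ge (max |Y.2| |Z.2|)
    refine ⟨max W W', (hW.mono ?_).tail ⟨⟨hYZ.1, ?_⟩, ⟨hYZ.2.1, ?_⟩, hYZ.2.2⟩⟩
    · refine Set.inter_subset_inter_right _ fun Z hZ => ?_
      exact (show |Z.2| ≤ W from hZ).trans (by exact_mod_cast le_max_left _ _)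
    · exact ((le_max_left _ _).trans hW').trans (by exact_mod_cast le_max_right _ _)
    · exact ((le_max_right _ _).trans hW').trans (by exact_mod_cast le_max_right _ _)

end Paths

/-! ### Discretisation of time: paths -/

section Discretisation

variable {d : ℕ} {ω : Config d} {M : ℕ}

/-- The part of a line which is represented by an edge of the discretised graph. -/
def fineCell (M : ℕ) (e : FineEdge d) : Set (Lines d) :=
  {e.1} ×ˢ Set.Ico ((e.2 : ℝ) / M) ((e.2 + 1) / M)

/-- The edges of the discretised graph which are open: a vertical edge if there is no death in its
cell, a horizontal one if there is a bond. -/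
def Config.fineOpen (ω : Config d) (M : ℕ) : Set (FineEdge d) :=
  {e | (e.1.isLeft ∧ Config.count (fineCell M e) ω = 0) ∨
    (e.1.isRight ∧ Config.count (fineCell M e) ω ≠ 0)}

lemma count_fineCell_eq_zero {e : FineEdge d} :
    Config.count (fineCell M e) ω = 0 ↔
      ∀ r : ℝ, (e.2 : ℝ) / M ≤ r → r < (e.2 + 1) / M → (e.1, r) ∉ ω.1 := by
  rw [Config.count, Set.encard_eq_zero, Set.eq_empty_iff_forall_notMem]
  constructor
  · intro h r h1 h2 h3
    exact h (e.1, r) ⟨h3, rfl, h1, h2⟩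
  · rintro h ⟨w, r⟩ ⟨h1, h2, h3, h4⟩
    obtain rfl : w = e.1 := h2
    exact h r h3 h4 h1

/-- The edges of the discretised graph at the vertices of `Λ` in the time window `[-W, W]`. -/
def fineWindow (Λ : Finset (Vertex d)) (M W : ℕ) : Finset (FineEdge d) :=
  Λ.disjSum (Λ ×ˢ Finset.univ) ×ˢ Finset.Icc (-((M * W : ℕ) : ℤ)) (M * W : ℕ)

/-- In no cell of the window there are both a death and a bond. -/
def Config.IsSparse (ω : Config d) (Λ : Finset (Vertex d)) (M W : ℕ) : Prop :=
  ∀ n ∈ Finset.Icc (-((M * W : ℕ) : ℤ)) (M * W : ℕ), ∀ y ∈ Λ, ∀ u ∈ Λ ×ˢ (Finset.univ : Finset (Fin d)),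
    Config.count (fineCell M (Sum.inl y, n)) ω = 0 ∨ Config.count (fineCell M (Sum.inr u, n)) ω = 0

lemma Config.conn_of_noDeath {Λ : Finset (Vertex d)} {W : ℕ} {y : Vertex d} (hy : y ∈ Λ)
    (hM : 0 < M) {n n' : ℤ} (hn : n ∈ Finset.Icc (-((M * W : ℕ) : ℤ)) (M * W : ℕ))
    (hn' : n' ∈ Finset.Icc (-((M * W : ℕ) : ℤ)) (M * W : ℕ)) (hle : n ≤ n')
    (h : ∀ r : ℝ, (n : ℝ) / M ≤ r → r < (n' : ℝ) / M → (Sum.inl y, r) ∉ ω.1) :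
    Conn (ω.fineOpen M ∩ fineWindow Λ M W) {X | X.1 ∈ Λ} (y, n) (y, n') := by
  have hM' : (0 : ℝ) < M := by exact_mod_cast hM
  rw [Finset.mem_Icc] at hn hn'
  obtain ⟨k, rfl⟩ := Int.le.dest hle
  clear hle
  induction k with
  | zero => rw [Nat.cast_zero, add_zero]; exact .refl
  | succ k ih =>
    have hcast : ((n + ((k + 1 : ℕ) : ℤ) : ℤ) : ℝ) = ((n + (k : ℤ) : ℤ) : ℝ) + 1 := by
      push_cast; ring
    refine (ih ⟨by omega, by omega⟩ fun r h1 h2 => h r h1 (h2.trans_le ?_)).tail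
      ⟨hy, hy, (Sum.inl y, n + k), ⟨Or.inl ⟨rfl, ?_⟩, ?_⟩, Or.inl ?_⟩
    · rw [hcast]
      exact div_le_div_of_nonneg_right (by linarith) hM'.le
    · rw [count_fineCell_eq_zero]
      intro r h1 h2
      refine h r (le_trans ?_ h1) (by rw [hcast]; exact h2)
      refine div_le_div_of_nonneg_right ?_ hM'.le
      push_cast
      linarith [(Nat.cast_nonneg k : (0 : ℝ) ≤ k)]
    · simp only [fineWindow, Finset.coe_product, Set.mem_prod, Finset.mem_coe,
        Finset.inl_mem_disjSum, Finset.mem_Icc]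
      exact ⟨hy, by omega, by omega⟩
    · simp only [ends, Nat.cast_add, Nat.cast_one, add_assoc]

lemma floor_mem_Icc {W : ℕ} {r : ℝ} (hr : |r| ≤ W) :
    ⌊r * M⌋ ∈ Finset.Icc (-((M * W : ℕ) : ℤ)) (M * W : ℕ) := by
  have hM : (0 : ℝ) ≤ M := Nat.cast_nonneg M
  obtain ⟨h1, h2⟩ := abs_le.1 hr
  rw [Finset.mem_Icc]
  constructor
  · rw [Int.le_floor]
    push_cast
    nlinarith
  · have : r * M ≤ ((M * W : ℕ) : ℤ) := by push_cast; nlinarith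
    exact_mod_cast (Int.floor_le _).trans this

/-- A path in the continuum gives rise to a connection in the discretised graph. -/
lemma Config.HasPath.exists_conn {Λ : Finset (Vertex d)} {W : ℕ} {x z : Vertex d} {t r : ℝ}
    (hM : 0 < M) (hs : ω.IsSparse Λ M W) (ht : |t| ≤ W)
    (hx : Config.count (fineCell M (Sum.inl x, ⌊t * M⌋)) ω = 0)
    (h : ω.HasPath ({Z | Z.1 ∈ Λ} ∩ {Z | |Z.2| ≤ W}) (x, t) (z, r)) :
    ∃ n ∈ Finset.Icc (-((M * W : ℕ) : ℤ)) (M * W : ℕ),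
      Conn (ω.fineOpen M ∩ fineWindow Λ M W) {X | X.1 ∈ Λ} (x, ⌊t * M⌋) (z, n) ∧
      ω.NoDeath z ((n : ℝ) / M) r := by
  have hM' : (0 : ℝ) < M := by exact_mod_cast hM
  have hfl : ∀ s : ℝ, (⌊s * M⌋ : ℝ) / M ≤ s := fun s => by
    rw [div_le_iff₀ hM']; exact Int.floor_le _
  have hfl' : ∀ s : ℝ, s < (⌊s * M⌋ + 1 : ℝ) / M := fun s => by
    rw [lt_div_iff₀ hM']; exact Int.lt_floor_add_one _
  have hnd : ∀ (y : Vertex d) (s : ℝ), Config.count (fineCell M (Sum.inl y, ⌊s * M⌋)) ω = 0 →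
      ω.NoDeath y ((⌊s * M⌋ : ℝ) / M) s := by
    intro y s hys q hq
    rw [Set.uIcc_of_le (hfl s)] at hq
    exact count_fineCell_eq_zero.1 hys q hq.1 (hq.2.trans_lt (hfl' s))
  generalize hZ : (z, r) = Z at h
  obtain rfl : z = Z.1 := by rw [← hZ]
  obtain rfl : r = Z.2 := by rw [← hZ]
  clear hZ
  -- The statement provides a mesh time joined to `r` without a death, not the cell of `r` itself:
  -- that cell may contain a death on the far side of `r`, and its edge is then closed although the
  -- path arrives at `r`.
  induction h with
  | refl => exact ⟨⌊t * M⌋, floor_mem_Icc ht, .refl, hnd x t hx⟩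
  | @tail Y Z _ hYZ ih =>
    obtain ⟨n, hn, hconn, hno⟩ := ih
    obtain ⟨⟨hYΛ, hYW⟩, ⟨hZΛ, hZW⟩, ⟨h1, h2⟩ | ⟨h1, i, h2⟩⟩ := hYZ
    · refine ⟨n, hn, h1 ▸ hconn, fun q hq => ?_⟩
      rw [← h1]
      rcases Set.uIcc_subset_uIcc_union_uIcc (b := Y.2) hq with hq | hq
      · exact hno q hq
      · exact h2 q hq
    · set n' := ⌊Y.2 * M⌋ with hn'
      have hn'I : n' ∈ Finset.Icc (-((M * W : ℕ) : ℤ)) (M * W : ℕ) := floor_mem_Icc hYW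
      have hmain : ∀ u ∈ Λ ×ˢ (Finset.univ : Finset (Fin d)), (Sum.inr u, Y.2) ∈ ω.1 →
          Joins (Sum.inr u, n') (Y.1, n') (Z.1, n') →
          ∃ n ∈ Finset.Icc (-((M * W : ℕ) : ℤ)) (M * W : ℕ),
            Conn (ω.fineOpen M ∩ fineWindow Λ M W) {X | X.1 ∈ Λ} (x, ⌊t * M⌋) (Z.1, n) ∧
            ω.NoDeath Z.1 ((n : ℝ) / M) Z.2 := by
        intro u hu hmem hj
        have hu0 : Config.count (fineCell M (Sum.inr u, n')) ω ≠ 0 := fun hcon =>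
          count_fineCell_eq_zero.1 hcon Y.2 (hfl _) (hfl' _) hmem
        -- Sparsity is needed here: a cell with a bond has no death on either of the two lines, so
        -- rounding the time of the bond down to the mesh loses nothing.
        have hY0 := (hs n' hn'I Y.1 hYΛ u hu).resolve_right hu0
        have hZ0 := (hs n' hn'I Z.1 hZΛ u hu).resolve_right hu0
        refine ⟨n', hn'I, (hconn.trans ?_).tail ⟨hYΛ, hZΛ, (Sum.inr u, n'), ⟨Or.inr ⟨rfl, hu0⟩, ?_⟩, hj⟩, ?_⟩
        · rcases le_total n n' with hle | hle
          · refine Config.conn_of_noDeath hYΛ hM hn hn'I hle fun q h3 h4 => hno q ?_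
            exact Set.mem_uIcc.2 (Or.inl ⟨h3, h4.le.trans (hfl _)⟩)
          · refine (Config.conn_of_noDeath hYΛ hM hn'I hn hle fun q h3 h4 => ?_).symm
            by_cases hq : q < Y.2
            · exact count_fineCell_eq_zero.1 hY0 q h3 (hq.trans (hfl' _))
            · exact hno q (Set.mem_uIcc.2 (Or.inr ⟨not_lt.1 hq, h4.le⟩))
        · simp only [fineWindow, Finset.coe_product, Set.mem_prod, Finset.mem_coe,
            Finset.inr_mem_disjSum]
          exact ⟨hu, hn'I⟩
        · rw [← h1]
          exact hnd Z.1 Y.2 hZ0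
      rcases h2 with ⟨h2, h3⟩ | ⟨h2, h3⟩
      · refine hmain (Y.1, i) (Finset.mem_product.2 ⟨hYΛ, Finset.mem_univ _⟩) h3 (Or.inl ?_)
        simp only [ends, h2]
      · refine hmain (Z.1, i) (Finset.mem_product.2 ⟨hZΛ, Finset.mem_univ _⟩) h3 (Or.inr ?_)
        simp only [ends, h2]

lemma floor_mul_ediv (hM : 0 < M) (t : ℝ) : ⌊t * M⌋ / (M : ℤ) = ⌊t⌋ := by
  have hM' : (0 : ℤ) < M := by exact_mod_cast hM
  have hM'' : (0 : ℝ) < M := by exact_mod_cast hM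
  refine le_antisymm (Int.lt_add_one_iff.1 ((Int.ediv_lt_iff_lt_mul hM').2 ?_))
    ((Int.le_ediv_iff_mul_le hM').2 (Int.le_floor.2 ?_))
  · rw [Int.floor_lt]
    push_cast
    exact mul_lt_mul_of_pos_right (Int.lt_floor_add_one t) hM''
  · push_cast
    exact mul_le_mul_of_nonneg_right (Int.floor_le t) hM''.le

/-- A path in the continuum gives rise to a connection between cells. -/
lemma Config.HasPath.cellConn {Λ : Finset (Vertex d)} {W : ℕ} {x z : Vertex d} {t r : ℝ}
    (hM : 0 < M) (hs : ω.IsSparse Λ M W) (ht : |t| ≤ W) (hr : |r| ≤ W) (hz : z ∈ Λ)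
    (hx : Config.count (fineCell M (Sum.inl x, ⌊t * M⌋)) ω = 0)
    (h : ω.HasPath ({Z | Z.1 ∈ Λ} ∩ {Z | |Z.2| ≤ W}) (x, t) (z, r)) :
    CellConn M {X | X.1 ∈ Λ} (x, ⌊t⌋) (z, ⌊r⌋) (ω.fineOpen M ∩ fineWindow Λ M W) ∨
    CellConn M {X | X.1 ∈ Λ} (x, ⌊t⌋) (z, ⌊r⌋ + 1) (ω.fineOpen M ∩ fineWindow Λ M W) := by
  have hM' : (0 : ℝ) < M := by exact_mod_cast hM
  have hMZ : (0 : ℤ) < M := by exact_mod_cast hM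
  obtain ⟨n, hn, hconn, hno⟩ := h.exists_conn hM hs ht hx
  have hstart : cell M (x, ⌊t * M⌋) = (x, ⌊t⌋) := by rw [cell, floor_mul_ediv hM]
  have hrI := floor_mem_Icc (M := M) hr
  have hfl : (⌊r * M⌋ : ℝ) / M ≤ r := by rw [div_le_iff₀ hM']; exact Int.floor_le _
  have hfl' : r < (⌊r * M⌋ + 1 : ℝ) / M := by rw [lt_div_iff₀ hM']; exact Int.lt_floor_add_one _
  have hend : cell M (z, ⌊r * M⌋) = (z, ⌊r⌋) := by rw [cell, floor_mul_ediv hM]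
  -- If `r` is reached from above, the connection can be followed only down to mesh time `⌊r * M⌋ +
  -- 1`, which may belong to the next unit block. This causes the second alternative.
  rcases le_or_gt n ⌊r * M⌋ with hle | hlt
  · refine Or.inl ⟨_, _, hstart, hend, hconn.trans
      (Config.conn_of_noDeath hz hM hn hrI hle fun q h1 h2 => hno q ?_)⟩
    exact Set.mem_uIcc.2 (Or.inl ⟨h1, h2.le.trans hfl⟩)
  · have hI' : ⌊r * M⌋ + 1 ∈ Finset.Icc (-((M * W : ℕ) : ℤ)) (M * W : ℕ) := by
      rw [Finset.mem_Icc] at hn hrI ⊢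
      omega
    have hconn' := hconn.trans (Config.conn_of_noDeath (ω := ω) hz hM hI' hn (by omega)
      fun q h1 h2 => hno q (Set.mem_uIcc.2 (Or.inr ⟨?_, h2.le⟩))).symm
    · have h1 : ⌊r⌋ ≤ (⌊r * M⌋ + 1) / (M : ℤ) := by
        rw [← floor_mul_ediv hM r]; exact Int.ediv_le_ediv hMZ (by omega)
      have h2 : (⌊r * M⌋ + 1) / (M : ℤ) ≤ ⌊r⌋ + 1 := by
        rw [← floor_mul_ediv hM r, ← Int.add_mul_ediv_left _ _ hMZ.ne']
        exact Int.ediv_le_ediv hMZ (by omega)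
      rcases (show (⌊r * M⌋ + 1) / (M : ℤ) = ⌊r⌋ ∨ (⌊r * M⌋ + 1) / (M : ℤ) = ⌊r⌋ + 1 by omega) with e | e
      · exact Or.inl ⟨_, _, hstart, by rw [cell, e], hconn'⟩
      · exact Or.inr ⟨_, _, hstart, by rw [cell, e], hconn'⟩
    · push_cast at h1
      exact hfl'.le.trans h1

end Discretisation

/-! ### Discretisation of time: probabilities -/

section Transfer

variable {d : ℕ} {M : ℕ} {rate : Graph d → ℝ} {P : Measure (Config d)}

lemma measurable_count {B : Set (Lines d)} (hB : MeasurableSet B) :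
    Measurable (Config.count B : Config d → ℕ∞) := by
  have h : MeasurableSpace.comap (Config.count B) inferInstance ≤ Config.instMeasurableSpace d :=
    le_iSup (fun B : {B : Set (Lines d) // MeasurableSet B} =>
      MeasurableSpace.comap (Config.count B.1) inferInstance) ⟨B, hB⟩
  exact measurable_iff_comap_le.2 h

lemma measurableSet_singleton_graph (w : Graph d) : MeasurableSet ({w} : Set (Graph d)) := by
  rcases w with x | u
  · rw [← Set.image_singleton]; exact (measurableSet_singleton x).inl_image
  · rw [← Set.image_singleton]; exact (measurableSet_singleton u).inr_image

lemma measurableSet_fineCell (e : FineEdge d) : MeasurableSet (fineCell M e) :=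
  (measurableSet_singleton_graph e.1).prod measurableSet_Ico

lemma disjoint_fineCell (hM : 0 < M) {e e' : FineEdge d} (h : e ≠ e') :
    Disjoint (fineCell M e) (fineCell M e') := by
  have hM' : (0 : ℝ) < M := by exact_mod_cast hM
  rw [Set.disjoint_left]
  rintro ⟨w, r⟩ ⟨h1, h2, h3⟩ ⟨h4, h5, h6⟩
  refine h (Prod.ext ((show w = e.1 from h1).symm.trans h4) ?_)
  rw [div_le_iff₀ hM'] at h2 h5
  rw [lt_div_iff₀ hM'] at h3 h6
  have e1 : (e.2 : ℝ) < e'.2 + 1 := h2.trans_lt h6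
  have e2 : (e'.2 : ℝ) < e.2 + 1 := h5.trans_lt h3
  have e1' : e.2 < e'.2 + 1 := by exact_mod_cast e1
  have e2' : e'.2 < e.2 + 1 := by exact_mod_cast e2
  omega

lemma intensity_fineCell (hM : 0 < M) (e : FineEdge d) :
    intensity rate (fineCell M e) = ENNReal.ofReal (rate e.1) * ENNReal.ofReal (1 / M) := by
  have hM' : (0 : ℝ) < M := by exact_mod_cast hM
  rw [intensity, Measure.sum_apply _ (measurableSet_fineCell e), tsum_eq_single e.1]
  · rw [Measure.smul_apply, Measure.map_apply measurable_prodMk_left (measurableSet_fineCell e),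
      smul_eq_mul]
    congr 1
    have : Prod.mk e.1 ⁻¹' fineCell M e = Set.Ico ((e.2 : ℝ) / M) ((e.2 + 1) / M) := by
      ext r; simp [fineCell]
    rw [this, Real.volume_Ico]
    congr 1
    field_simp
    ring
  · intro w hw
    rw [Measure.smul_apply, Measure.map_apply measurable_prodMk_left (measurableSet_fineCell e)]
    have : Prod.mk w ⁻¹' fineCell M e = ∅ := by
      ext r; simp [fineCell, hw]
    rw [this, measure_empty, smul_zero]

/-- Probability that an edge of the discretised graph is open. -/
def fineProb (rate : Graph d → ℝ) (M : ℕ) (e : FineEdge d) : ℝ :=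
  if e.1.isLeft then Real.exp (-(rate e.1 / M)) else 1 - Real.exp (-(rate e.1 / M))

lemma fineProb_mem_unit (hrate : ∀ w, 0 ≤ rate w) (e : FineEdge d) :
    0 ≤ fineProb rate M e ∧ fineProb rate M e ≤ 1 := by
  have h1 : Real.exp (-(rate e.1 / M)) ≤ 1 :=
    Real.exp_le_one_iff.2 (neg_nonpos.2 (div_nonneg (hrate _) (Nat.cast_nonneg _)))
  have h2 := Real.exp_pos (-(rate e.1 / M))
  unfold fineProb
  split_ifs <;> constructor <;> linarith

lemma IsPoissonLaw.real_count_eq_zero (h : IsPoissonLaw rate P) (hrate : ∀ w, 0 ≤ rate w)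
    (hM : 0 < M) (e : FineEdge d) :
    P.real {ω | Config.count (fineCell M e) ω = 0} = Real.exp (-(rate e.1 / M)) := by
  have h1 := intensity_fineCell (rate := rate) hM e
  have h2 := h.poisson (fineCell M e) (measurableSet_fineCell e)
    (by rw [h1]; exact ENNReal.mul_lt_top ENNReal.ofReal_lt_top ENNReal.ofReal_lt_top) 0
  rw [h1, ENNReal.toReal_mul, ENNReal.toReal_ofReal (hrate _),
    ENNReal.toReal_ofReal (by positivity)] at h2
  simp only [Nat.cast_zero, pow_zero, mul_one, Nat.factorial_zero, Nat.cast_one, div_one] at h2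
  rw [measureReal_def, h2, ENNReal.toReal_ofReal (Real.exp_pos _).le, mul_one_div]

lemma IsPoissonLaw.real_count_ne_zero (h : IsPoissonLaw rate P) (hrate : ∀ w, 0 ≤ rate w)
    (hM : 0 < M) (e : FineEdge d) :
    P.real {ω | Config.count (fineCell M e) ω ≠ 0} = 1 - Real.exp (-(rate e.1 / M)) := by
  have := h.isProbabilityMeasure
  rw [← h.real_count_eq_zero hrate hM e, ← probReal_compl_eq_one_sub]
  · rfl
  · exact measurable_count (measurableSet_fineCell e) (measurableSet_singleton 0)

lemma IsPoissonLaw.real_count_ne_zero_le (h : IsPoissonLaw rate P) (hrate : ∀ w, 0 ≤ rate w)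
    (hM : 0 < M) (e : FineEdge d) :
    P.real {ω | Config.count (fineCell M e) ω ≠ 0} ≤ rate e.1 / M := by
  rw [h.real_count_ne_zero hrate hM]
  linarith [Real.add_one_le_exp (-(rate e.1 / M))]

/-- The numbers of points in different cells are independent. -/
lemma IsPoissonLaw.real_forall_count_mem (h : IsPoissonLaw rate P) (hM : 0 < M)
    (F : Finset (FineEdge d)) (s : FineEdge d → Set ℕ∞) :
    P.real {ω | ∀ e ∈ F, Config.count (fineCell M e) ω ∈ s e} =
      ∏ e ∈ F, P.real {ω | Config.count (fineCell M e) ω ∈ s e} := by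
  have hind : iIndepFun (fun e : F => Config.count (fineCell M e.1)) P := by
    have h1 := h.indep F.card (fun j => fineCell M (F.equivFin.symm j).1)
      (fun j => measurableSet_fineCell _) (fun j k hjk => disjoint_fineCell hM fun hcon =>
        hjk (F.equivFin.symm.injective (Subtype.ext hcon)))
    have h2 := h1.precomp F.equivFin.injective
    simpa using h2
  have h3 := hind.measure_inter_preimage_eq_mul Finset.univ (sets := fun e => s e.1)
    (fun e _ => MeasurableSet.of_discrete)
  have h4 : {ω | ∀ e ∈ F, Config.count (fineCell M e) ω ∈ s e} =
      ⋂ e ∈ (Finset.univ : Finset F), Config.count (fineCell M e.1) ⁻¹' s e.1 := by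
    ext ω; simp
  rw [measureReal_def, h4, h3, ENNReal.toReal_prod,
    ← Finset.prod_coe_sort F fun e => P.real {ω | Config.count (fineCell M e) ω ∈ s e}]
  rfl

lemma IsPoissonLaw.real_mem_fineOpen (h : IsPoissonLaw rate P) (hrate : ∀ w, 0 ≤ rate w)
    (hM : 0 < M) (e : FineEdge d) : P.real {ω | e ∈ ω.fineOpen M} = fineProb rate M e := by
  rcases e with ⟨x | u, n⟩
  · simpa [Config.fineOpen, fineProb] using h.real_count_eq_zero hrate hM (Sum.inl x, n)
  · simpa [Config.fineOpen, fineProb] using h.real_count_ne_zero hrate hM (Sum.inr u, n)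

open Classical in
/-- The law of the open edges of the discretised graph. -/
lemma IsPoissonLaw.real_fineOpen_le (h : IsPoissonLaw rate P) (hrate : ∀ w, 0 ≤ rate w)
    (hM : 0 < M) (F : Finset (FineEdge d)) (A : Set (FineEdge d) → Prop) :
    P.real {ω | A (ω.fineOpen M ∩ F)} ≤ prob F (fineProb rate M) A := by
  have := h.isProbabilityMeasure
  let op : FineEdge d → ℕ∞ → Prop := fun e k => (e.1.isLeft ∧ k = 0) ∨ (e.1.isRight ∧ k ≠ 0)
  have hmem : ∀ (ω : Config d) e, e ∈ ω.fineOpen M ↔ op e (Config.count (fineCell M e) ω) :=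
    fun _ _ => Iff.rfl
  have hS : ∀ S ∈ F.powerset, P.real {ω | ω.fineOpen M ∩ F = S} =
      (∏ e ∈ S, fineProb rate M e) * ∏ e ∈ F \ S, (1 - fineProb rate M e) := by
    intro S hS
    have hSF := Finset.mem_powerset.1 hS
    have h1 := h.real_forall_count_mem hM F fun e => {k | op e k ↔ e ∈ S}
    have h2 : {ω : Config d | ω.fineOpen M ∩ F = S} =
        {ω | ∀ e ∈ F, Config.count (fineCell M e) ω ∈ {k | op e k ↔ e ∈ S}} := by
      ext ω
      simp only [Set.ext_iff, Set.mem_inter_iff, Finset.mem_coe, Set.mem_ofPred_eq, hmem]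
      refine forall_congr' fun e => ?_
      have := @hSF e
      tauto
    rw [h2, h1, ← Finset.prod_sdiff hSF, mul_comm]
    congr 1
    · refine Finset.prod_congr rfl fun e he => ?_
      rw [← h.real_mem_fineOpen hrate hM]
      congr 1
      ext ω
      simp [hmem, he]
    · refine Finset.prod_congr rfl fun e he => ?_
      have hmeas : MeasurableSet {ω : Config d | e ∈ ω.fineOpen M} :=
        measurable_count (measurableSet_fineCell e) (MeasurableSet.of_discrete (s := {k | op e k}))
      rw [← h.real_mem_fineOpen hrate hM, ← probReal_compl_eq_one_sub hmeas]
      congr 1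
      ext ω
      simp [hmem, (Finset.mem_sdiff.1 he).2]
  have hsub : {ω : Config d | A (ω.fineOpen M ∩ F)} ⊆
      ⋃ S ∈ (F.powerset.filter fun S : Finset (FineEdge d) => A (S : Set (FineEdge d))),
        {ω | ω.fineOpen M ∩ F = (S : Set (FineEdge d))} := by
    intro ω hω
    have e1 : ((F.filter fun e => e ∈ ω.fineOpen M : Finset (FineEdge d)) : Set (FineEdge d)) =
        ω.fineOpen M ∩ F := by
      ext e; simp [and_comm]
    simp only [Set.mem_iUnion, Finset.mem_filter, Finset.mem_powerset]
    exact ⟨F.filter fun e => e ∈ ω.fineOpen M, ⟨Finset.filter_subset _ _, by rw [e1]; exact hω⟩,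
      e1.symm⟩
  refine (measureReal_mono hsub (measure_ne_top _ _)).trans ((measureReal_biUnion_finset_le _ _).trans (le_of_eq ?_))
  rw [Finset.sum_filter, prob, expect]
  refine Finset.sum_congr rfl fun S hS' => ?_
  rw [hS S hS']
  split_ifs
  · rw [mul_one]; congr!
  · rw [mul_zero]

/-- A death and a bond fall into the same cell with probability of order `1 / M ^ 2`, and a window
contains of order `M` cells per pair of lines. -/
lemma IsPoissonLaw.real_not_isSparse_le (h : IsPoissonLaw rate P) (hrate : ∀ w, 0 ≤ rate w)
    (Λ : Finset (Vertex d)) (W : ℕ) : ∃ K : ℝ, ∀ M : ℕ, 0 < M →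
      P.real {ω | ¬ ω.IsSparse Λ M W} ≤ K / M := by
  have := h.isProbabilityMeasure
  refine ⟨(2 * W + 1) * ∑ y ∈ Λ, ∑ u ∈ Λ ×ˢ (Finset.univ : Finset (Fin d)),
    rate (Sum.inl y) * rate (Sum.inr u), fun M hM => ?_⟩
  have hM' : (1 : ℝ) ≤ M := by exact_mod_cast hM
  have hpair : ∀ (n : ℤ) (y : Vertex d) (u : Edge d),
      P.real {ω | Config.count (fineCell M (Sum.inl y, n)) ω ≠ 0 ∧
        Config.count (fineCell M (Sum.inr u, n)) ω ≠ 0} ≤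
      rate (Sum.inl y) / M * (rate (Sum.inr u) / M) := by
    intro n y u
    have h1 := h.real_forall_count_mem hM {(Sum.inl y, n), (Sum.inr u, n)} fun _ => {0}ᶜ
    rw [Finset.prod_pair (by simp)] at h1
    have h2 : {ω : Config d | ∀ e ∈ ({(Sum.inl y, n), (Sum.inr u, n)} : Finset (FineEdge d)),
        Config.count (fineCell M e) ω ∈ ({0}ᶜ : Set ℕ∞)} =
        {ω | Config.count (fineCell M (Sum.inl y, n)) ω ≠ 0 ∧
        Config.count (fineCell M (Sum.inr u, n)) ω ≠ 0} := by
      ext ω; simp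
    rw [← h2, h1]
    exact mul_le_mul (h.real_count_ne_zero_le hrate hM (Sum.inl y, n))
      (h.real_count_ne_zero_le hrate hM (Sum.inr u, n)) measureReal_nonneg
      (div_nonneg (hrate _) (by linarith))
  have hsub : {ω : Config d | ¬ ω.IsSparse Λ M W} ⊆
      ⋃ n ∈ Finset.Icc (-((M * W : ℕ) : ℤ)) (M * W : ℕ), ⋃ y ∈ Λ,
        ⋃ u ∈ Λ ×ˢ (Finset.univ : Finset (Fin d)),
        {ω | Config.count (fineCell M (Sum.inl y, n)) ω ≠ 0 ∧
          Config.count (fineCell M (Sum.inr u, n)) ω ≠ 0} := by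
    intro ω hω
    simp only [Set.mem_ofPred_eq, Config.IsSparse, not_forall, not_or] at hω
    obtain ⟨n, hn, y, hy, u, hu, h1⟩ := hω
    simp only [Set.mem_iUnion]
    exact ⟨n, hn, y, hy, u, hu, h1⟩
  calc P.real {ω | ¬ ω.IsSparse Λ M W}
      ≤ ∑ n ∈ Finset.Icc (-((M * W : ℕ) : ℤ)) (M * W : ℕ), ∑ y ∈ Λ,
          ∑ u ∈ Λ ×ˢ (Finset.univ : Finset (Fin d)), rate (Sum.inl y) / M * (rate (Sum.inr u) / M) := by
        refine (measureReal_mono hsub (measure_ne_top _ _)).trans ((measureReal_biUnion_finset_le _ _).trans ?_)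
        refine Finset.sum_le_sum fun n _ => (measureReal_biUnion_finset_le _ _).trans ?_
        refine Finset.sum_le_sum fun y _ => (measureReal_biUnion_finset_le _ _).trans ?_
        exact Finset.sum_le_sum fun u _ => hpair n y u
    _ = (2 * (M * W) + 1) * ((∑ y ∈ Λ, ∑ u ∈ Λ ×ˢ (Finset.univ : Finset (Fin d)),
          rate (Sum.inl y) * rate (Sum.inr u)) / (M * M)) := by
        rw [Finset.sum_const, Int.card_Icc, nsmul_eq_mul]
        have e1 : (((M * W : ℕ) : ℤ) + 1 - -((M * W : ℕ) : ℤ)).toNat = 2 * (M * W) + 1 := by omega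
        rw [e1]
        push_cast
        congr 1
        rw [Finset.sum_div]
        refine Finset.sum_congr rfl fun y _ => ?_
        rw [Finset.sum_div]
        exact Finset.sum_congr rfl fun u _ => by rw [div_mul_div_comm]
    _ ≤ _ := by
        set s := ∑ y ∈ Λ, ∑ u ∈ Λ ×ˢ (Finset.univ : Finset (Fin d)),
          rate (Sum.inl y) * rate (Sum.inr u) with hs
        have hs0 : 0 ≤ s := Finset.sum_nonneg fun y _ => Finset.sum_nonneg fun u _ =>
          mul_nonneg (hrate _) (hrate _)
        have hW : (0 : ℝ) ≤ W := Nat.cast_nonneg W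
        calc (2 * (M * W) + 1) * (s / (M * M)) ≤ (M * (2 * W + 1)) * (s / (M * M)) :=
              mul_le_mul_of_nonneg_right (by nlinarith) (by positivity)
          _ = (2 * W + 1) * s / M := by field_simp

/-- Bounds for the discretised graph carry over to the continuum. -/
theorem IsPoissonLaw.measure_hasPath_le (h : IsPoissonLaw rate P) (hrate : ∀ w, 0 ≤ rate w)
    {Λ : Finset (Vertex d)} {x z : Vertex d} (hz : z ∈ Λ) {t : ℝ} {j : ℤ} {ε : ℝ}
    (hε : ∀ᶠ M : ℕ in atTop, ∀ F : Finset (FineEdge d),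
      prob F (fineProb rate M) (CellConn M {X | X.1 ∈ Λ} (x, ⌊t⌋) (z, j)) ≤ ε ∧
      prob F (fineProb rate M) (CellConn M {X | X.1 ∈ Λ} (x, ⌊t⌋) (z, j + 1)) ≤ ε) :
    P {ω | ∃ r, ⌊r⌋ = j ∧ ω.HasPath {Z | Z.1 ∈ Λ} (x, t) (z, r)} ≤ ENNReal.ofReal (2 * ε) := by
  have := h.isProbabilityMeasure
  let E : ℕ → Set (Config d) := fun W =>
    {ω | ∃ r, ⌊r⌋ = j ∧ ω.HasPath ({Z | Z.1 ∈ Λ} ∩ {Z | |Z.2| ≤ W}) (x, t) (z, r)}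
  have hmono : Monotone E := by
    rintro W W' hW ω ⟨r, h1, h2⟩
    refine ⟨r, h1, h2.mono (Set.inter_subset_inter_right _ fun Z hZ => ?_)⟩
    exact (show |Z.2| ≤ W from hZ).trans (by exact_mod_cast hW)
  have hE : {ω : Config d | ∃ r, ⌊r⌋ = j ∧ ω.HasPath {Z | Z.1 ∈ Λ} (x, t) (z, r)} ⊆ ⋃ W, E W := by
    rintro ω ⟨r, h1, h2⟩
    obtain ⟨W, hW⟩ := h2.exists_window
    exact Set.mem_iUnion.2 ⟨W, r, h1, hW⟩
  -- The mesh tends to zero for a fixed window, and only then does the window grow. The two errors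
  -- that vanish in the first limit are a failure of sparsity and a death in the cell of the
  -- starting point.
  have hbound : ∀ W : ℕ, |t| ≤ W → |(j : ℝ)| + 1 ≤ W → P.real (E W) ≤ 2 * ε := by
    intro W hW1 hW2
    obtain ⟨K, hK⟩ := h.real_not_isSparse_le hrate Λ W
    have hlim : Tendsto (fun M : ℕ => 2 * ε + (K / M + rate (Sum.inl x) / M)) atTop (𝓝 (2 * ε)) := by
      have := (tendsto_const_div_atTop_nhds_zero_nat K).add
        (tendsto_const_div_atTop_nhds_zero_nat (rate (Sum.inl x)))
      simpa using this.const_add (2 * ε)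
    refine ge_of_tendsto hlim ?_
    filter_upwards [hε, eventually_gt_atTop 0] with M hM hM0
    have hsub : E W ⊆ ({ω | ¬ ω.IsSparse Λ M W} ∪
        {ω | Config.count (fineCell M (Sum.inl x, ⌊t * M⌋)) ω ≠ 0}) ∪
        ({ω | CellConn M {X | X.1 ∈ Λ} (x, ⌊t⌋) (z, j) (ω.fineOpen M ∩ fineWindow Λ M W)} ∪
        {ω | CellConn M {X | X.1 ∈ Λ} (x, ⌊t⌋) (z, j + 1) (ω.fineOpen M ∩ fineWindow Λ M W)}) := by
      rintro ω ⟨r, rfl, h2⟩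
      by_cases hs : ω.IsSparse Λ M W
      · by_cases hx : Config.count (fineCell M (Sum.inl x, ⌊t * M⌋)) ω = 0
        · refine Or.inr (h2.cellConn hM0 hs hW1 ?_ hz hx)
          have e1 := Int.floor_le r
          have e2 := (Int.lt_floor_add_one r).le
          have e3 := abs_le.1 (le_refl |(⌊r⌋ : ℝ)|)
          rw [abs_le]
          constructor <;> linarith
        · exact Or.inl (Or.inr hx)
      · exact Or.inl (Or.inl hs)
    have b1 := hK M hM0
    have b2 := h.real_count_ne_zero_le hrate hM0 (Sum.inl x, ⌊t * M⌋)
    have b3 := (h.real_fineOpen_le hrate hM0 (fineWindow Λ M W) _).trans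
      (hM (fineWindow Λ M W)).1
    have b4 := (h.real_fineOpen_le hrate hM0 (fineWindow Λ M W) _).trans
      (hM (fineWindow Λ M W)).2
    refine (measureReal_mono hsub (measure_ne_top _ _)).trans ((measureReal_union_le _ _).trans ?_)
    have b5 := measureReal_union_le (μ := P) {ω : Config d | ¬ ω.IsSparse Λ M W}
      {ω | Config.count (fineCell M (Sum.inl x, ⌊t * M⌋)) ω ≠ 0}
    have b6 := measureReal_union_le (μ := P)
      {ω : Config d | CellConn M {X | X.1 ∈ Λ} (x, ⌊t⌋) (z, j) (ω.fineOpen M ∩ fineWindow Λ M W)}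
      {ω | CellConn M {X | X.1 ∈ Λ} (x, ⌊t⌋) (z, j + 1) (ω.fineOpen M ∩ fineWindow Λ M W)}
    linarith
  refine (measure_mono hE).trans ?_
  rw [hmono.measure_iUnion]
  refine iSup_le fun W => ?_
  obtain ⟨W', hW'⟩ := exists_nat_ge (max |t| (|(j : ℝ)| + 1))
  have h1 : (W' : ℝ) ≤ (max W W' : ℕ) := by exact_mod_cast le_max_right W W'
  refine (measure_mono (hmono (le_max_left W W'))).trans ?_
  rw [← ENNReal.ofReal_toReal (measure_ne_top P (E (max W W')))]
  exact ENNReal.ofReal_le_ofReal (hbound _ (((le_max_left _ _).trans hW').trans h1)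
    (((le_max_right _ _).trans hW').trans h1))

end Transfer

/-! ### Sampling functions along orbits -/

section Orbits

variable {n d : ℕ}

lemma shift_add (M : Matrix (Fin n) (Fin d) ℝ) (x y : Vertex d) :
    shift M (x + y) = shift M x + shift M y := by
  funext j
  have h1 : (fun i => (((x + y) i : ℤ) : ℝ)) = (fun i => (x i : ℝ)) + fun i => (y i : ℝ) := by
    funext i; simp
  change ((M.mulVec (fun i => (((x + y) i : ℤ) : ℝ)) j : ℝ) : UnitAddCircle) = _
  rw [h1, Matrix.mulVec_add, Pi.add_apply, AddCircle.coe_add]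
  rfl

/-- An admissible function is small only near its zeros. -/
lemma IsAdmissible.exists_dist_rpow_le {σ : ℝ} {h : Torus n → ℝ} (hσ : 0 < σ)
    (ha : IsAdmissible σ h) (hs : IsSampling h) :
    ∃ η : ℝ, 0 < η ∧ ∀ θ, h θ < η → ∃ ϑ, h ϑ = 0 ∧ dist θ ϑ ^ σ ≤ h θ := by
  have hloc : ∀ ϑ, h ϑ = 0 → ∃ ε > 0, ∀ θ, dist θ ϑ < ε → 0 < h θ → dist θ ϑ ^ σ ≤ h θ := by
    intro ϑ hϑ
    have h1 := eventually_lt_of_limsup_lt (ha ϑ hϑ)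
    obtain ⟨ε, hε, hε0, hε1⟩ := (h1.and (Ioo_mem_nhdsGT (zero_lt_one (α := ℝ)))).exists
    refine ⟨ε, hε0, fun θ hθ hpos => ?_⟩
    have hne : θ ≠ ϑ := by rintro rfl; exact hpos.ne' hϑ
    have hd : 0 < dist θ ϑ := dist_pos.2 hne
    have h2 : ENNReal.ofReal (|Real.log (h θ)| / |Real.log (dist θ ϑ)|) < ENNReal.ofReal σ := by
      refine lt_of_le_of_lt ?_ hε
      exact le_iSup_of_le θ (le_iSup_of_le hne (le_iSup_of_le hθ le_rfl))
    have h3 := (ENNReal.ofReal_lt_ofReal_iff hσ).1 h2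
    have hlog : Real.log (dist θ ϑ) < 0 := Real.log_neg hd (hθ.trans hε1)
    rw [div_lt_iff₀ (abs_pos.2 hlog.ne), abs_of_neg hlog] at h3
    have h4 := neg_le_abs (Real.log (h θ))
    rw [Real.rpow_def_of_pos hd, ← Real.le_log_iff_exp_le hpos]
    linarith
  choose! ε hε hε' using hloc
  let U : Set (Torus n) := ⋃ ϑ ∈ {ϑ | h ϑ = 0}, Metric.ball ϑ (ε ϑ)
  have hU : IsOpen U := isOpen_biUnion fun _ _ => Metric.isOpen_ball
  have hpos : ∀ θ ∈ Uᶜ, 0 < h θ := by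
    intro θ hθ
    refine lt_of_le_of_ne (hs.2.1 θ) fun h0 => hθ ?_
    exact Set.mem_biUnion (show h θ = 0 from h0.symm) (Metric.mem_ball_self (hε θ h0.symm))
  obtain ⟨η, hη, hη'⟩ := hU.isClosed_compl.isCompact.exists_forall_le' hs.1.continuousOn hpos
  refine ⟨η, hη, fun θ hθ => ?_⟩
  rcases (hs.2.1 θ).eq_or_lt with h0 | h0
  · exact ⟨θ, h0.symm, by rw [dist_self, Real.zero_rpow hσ.ne', ← h0]⟩
  · have hθU : θ ∈ U := by
      by_contra hcon
      exact absurd (hη' θ hcon) (not_le.2 hθ)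
    obtain ⟨ϑ, hϑ, hball⟩ := Set.mem_iUnion₂.1 hθU
    exact ⟨ϑ, hϑ, hε' ϑ hϑ θ (Metric.mem_ball.1 hball) h0⟩

lemma volume_dist_add_le (a ϑ : Torus n) {ρ : ℝ} (hρ : 0 ≤ ρ) :
    volume {θ : Torus n | dist (θ + a) ϑ ≤ ρ} ≤ ENNReal.ofReal ((2 * ρ) ^ n) := by
  have h1 : {θ : Torus n | dist (θ + a) ϑ ≤ ρ} = Metric.closedBall (ϑ - a) ρ := by
    ext θ
    rw [Metric.mem_closedBall, ← dist_add_right θ (ϑ - a) a, sub_add_cancel]; rfl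
  rw [h1, closedBall_pi _ hρ, volume_pi_pi]
  simp only [AddCircle.volume_closedBall, Finset.prod_const, Finset.card_univ, Fintype.card_fin]
  rw [← ENNReal.ofReal_pow (by positivity)]
  exact ENNReal.ofReal_le_ofReal (pow_le_pow_left₀ (by positivity) (min_le_right _ _) n)

lemma summable_int_inv_sq : Summable fun n : ℤ => ((1 + |(n : ℝ)|) ^ 2)⁻¹ := by
  have h : Summable fun n : ℕ => ((1 + |(n : ℝ)|) ^ 2)⁻¹ := by
    have h1 := (summable_nat_add_iff 1).2 (Real.summable_one_div_nat_pow.2 one_lt_two)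
    refine h1.congr fun n => ?_
    rw [Nat.abs_cast, one_div]
    push_cast
    rw [add_comm]
  refine Summable.of_nat_of_neg (by simpa using h) (by simpa using h)

/-- The `ℓ¹` norm dominates every coordinate, so the terms are bounded by products of
one-dimensional summable factors. -/
lemma summable_vertex (d : ℕ) :
    Summable fun v : Vertex d => ((1 + (dst 0 v : ℝ)) ^ (2 * d))⁻¹ := by
  set K := ∑' n : ℤ, ((1 + |(n : ℝ)|) ^ 2)⁻¹ with hK
  refine summable_of_sum_le (c := K ^ d) (fun v => by positivity) fun s => ?_
  obtain ⟨r, hr⟩ : ∃ r, s ⊆ ballF 0 r :=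
    ⟨s.sup fun y => dst 0 y, fun y hy => mem_ballF.2 (Finset.le_sup (f := fun y => dst 0 y) hy)⟩
  calc ∑ v ∈ s, ((1 + (dst 0 v : ℝ)) ^ (2 * d))⁻¹
      ≤ ∑ v ∈ s, ∏ i, ((1 + |(v i : ℝ)|) ^ 2)⁻¹ := by
        refine Finset.sum_le_sum fun v _ => ?_
        rw [Finset.prod_inv_distrib]
        refine inv_anti₀ (Finset.prod_pos fun i _ => by positivity) ?_
        have hprod : (1 + (dst 0 v : ℝ)) ^ (2 * d) = ∏ _i : Fin d, (1 + (dst 0 v : ℝ)) ^ 2 := by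
          rw [Finset.prod_const, Finset.card_univ, Fintype.card_fin, pow_mul]
        rw [hprod]
        refine Finset.prod_le_prod (fun i _ => by positivity) fun i _ => ?_
        gcongr
        rw [dst]
        push_cast
        refine le_trans (le_of_eq ?_) (Finset.single_le_sum
          (f := fun i => ((((0 : Vertex d) i - v i).natAbs : ℕ) : ℝ))
          (fun i _ => Nat.cast_nonneg _) (Finset.mem_univ i))
        rw [Nat.cast_natAbs]
        simp
    _ ≤ ∑ v ∈ Fintype.piFinset fun i => Finset.Icc ((0 : Vertex d) i - r) ((0 : Vertex d) i + r),
          ∏ i, ((1 + |(v i : ℝ)|) ^ 2)⁻¹ :=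
        Finset.sum_le_sum_of_subset_of_nonneg (hr.trans (Finset.filter_subset _ _))
          fun _ _ _ => Finset.prod_nonneg fun i _ => by positivity
    _ = ∏ i, ∑ n ∈ Finset.Icc ((0 : Vertex d) i - r) ((0 : Vertex d) i + r),
          ((1 + |(n : ℝ)|) ^ 2)⁻¹ := by
        rw [Finset.prod_univ_sum]
    _ ≤ ∏ _i : Fin d, K :=
        Finset.prod_le_prod (fun i _ => Finset.sum_nonneg fun _ _ => by positivity)
          fun i _ => summable_int_inv_sq.sum_le_tsum _ fun _ _ => by positivity
    _ = K ^ d := by simp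

/-- Along almost every orbit a sampling function decays at most polynomially. -/
theorem ae_exists_le_sampling {ν σ : ℝ} (hν : 0 < ν) (hσ : 0 < σ) (hn : ν ≤ n)
    (M : Matrix (Fin n) (Fin d) ℝ) {h : Torus n → ℝ} (hs : IsSampling h) (ha : IsAdmissible σ h) :
    ∀ᵐ θ : Torus n, ∃ c : ℝ, 0 < c ∧ ∀ v : Vertex d,
      c * (1 + (dst 0 v : ℝ)) ^ (-(2 * σ * (d / ν))) ≤ h (θ + shift M v) := by
  have hn0 : n ≠ 0 := by
    rintro rfl
    simp only [Nat.cast_zero] at hn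
    linarith
  obtain ⟨η, hη, hη'⟩ := ha.exists_dist_rpow_le hσ hs
  set ρ : Vertex d → ℝ := fun v => (1 + (dst 0 v : ℝ)) ^ (-(2 * (d / ν))) with hρ
  have hone : ∀ v : Vertex d, (1 : ℝ) ≤ 1 + (dst 0 v : ℝ) := fun v => by
    linarith [(Nat.cast_nonneg (dst 0 v) : (0 : ℝ) ≤ dst 0 v)]
  have hρ0 : ∀ v, 0 < ρ v := fun v => Real.rpow_pos_of_pos (by linarith [hone v]) _
  -- Borel–Cantelli: the balls of radius `ρ v` have volume at most a constant times `(1 +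
  -- |v|)^(-2d)`, because `n ≥ ν`.
  have hfin : ∀ ϑ : Torus n, ∀ᵐ θ : Torus n, {v | dist (θ + shift M v) ϑ ≤ ρ v}.Finite := by
    intro ϑ
    refine ae_finite_setOfPred_mem (s := fun v => {θ : Torus n | dist (θ + shift M v) ϑ ≤ ρ v}) ?_
    have hsum := (summable_vertex d).mul_left ((2 : ℝ) ^ n)
    refine ne_top_of_le_ne_top hsum.tsum_ofReal_ne_top (ENNReal.tsum_le_tsum fun v => ?_)
    refine (volume_dist_add_le _ _ (hρ0 v).le).trans (ENNReal.ofReal_le_ofReal ?_)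
    rw [mul_pow]
    refine mul_le_mul_of_nonneg_left ?_ (by positivity)
    have h0 : (0 : ℝ) ≤ 1 + (dst 0 v : ℝ) := by linarith [hone v]
    rw [hρ, ← Real.rpow_natCast, ← Real.rpow_mul h0, ← Real.rpow_natCast, ← Real.rpow_neg h0]
    refine Real.rpow_le_rpow_of_exponent_le (hone v) ?_
    have h1 : (d : ℝ) ≤ d / ν * n := by
      rw [div_mul_eq_mul_div, le_div_iff₀ hν]
      exact mul_le_mul_of_nonneg_left hn (Nat.cast_nonneg d)
    push_cast
    linarith
  have hne : ∀ (ϑ : Torus n) (v : Vertex d), ∀ᵐ θ : Torus n, θ + shift M v ≠ ϑ := by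
    intro ϑ v
    rw [ae_iff]
    have := volume_dist_add_le (shift M v) ϑ le_rfl
    rw [mul_zero, zero_pow hn0, ENNReal.ofReal_zero] at this
    refine measure_mono_null (fun θ hθ => ?_) (le_antisymm this zero_le)
    simp only [ne_eq, not_not, Set.mem_ofPred_eq] at hθ
    simp [hθ]
  have hcount : {ϑ | h ϑ = 0}.Countable := hs.2.2.countable
  filter_upwards [(ae_ball_iff hcount).2 fun ϑ _ => hfin ϑ,
    (ae_ball_iff hcount).2 fun ϑ _ => ae_all_iff.2 (hne ϑ)] with θ h1 h2
  -- At the finitely many exceptional vertices it suffices that the sampling function does not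
  -- vanish; its least value there enters the constant.
  have hS : (⋃ ϑ ∈ {ϑ | h ϑ = 0}, {v | dist (θ + shift M v) ϑ ≤ ρ v}).Finite :=
    hs.2.2.biUnion h1
  obtain ⟨c, hc, hc'⟩ := hS.isCompact.exists_forall_le' (f := fun v => h (θ + shift M v))
    continuous_of_discreteTopology.continuousOn (a := 0) fun v _ =>
      lt_of_le_of_ne (hs.2.1 _) fun h0 => h2 _ h0.symm v rfl
  refine ⟨min (min η 1) c, lt_min (lt_min hη one_pos) hc, fun v => ?_⟩
  set q := (1 + (dst 0 v : ℝ)) ^ (-(2 * σ * (d / ν))) with hq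
  have hq0 : 0 ≤ q := Real.rpow_nonneg (by linarith [hone v]) _
  have hq1 : q ≤ 1 := Real.rpow_le_one_of_one_le_of_nonpos (hone v)
    (neg_nonpos.2 (by positivity))
  have hm0 : 0 ≤ min (min η 1) c := (lt_min (lt_min hη one_pos) hc).le
  have hmq : min (min η 1) c * q ≤ min (min η 1) c := mul_le_of_le_one_right hm0 hq1
  by_cases hv : v ∈ ⋃ ϑ ∈ {ϑ | h ϑ = 0}, {v | dist (θ + shift M v) ϑ ≤ ρ v}
  · exact (hmq.trans (min_le_right _ _)).trans (hc' v hv)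
  · rcases lt_or_ge (h (θ + shift M v)) η with hlt | hge
    · obtain ⟨ϑ, hϑ, hd⟩ := hη' _ hlt
      have h3 : ρ v < dist (θ + shift M v) ϑ := by
        by_contra hcon
        exact hv (Set.mem_biUnion (show h ϑ = 0 from hϑ) (not_lt.1 hcon))
      have h4 : q = ρ v ^ σ := by
        rw [hq, hρ, ← Real.rpow_mul (by linarith [hone v])]
        congr 1; ring
      have h5 : q ≤ dist (θ + shift M v) ϑ ^ σ := by
        rw [h4]; exact Real.rpow_le_rpow (hρ0 v).le h3.le hσ.le
      have h6 : min (min η 1) c * q ≤ q := mul_le_of_le_one_left hq0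
        ((min_le_left _ _).trans (min_le_right _ _))
      linarith
    · exact (hmq.trans ((min_le_left _ _).trans (min_le_left _ _))).trans hge

end Orbits

/-! ### Quasiperiodic environments -/

section Environments

variable {d : ℕ}

/-- The vector along an edge of the type `j`. -/
def stepVec (j : Fin (d + 1)) : Vertex d := Fin.cases 0 (fun i => Pi.single i 1) j

lemma dst_sub_stepVec_le (x : Vertex d) (j : Fin (d + 1)) (s : Bool) :
    dst 0 (x - if s then stepVec j else 0) ≤ dst 0 x + 1 := by
  refine (dst_triangle 0 x _).trans (Nat.add_le_add_left ?_ _)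
  cases s
  · simp [dst_self]
  · refine Fin.cases ?_ (fun i => ?_) j
    · simp [stepVec, dst_self]
    · have h := dst_add_single (x - Pi.single i 1) i
      rw [sub_add_cancel, dst_comm] at h
      simpa [stepVec] using h.le

namespace Environment

variable (E : Environment d) (θ : E.Phase)

/-- The least value of the sampling functions at a vertex and at the edges incident to it. -/
def quality (x : Vertex d) : ℝ :=
  Finset.univ.inf' Finset.univ_nonempty fun l : Fin (d + 1) × Bool =>
    E.h l.1 (θ l.1 + shift (E.mat l.1) (x - if l.2 then stepVec l.1 else 0))

variable {E θ}

lemma quality_le (x : Vertex d) (j : Fin (d + 1)) (s : Bool) :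
    E.quality θ x ≤ E.h j (θ j + shift (E.mat j) (x - if s then stepVec j else 0)) :=
  Finset.inf'_le (f := fun l : Fin (d + 1) × Bool =>
    E.h l.1 (θ l.1 + shift (E.mat l.1) (x - if l.2 then stepVec l.1 else 0)))
    (Finset.mem_univ (j, s))

lemma quality_le_death (x : Vertex d) : E.quality θ x ≤ E.death θ x := by
  simpa [death] using quality_le (E := E) (θ := θ) x 0 false

lemma quality_le_left (u : Edge d) :
    E.quality θ u.1 ≤ E.h u.2.succ (θ u.2.succ + shift (E.mat u.2.succ) u.1) := by
  simpa using quality_le (E := E) (θ := θ) u.1 u.2.succ false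

lemma quality_le_right (u : Edge d) :
    E.quality θ (u.1 + Pi.single u.2 1) ≤
      E.h u.2.succ (θ u.2.succ + shift (E.mat u.2.succ) u.1) := by
  have h := quality_le (E := E) (θ := θ) (u.1 + Pi.single u.2 1) u.2.succ true
  have e : u.1 + Pi.single u.2 1 - (if true then stepVec u.2.succ else 0) = u.1 := by
    rw [if_pos rfl]; exact add_sub_cancel_right _ _
  rwa [e] at h

variable {ν ζ σ : ℝ}

lemma IsRegular.rate_nonneg (hE : E.IsRegular ν ζ σ) {κ : ℝ} (hκ : 0 < κ) (w : Graph d) :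
    0 ≤ E.rate κ θ w := by
  rcases w with x | u
  · exact mul_nonneg (inv_nonneg.2 hκ.le) ((hE.sampling _).2.1 _)
  · exact mul_nonneg hκ.le (one_div_nonneg.2 ((hE.sampling _).2.1 _))

/-- The discretised process satisfies the bounds given by the quality of the vertices. -/
theorem IsRegular.isModel (hE : E.IsRegular ν ζ σ) {κ : ℝ} (hκ : 0 < κ) (M : ℕ)
    (hpos : ∀ x, 0 < E.quality θ x) :
    IsModel (E.quality θ) κ M (fineProb (E.rate κ θ) M) := by
  have hbond : ∀ (u : Edge d) (n : ℤ) (g : ℝ), 0 < g →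
      g ≤ E.h u.2.succ (θ u.2.succ + shift (E.mat u.2.succ) u.1) →
      Real.exp (-(κ / (M * g))) ≤ 1 - fineProb (E.rate κ θ) M (Sum.inr u, n) := by
    intro u n g hg hle
    simp only [fineProb, Sum.isLeft_inr, Bool.false_eq_true, if_false, sub_sub_cancel, rate, bond]
    refine Real.exp_le_exp.2 (neg_le_neg ?_)
    rw [mul_one_div, div_div, mul_comm (M : ℝ)]
    rcases M.eq_zero_or_pos with rfl | hM
    · simp
    · have : (0 : ℝ) < M := by exact_mod_cast hM
      gcongr
  refine ⟨fineProb_mem_unit (hE.rate_nonneg hκ), fun x n => ?_,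
    fun x i n => hbond (x, i) n _ (hpos _) (quality_le_left (x, i)),
    fun x i n => hbond (x, i) n _ (hpos _) (quality_le_right (x, i))⟩
  simp only [fineProb, Sum.isLeft_inl, if_true, rate]
  refine Real.exp_le_exp.2 (neg_le_neg ?_)
  rw [inv_mul_eq_div, div_div]
  exact div_le_div_of_nonneg_right (quality_le_death x) (by positivity)

/-- The quality decays at most polynomially. -/
theorem IsRegular.ae_exists_le_quality (hE : E.IsRegular ν ζ σ) (hν : 0 < ν) (hσ : 0 < σ) :
    ∀ᵐ θ : E.Phase, ∃ c : ℝ, 0 < c ∧ ∀ x : Vertex d,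
      c * (1 + (dst 0 x : ℝ)) ^ (-(2 * σ * (d / ν))) ≤ E.quality θ x := by
  have h1 : ∀ j : Fin (d + 1), ∀ᵐ θ : E.Phase, ∃ c : ℝ, 0 < c ∧ ∀ v : Vertex d,
      c * (1 + (dst 0 v : ℝ)) ^ (-(2 * σ * (d / ν))) ≤ E.h j (θ j + shift (E.mat j) v) :=
    fun j => (Measure.quasiMeasurePreserving_eval (fun i => (volume : Measure (Torus (E.dim i))))
      j).ae (ae_exists_le_sampling hν hσ (hE.le_dim j) (E.mat j) (hE.sampling j) (hE.admissible j))
  filter_upwards [ae_all_iff.2 h1] with θ hθ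
  choose c hc hc' using hθ
  set a := 2 * σ * (d / ν) with ha
  have ha0 : 0 ≤ a := by positivity
  have hcm : 0 < Finset.univ.inf' Finset.univ_nonempty c :=
    (Finset.lt_inf'_iff _).2 fun j _ => hc j
  refine ⟨Finset.univ.inf' Finset.univ_nonempty c * 2 ^ (-a),
    mul_pos hcm (Real.rpow_pos_of_pos two_pos _), fun x => ?_⟩
  refine (Finset.le_inf'_iff _ _).2 fun l _ => le_trans ?_ (hc' l.1 _)
  rw [mul_assoc, ← Real.mul_rpow two_pos.le (by positivity)]
  refine mul_le_mul (Finset.inf'_le _ (Finset.mem_univ _)) ?_ (by positivity) (hc _).le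
  refine Real.rpow_le_rpow_of_nonpos (by positivity) ?_ (neg_nonpos.2 ha0)
  have : (dst 0 (x - if l.2 then stepVec l.1 else 0) : ℝ) ≤ dst 0 x + 1 := by
    exact_mod_cast dst_sub_stepVec_le x l.1 l.2
  linarith [(Nat.cast_nonneg (dst 0 x) : (0 : ℝ) ≤ dst 0 x)]

/-- Five of the six multiples of `ζ * σ` match the power `y ^ 5` in the radius; the sixth beats the
constant. -/
lemma eventually_inv_pow_le {c ζ σ : ℝ} (hc : 0 < c) (hζ : 0 < ζ) (hσ : 0 < σ) {β : ℕ}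
    (hβ : 6 * (ζ * σ) ≤ β) :
    ∀ᶠ y : ℕ in atTop, ((y : ℝ) ^ β)⁻¹ ≤ (c / (2 * (y : ℝ) ^ 5) ^ ζ / 2) ^ σ := by
  have h1 : Tendsto (fun y : ℕ => (y : ℝ) ^ (-(ζ * σ))) atTop (𝓝 0) :=
    (tendsto_rpow_neg_atTop (mul_pos hζ hσ)).comp tendsto_natCast_atTop_atTop
  have h2 : 0 < (c / 2 ^ ζ / 2) ^ σ := by positivity
  filter_upwards [h1.eventually_le_const h2, eventually_ge_atTop 1] with y hy hy1
  have hy1' : (1 : ℝ) ≤ y := by exact_mod_cast hy1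
  have hy0 : (0 : ℝ) < y := by linarith
  have e1 : (c / (2 * (y : ℝ) ^ 5) ^ ζ / 2) ^ σ = (c / 2 ^ ζ / 2) ^ σ * (y : ℝ) ^ (-(5 * (ζ * σ))) := by
    rw [Real.mul_rpow two_pos.le (by positivity), ← Real.rpow_natCast, ← Real.rpow_mul hy0.le,
      show c / (2 ^ ζ * (y : ℝ) ^ (((5 : ℕ) : ℝ) * ζ)) / 2 =
        c / 2 ^ ζ / 2 * (y : ℝ) ^ (-(5 * ζ)) by rw [Real.rpow_neg hy0.le]; push_cast; field_simp,
      Real.mul_rpow (by positivity) (by positivity), ← Real.rpow_mul hy0.le]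
    congr 2; ring
  rw [e1, ← Real.rpow_natCast, ← Real.rpow_neg hy0.le]
  calc (y : ℝ) ^ (-(β : ℝ)) ≤ (y : ℝ) ^ (-(ζ * σ) + -(5 * (ζ * σ))) :=
        Real.rpow_le_rpow_of_exponent_le hy1' (by linarith)
    _ = (y : ℝ) ^ (-(ζ * σ)) * (y : ℝ) ^ (-(5 * (ζ * σ))) := Real.rpow_add hy0 _ _
    _ ≤ _ := mul_le_mul_of_nonneg_right hy (by positivity)

/-- Vertices of low quality are far apart. -/
theorem IsRegular.eventually_isSeparated (hE : E.IsRegular ν ζ σ) (hζ : 0 < ζ) (hσ : 0 < σ)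
    {β : ℕ} (hβ1 : 1 ≤ β) (hβ : 6 * (ζ * σ) ≤ β) :
    ∀ᶠ b : ℕ in atTop, ∀ θ, IsSeparated b (2 * E.numZeros) β (E.quality θ) := by
  classical
  choose c hc hdio using hE.diophantine
  choose η hη hη' using fun j => (hE.admissible j).exists_dist_rpow_le hσ (hE.sampling j)
  have hthr : ∀ᶠ y : ℕ in atTop, ∀ j, ((y : ℝ) ^ β)⁻¹ ≤ η j := by
    refine eventually_all.2 fun j => ?_
    have h1 : Tendsto (fun b : ℕ => ((b : ℝ) ^ β)⁻¹) atTop (𝓝 0) :=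
      ((tendsto_pow_atTop (by omega)).comp tendsto_natCast_atTop_atTop).inv_tendsto_atTop
    exact h1.eventually_le_const (hη j)
  have hsep : ∀ᶠ y : ℕ in atTop, ∀ j, ((y : ℝ) ^ β)⁻¹ ≤ (c j / (2 * (y : ℝ) ^ 5) ^ ζ / 2) ^ σ :=
    eventually_all.2 fun j => eventually_inv_pow_le (hc j) hζ hσ hβ
  filter_upwards [eventually_forall_ge_atTop.2 (hthr.and hsep), eventually_gt_atTop 0] with b hb hb0
  intro θ k x
  obtain ⟨h1, h2⟩ := hb (scale b (2 * E.numZeros) k) (le_scale k)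
  have hy0 : (0 : ℝ) < scale b (2 * E.numZeros) k := by exact_mod_cast scale_pos hb0 k
  set y := scale b (2 * E.numZeros) k with hy
  have hty : thr b (2 * E.numZeros) β k = ((y : ℝ) ^ β)⁻¹ := rfl
  set V := (ballF x (y ^ 5)).filter fun z => E.quality θ z < thr b (2 * E.numZeros) β k with hV
  -- A vertex is bad because of some zero of some sampling function, seen at the vertex itself or at
  -- its backward neighbour. There are at most 2R such labels, and it remains to show that bad
  -- vertices in a ball have different labels.
  set T : Finset ((Σ j, Torus (E.dim j)) × Bool) :=
    (Finset.univ.sigma fun j => (hE.sampling j).2.2.toFinset) ×ˢ Finset.univ with hT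
  have hTcard : T.card ≤ 2 * E.numZeros := by
    rw [hT, Finset.card_product, Finset.card_sigma, Finset.card_univ, Fintype.card_bool, mul_comm]
    refine Nat.mul_le_mul_left 2 (le_trans (le_of_eq ?_) (le_max_right _ _))
    exact Finset.sum_congr rfl fun j _ => (Set.ncard_eq_toFinset_card _ _).symm
  have hlabel : ∀ z ∈ V, ∃ l ∈ T, dist (θ l.1.1 +
      shift (E.mat l.1.1) (z - if l.2 then stepVec l.1.1 else 0)) l.1.2 ^ σ < ((y : ℝ) ^ β)⁻¹ := by
    intro z hz
    obtain ⟨l, -, hl⟩ := (Finset.inf'_lt_iff _).1 (Finset.mem_filter.1 hz).2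
    obtain ⟨ϑ, hϑ, hd⟩ := hη' l.1 _ (hl.trans_le (h1 l.1))
    refine ⟨(⟨l.1, ϑ⟩, l.2), ?_, hd.trans_lt hl⟩
    simp [hT, hϑ]
  choose! f hfT hf using hlabel
  refine le_trans (Finset.card_le_card_of_injOn f hfT ?_) hTcard
  intro z hz z' hz' hzz'
  by_contra hne
  have hd1 := hf z hz
  have hd2 := hf z' hz'
  rw [← hzz'] at hd2
  set j := (f z).1.1 with hj
  set ϑ := (f z).1.2 with hϑ
  set w : Vertex d := if (f z).2 then stepVec j else 0 with hw
  have hdio' := hdio j (z - z') (sub_ne_zero.2 hne) (θ j + shift (E.mat j) (z' - w))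
  have e1 : shift (E.mat j) (z - z') + (θ j + shift (E.mat j) (z' - w)) =
      θ j + shift (E.mat j) (z - w) := by
    rw [show z - w = (z - z') + (z' - w) by abel, shift_add]; abel
  rw [e1] at hdio'
  have hl1 : l1 (z - z') ≤ 2 * (y : ℝ) ^ 5 := by
    rw [l1_sub_eq_dst]
    have a1 := mem_ballF.1 (Finset.mem_filter.1 hz).1
    have a2 := mem_ballF.1 (Finset.mem_filter.1 hz').1
    have a3 := dst_triangle z' x z
    rw [dst_comm z' x] at a3
    have : dst z' z ≤ 2 * y ^ 5 := by omega
    exact_mod_cast this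
  have hl0 : 0 < l1 (z - z') := by
    rw [l1_sub_eq_dst]
    have : dst z' z ≠ 0 := fun h0 => hne (eq_of_dst_eq_zero h0).symm
    exact_mod_cast Nat.pos_of_ne_zero this
  have hlow : c j / (2 * (y : ℝ) ^ 5) ^ ζ ≤
      dist (θ j + shift (E.mat j) (z - w)) ϑ + dist (θ j + shift (E.mat j) (z' - w)) ϑ := by
    refine le_trans ?_ (hdio'.trans (dist_triangle_right _ _ _))
    exact div_le_div_of_nonneg_left (hc j).le (Real.rpow_pos_of_pos hl0 _)
      (Real.rpow_le_rpow hl0.le hl1 hζ.le)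
  have hhalf : 0 ≤ c j / (2 * (y : ℝ) ^ 5) ^ ζ / 2 := by
    have := hc j
    positivity
  -- With equal labels both orbit points would be this close to the same zero, hence closer to each
  -- other than the Diophantine condition permits.
  have hbad : ∀ r : ℝ, r ^ σ < ((y : ℝ) ^ β)⁻¹ → r < c j / (2 * (y : ℝ) ^ 5) ^ ζ / 2 := by
    intro r hr
    by_contra hcon
    exact absurd ((h2 j).trans (Real.rpow_le_rpow hhalf (not_lt.1 hcon) hσ.le)) (not_le.2 hr)
  linarith [hbad _ hd1, hbad _ hd2]

end Environment

end Environments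

/-! ### Connection probabilities -/

section Connection

variable {d : ℕ} {rate : Graph d → ℝ} {P : Measure (Config d)} {b N β k L : ℕ} {m : ℝ}
  {g : Vertex d → ℝ} {x y : Vertex d}

/-- Connections inside a ball of good vertices. -/
lemma IsPoissonLaw.measure_hasPath_ball_le (h : IsPoissonLaw rate P) (hrate : ∀ w, 0 ≤ rate w)
    (hb : 0 < b) (hgood : ∀ z ∈ ballF x L, thr b N β k ≤ g z)
    (hdec : ∀ᶠ M : ℕ in atTop, ∀ F, Decays b N β m g M F (fineProb rate M) k)
    {z : Vertex d} (hz : z ∈ ballF x L) (t : ℝ) (j : ℤ) :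
    P {ω | ∃ r, ⌊r⌋ = j ∧ ω.HasPath {Z | Z.1 ∈ ballF x L} (x, t) (z, r)} ≤
      ENNReal.ofReal (2 * Real.exp (scale b N k + 1 - m * dst x z -
        |(j : ℝ) - ⌊t⌋| / corrTime b N β k)) := by
  refine h.measure_hasPath_le hrate hz ?_
  filter_upwards [hdec] with M hM F
  have hT : (1 : ℝ) ≤ corrTime b N β k := by exact_mod_cast corrTime_pos hb k
  have hmono : ∀ c c', prob F (fineProb rate M) (CellConn M {X | X.1 ∈ ballF x L} c c') ≤
      Real.exp (scale b N k - weight (mass m k) (corrTime b N β k) c c') := by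
    refine fun c c' => le_trans (prob_mono (fineProb_mem_unit hrate) ?_) (hM F c c')
    rintro S - ⟨X, Y, h1, h2, h3⟩
    exact ⟨X, Y, h1, h2, h3.mono le_rfl fun Z hZ => hgood Z.1 hZ⟩
  have hmass : m * dst x z ≤ mass m k * dst x z :=
    mul_le_mul_of_nonneg_right (le_mass m k) (Nat.cast_nonneg _)
  constructor
  · refine (hmono _ _).trans (Real.exp_le_exp.2 ?_)
    unfold weight
    rw [abs_sub_comm]
    linarith
  -- The block `j + 1` may be closer in time by one unit; the `+ 1` in the exponent makes up for it.
  · refine (hmono _ _).trans (Real.exp_le_exp.2 ?_)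
    unfold weight
    have e1 : |(j : ℝ) - ⌊t⌋| ≤ |(⌊t⌋ : ℝ) - (j + 1 : ℤ)| + 1 := by
      rw [abs_sub_comm (⌊t⌋ : ℝ)]
      have := abs_sub_abs_le_abs_sub ((j : ℝ) - ⌊t⌋) (((j + 1 : ℤ) : ℝ) - ⌊t⌋)
      have e2 : (j : ℝ) - ⌊t⌋ - (((j + 1 : ℤ) : ℝ) - ⌊t⌋) = -1 := by push_cast; ring
      rw [e2, abs_neg, abs_one] at this
      linarith
    have e3 : |(j : ℝ) - ⌊t⌋| / corrTime b N β k ≤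
        |(⌊t⌋ : ℝ) - (j + 1 : ℤ)| / corrTime b N β k + 1 := by
      rw [div_add_one (by positivity), div_le_div_iff_of_pos_right (by linarith)]
      linarith
    simp only
    linarith

/-- The probability of a connection, in terms of a ball of good vertices. -/
theorem IsPoissonLaw.real_connects_le (h : IsPoissonLaw rate P) (hrate : ∀ w, 0 ≤ rate w)
    (hb : 0 < b) (hgood : ∀ z ∈ ballF x L, thr b N β k ≤ g z)
    (hdec : ∀ᶠ M : ℕ in atTop, ∀ F, Decays b N β m g M F (fineProb rate M) k)
    (hy : dst x y ≤ L) (t s : ℝ) :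
    P.real {ω | ω.Connects (x, t) (y, s)} ≤
      2 * Real.exp (scale b N k + 1 - m * dst x y - |(⌊s⌋ : ℝ) - ⌊t⌋| / corrTime b N β k) +
      (2 * L + 1) ^ d * (8 * corrTime b N β k * Real.exp (scale b N k + 1 - m * L)) := by
  have := h.isProbabilityMeasure
  have hT : (1 : ℝ) ≤ corrTime b N β k := by exact_mod_cast corrTime_pos hb k
  let E : Vertex d → ℤ → Set (Config d) := fun z j =>
    {ω | ∃ r, ⌊r⌋ = j ∧ ω.HasPath {Z | Z.1 ∈ ballF x L} (x, t) (z, r)}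
  have hE := fun z (hz : z ∈ ballF x L) j =>
    h.measure_hasPath_ball_le hrate hb hgood hdec hz t j
  set V := (ballF x L).filter fun z => dst x z = L with hV
  -- A path that leaves the ball first reaches its boundary sphere inside the ball, at an arbitrary
  -- time. Summing over that time costs only a multiple of the correlation time.
  have hsub : {ω : Config d | ω.Connects (x, t) (y, s)} ⊆ E y ⌊s⌋ ∪ ⋃ z ∈ V, ⋃ j, E z j := by
    intro ω hω
    have hx : x ∈ ballF x L := mem_ballF.2 (by rw [dst_self]; exact Nat.zero_le _)
    rcases Config.HasPath.exists_exit (Λ := (ballF x L : Set (Vertex d)))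
      (Config.Connects.hasPath hω) hx with hp | ⟨z, hz, z', hz', hzz', r, hp⟩
    · exact Or.inl ⟨s, rfl, hp⟩
    · refine Or.inr (Set.mem_iUnion₂.2 ⟨z, Finset.mem_filter.2 ⟨hz, ?_⟩,
        Set.mem_iUnion.2 ⟨⌊r⌋, r, rfl, hp⟩⟩)
      have h1 := mem_ballF.1 (Finset.mem_coe.1 hz)
      have h2 : ¬ dst x z' ≤ L := fun h2 => hz' (Finset.mem_coe.2 (mem_ballF.2 h2))
      have h3 := dst_triangle x z z'
      omega
  set K := 8 * (corrTime b N β k : ℝ) * Real.exp (scale b N k + 1 - m * L) with hK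
  have hexit : ∀ z ∈ V, P (⋃ j, E z j) ≤ ENNReal.ofReal K := by
    intro z hz
    obtain ⟨hz1, hz2⟩ := Finset.mem_filter.1 hz
    refine (measure_iUnion_le _).trans ?_
    refine (ENNReal.tsum_le_tsum fun j => hE z hz1 j).trans ?_
    rw [ENNReal.tsum_eq_iSup_sum]
    refine iSup_le fun S => ?_
    rw [← ENNReal.ofReal_sum_of_nonneg fun j _ => by positivity]
    refine ENNReal.ofReal_le_ofReal ?_
    have e1 : ∀ j : ℤ, 2 * Real.exp (scale b N k + 1 - m * dst x z -
        |(j : ℝ) - ⌊t⌋| / corrTime b N β k) = 2 * Real.exp (scale b N k + 1 - m * L) *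
          Real.exp (-(|(j : ℝ) - ⌊t⌋| / corrTime b N β k)) := fun j => by
      rw [mul_assoc, ← Real.exp_add, hz2]; congr 2
    rw [Finset.sum_congr rfl fun j _ => e1 j, ← Finset.mul_sum, hK]
    calc _ ≤ 2 * Real.exp (scale b N k + 1 - m * L) * (4 * corrTime b N β k) :=
          mul_le_mul_of_nonneg_left (sum_exp_abs_le hT S ⌊t⌋) (by positivity)
      _ = _ := by ring
  have hK0 : 0 ≤ K := by positivity
  have hVcard : (V.card : ℝ) ≤ (2 * L + 1) ^ d := by
    have h1 := (Finset.card_filter_le (ballF x L) fun z => dst x z = L).trans (card_ballF_le x L)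
    exact_mod_cast h1
  have htotal : P {ω | ω.Connects (x, t) (y, s)} ≤ ENNReal.ofReal (2 * Real.exp (scale b N k + 1 -
      m * dst x y - |(⌊s⌋ : ℝ) - ⌊t⌋| / corrTime b N β k) + (2 * L + 1) ^ d * K) := by
    rw [ENNReal.ofReal_add (by positivity) (by positivity)]
    refine (measure_mono hsub).trans ((measure_union_le _ _).trans
      (add_le_add (hE y (mem_ballF.2 hy) ⌊s⌋) ?_))
    refine (measure_biUnion_finset_le _ _).trans ((Finset.sum_le_sum hexit).trans ?_)
    rw [Finset.sum_const, nsmul_eq_mul, ← ENNReal.ofReal_natCast,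
      ← ENNReal.ofReal_mul (Nat.cast_nonneg _)]
    exact ENNReal.ofReal_le_ofReal (mul_le_mul_of_nonneg_right hVcard hK0)
  exact ENNReal.toReal_le_of_le_ofReal (by positivity) htotal

/-- A level at which all vertices with a given lower bound on their quality are good. -/
lemma exists_level (hb : 2 ≤ b) (hβ : 1 ≤ β) {D : ℝ} (hD : 1 ≤ D) :
    ∃ k, D ≤ (scale b N k : ℝ) ^ β ∧ (scale b N k : ℝ) ^ β ≤ (b : ℝ) ^ β * D ^ ratio N := by
  classical
  have hb1 : (1 : ℝ) ≤ b := by exact_mod_cast (by omega : 1 ≤ b)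
  have hex : ∃ k, D ≤ (scale b N k : ℝ) ^ β := by
    obtain ⟨k, hk⟩ := pow_unbounded_of_one_lt D (one_lt_two (α := ℝ))
    refine ⟨k, hk.le.trans ?_⟩
    have h1 : ((2 ^ (k + 1) : ℕ) : ℝ) ≤ scale b N k := by exact_mod_cast two_pow_le_scale hb k
    push_cast at h1
    have h2 : (2 : ℝ) ^ k ≤ 2 ^ (k + 1) := pow_le_pow_right₀ (by norm_num) (by omega)
    have h3 : (1 : ℝ) ≤ scale b N k := by exact_mod_cast scale_pos (by omega) k
    exact (h2.trans h1).trans (le_self_pow₀ h3 (by omega))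
  -- The first sufficient level overshoots by at most one step of the scales, that is, by the power
  -- `ratio N`.
  refine ⟨Nat.find hex, Nat.find_spec hex, ?_⟩
  rcases hk : Nat.find hex with _ | k
  · have : scale b N 0 = b := by simp [scale]
    rw [this]
    exact le_mul_of_one_le_right (by positivity) (one_le_pow₀ hD)
  · have h1 := not_le.1 (Nat.find_min hex (show k < Nat.find hex by omega))
    rw [scale_succ]
    push_cast
    rw [← pow_mul, mul_comm (ratio N), pow_mul]
    exact (pow_le_pow_left₀ (by positivity) h1.le _).trans
      (le_mul_of_one_le_left (by positivity) (one_le_pow₀ hb1))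

/-- Small values of `κ` satisfy the conditions under which correlations decay. -/
lemma exists_kappa {η w K : ℝ} (hη : 0 < η) (hw : 0 < w) (hK : 0 < K) (d : ℕ) :
    ∃ κ₀ : ℝ, 0 < κ₀ ∧ ∀ κ, 0 < κ → κ ≤ κ₀ → κ ≤ 1 ∧ κ * w ≤ η ∧
      K * (6 * d * (κ / η) + 2 * Real.exp (-(η / κ))) ≤ 1 / 2 := by
  refine ⟨min 1 (min (η / w) (1 / (2 * (K * ((6 * d + 2) / η))))), by positivity,
    fun κ hκ hκ₀ => ?_⟩
  have h1 := hκ₀.trans (min_le_left _ _)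
  have h2 := hκ₀.trans ((min_le_right _ _).trans (min_le_left _ _))
  have h3 := hκ₀.trans ((min_le_right _ _).trans (min_le_right _ _))
  refine ⟨h1, (le_div_iff₀ hw).1 h2, ?_⟩
  have h4 : Real.exp (-(η / κ)) ≤ κ / η := by
    rw [Real.exp_neg, ← inv_div η κ]
    exact inv_anti₀ (by positivity) (le_exp_self _)
  rw [le_div_iff₀ (by positivity)] at h3
  calc K * (6 * d * (κ / η) + 2 * Real.exp (-(η / κ)))
      ≤ K * (6 * d * (κ / η) + 2 * (κ / η)) := by gcongr
    _ = (κ * (2 * (K * ((6 * d + 2) / η)))) / 2 := by ring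
    _ ≤ 1 / 2 := by linarith

end Connection

/-! ### Choice of the scale -/

section Choice

lemma mul_sqrt_le {K X S : ℝ} (hX : 0 ≤ X) (hS : S ≤ K * √X) : S ≤ K ^ 2 / 4 + X := by
  nlinarith [sq_nonneg (K / 2 - √X), Real.sq_sqrt hX]

/-- Connections out of a large ball are unlikely. -/
lemma exists_exit_bound (d n : ℕ) {K q μ : ℝ} (hK : 0 < K) :
    ∃ C : ℝ, 0 ≤ C ∧ ∀ (L : ℕ) (S T : ℝ), S ≤ K * √(1 + L) → 0 ≤ T → T ≤ K ^ n * (1 + L : ℝ) ^ q →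
      (2 * L + 1 : ℝ) ^ d * (8 * T * Real.exp (S + 1 - (μ + 2) * L)) ≤ C * Real.exp (-μ * L) := by
  set l := ⌈q⌉₊ + d with hl
  refine ⟨2 ^ d * 8 * K ^ n * l.factorial * Real.exp (3 + K ^ 2 / 4), by positivity,
    fun L S T hS hT0 hT => ?_⟩
  have hL : (0 : ℝ) ≤ L := Nat.cast_nonneg L
  set X : ℝ := 1 + L with hX
  have hX1 : 1 ≤ X := by linarith
  have hS' := mul_sqrt_le (by linarith : 0 ≤ X) hS
  have h1 : X ^ d * X ^ q ≤ l.factorial * Real.exp X := by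
    have h2 : X ^ q ≤ X ^ ⌈q⌉₊ := by
      rw [← Real.rpow_natCast]
      exact Real.rpow_le_rpow_of_exponent_le hX1 (Nat.le_ceil q)
    have h3 := Real.pow_div_factorial_le_exp X (by linarith) l
    rw [div_le_iff₀ (by positivity)] at h3
    calc X ^ d * X ^ q ≤ X ^ d * X ^ ⌈q⌉₊ := by gcongr
      _ = X ^ l := by rw [hl, pow_add, mul_comm]
      _ ≤ _ := by linarith
  calc (2 * L + 1 : ℝ) ^ d * (8 * T * Real.exp (S + 1 - (μ + 2) * L))
      ≤ (2 * X) ^ d * (8 * (K ^ n * X ^ q) * Real.exp (K ^ 2 / 4 + X + 1 - (μ + 2) * L)) := by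
        gcongr
        linarith
    _ = 2 ^ d * 8 * K ^ n * (X ^ d * X ^ q) * Real.exp (K ^ 2 / 4 + X + 1 - (μ + 2) * L) := by
        rw [mul_pow]; ring
    _ ≤ 2 ^ d * 8 * K ^ n * (l.factorial * Real.exp X) *
          Real.exp (K ^ 2 / 4 + X + 1 - (μ + 2) * L) := by gcongr
    _ = 2 ^ d * 8 * K ^ n * l.factorial * (Real.exp X *
          Real.exp (K ^ 2 / 4 + X + 1 - (μ + 2) * L)) := by ring
    _ = 2 ^ d * 8 * K ^ n * l.factorial * (Real.exp (3 + K ^ 2 / 4) * Real.exp (-μ * L)) := by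
        rw [← Real.exp_add, ← Real.exp_add, hX]
        congr 2; ring
    _ = _ := by ring

/-- Connections inside a large ball between distant points are unlikely. -/
lemma exists_inner_bound (n : ℕ) {K q μ τ : ℝ} (hK : 1 ≤ K) (hq : 0 ≤ q) (hμ : 0 ≤ μ) (hτ : 0 < τ)
    (hqτ : q + 2 ≤ 1 / τ) :
    ∃ C : ℝ, 0 ≤ C ∧ ∀ (L : ℕ) (S T δ r Δ ℓ : ℝ), S ≤ K * √(1 + L) → 1 ≤ T →
      T ≤ K ^ n * (1 + L : ℝ) ^ q → 0 ≤ δ → 0 ≤ r → 0 ≤ Δ → r - 1 ≤ Δ → ℓ = max δ (r ^ τ) → 1 ≤ ℓ →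
      (L : ℝ) ≤ ℓ + 1 →
      2 * Real.exp (S + 1 - (μ + 2) * δ - Δ / T) ≤ C * Real.exp (-μ * ℓ) := by
  set k₃ : ℝ := (K ^ n * 3 ^ q)⁻¹ with hk₃
  have hk₃0 : 0 < k₃ := by positivity
  refine ⟨2 * Real.exp (K ^ 2 / 4 + 4 + (1 + μ) ^ 2 / (4 * k₃)), by positivity,
    fun L S T δ r Δ ℓ hS hT1 hT hδ hr hΔ hrΔ hℓ hℓ1 hL => ?_⟩
  rw [mul_assoc, ← Real.exp_add]
  refine mul_le_mul_of_nonneg_left (Real.exp_le_exp.2 ?_) two_pos.le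
  have hL0 : (0 : ℝ) ≤ L := Nat.cast_nonneg L
  have hS' := mul_sqrt_le (by linarith : (0 : ℝ) ≤ 1 + L) hS
  have hsq : 0 ≤ (1 + μ) ^ 2 / (4 * k₃) := by positivity
  -- If the spatial distance dominates, the spare part of the rate `μ + 2` absorbs `exp S`.
  -- Otherwise the time separation `r = ℓ ^ (1 / τ)` exceeds `T` by a factor of order `ℓ ^ 2`, which
  -- beats every linear term.
  rcases max_cases δ (r ^ τ) with ⟨h1, -⟩ | ⟨h1, -⟩
  · rw [h1] at hℓ
    have : 0 ≤ Δ / T := by positivity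
    rw [← hℓ]
    nlinarith
  · rw [h1] at hℓ
    have hr' : r = ℓ ^ (1 / τ) := by
      rw [hℓ, ← Real.rpow_mul hr, mul_one_div_cancel hτ.ne', Real.rpow_one]
    have hℓ0 : 0 < ℓ := by linarith
    have hT3 : T ≤ k₃⁻¹ * ℓ ^ q := by
      rw [hk₃, inv_inv, mul_assoc, ← Real.mul_rpow (by norm_num) hℓ0.le]
      refine hT.trans (mul_le_mul_of_nonneg_left ?_ (by positivity))
      exact Real.rpow_le_rpow (by linarith) (by linarith) hq
    have hrT : k₃ * ℓ ^ 2 ≤ r / T := by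
      rw [le_div_iff₀ (by linarith)]
      calc k₃ * ℓ ^ 2 * T ≤ k₃ * ℓ ^ 2 * (k₃⁻¹ * ℓ ^ q) := by gcongr
        _ = ℓ ^ q * ℓ ^ 2 := by field_simp
        _ = ℓ ^ (q + 2) := by rw [Real.rpow_add hℓ0, Real.rpow_two]
        _ ≤ r := by rw [hr']; exact Real.rpow_le_rpow_of_exponent_le hℓ1 hqτ
    have hΔT : r / T - 1 ≤ Δ / T := by
      rw [div_sub_one (by linarith), div_le_div_iff_of_pos_right (by linarith)]
      linarith
    have hquad : (1 + μ) * ℓ - k₃ * ℓ ^ 2 ≤ (1 + μ) ^ 2 / (4 * k₃) := by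
      rw [le_div_iff₀ (by positivity)]
      nlinarith [sq_nonneg ((1 + μ) - 2 * k₃ * ℓ)]
    have hδ' : 0 ≤ (μ + 2) * δ := by positivity
    linarith

variable {d : ℕ} {rate : Graph d → ℝ} {P : Measure (Config d)} {b N β : ℕ}
  {g : Vertex d → ℝ}

/-- Decay of the connection probabilities from decay at all scales. -/
theorem IsPoissonLaw.exists_real_connects_le (h : IsPoissonLaw rate P) (hrate : ∀ w, 0 ≤ rate w)
    (hb : 2 ≤ b) (hβ : 1 ≤ β) {μ τ a c : ℝ} (hμ : 0 ≤ μ) (hτ : 0 < τ) (ha : 0 ≤ a) (hc : 0 < c)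
    (hg : ∀ z, c * (1 + (dst 0 z : ℝ)) ^ (-a) ≤ g z) (hβa : 2 * (a * ratio N) ≤ β)
    (haτ : a * ratio N * (12 * N + 1 : ℕ) + 2 ≤ 1 / τ)
    (hdec : ∀ k, ∀ᶠ M : ℕ in atTop, ∀ F, Decays b N β (μ + 2) g M F (fineProb rate M) k)
    (x : Vertex d) :
    ∃ C : ℝ, ∀ (t : ℝ) (y : Vertex d) (s : ℝ), P.real {ω | ω.Connects (x, t) (y, s)} ≤
      C * Real.exp (-μ * max (l1 (y - x)) (|s - t| ^ τ)) := by
  set e : ℝ := 1 + (dst 0 x : ℝ) with he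
  have he1 : 1 ≤ e := by linarith [(Nat.cast_nonneg (dst 0 x) : (0 : ℝ) ≤ dst 0 x)]
  set c₁ := min 1 (c * e ^ (-a)) with hc₁
  have hc₁0 : 0 < c₁ := lt_min one_pos (by positivity)
  have hc₁1 : 1 ≤ c₁⁻¹ := (one_le_inv₀ hc₁0).2 (min_le_left _ _)
  have hb1 : (1 : ℝ) ≤ b := by exact_mod_cast (by omega : 1 ≤ b)
  set K : ℝ := (b : ℝ) ^ β * c₁⁻¹ ^ ratio N with hK
  have hK1 : 1 ≤ K := one_le_mul_of_one_le_of_one_le (one_le_pow₀ hb1) (one_le_pow₀ hc₁1)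
  set q := a * ratio N * (12 * N + 1 : ℕ) with hq
  obtain ⟨C₁, hC₁, hin⟩ := exists_inner_bound (12 * N + 1) (q := q) hK1 (by positivity) hμ hτ haτ
  obtain ⟨C₂, hC₂, hout⟩ := exists_exit_bound d (12 * N + 1) (q := q) (μ := μ)
    (zero_lt_one.trans_le hK1)
  refine ⟨C₁ + C₂ + Real.exp μ, fun t y s => ?_⟩
  have := h.isProbabilityMeasure
  rw [l1_sub_eq_dst]
  set ℓ := max (dst x y : ℝ) (|s - t| ^ τ) with hℓ
  have hexp := Real.exp_pos (-μ * ℓ)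
  rcases lt_or_ge ℓ 1 with hlt | hge
  · have e1 : (1 : ℝ) ≤ Real.exp μ * Real.exp (-μ * ℓ) := by
      rw [← Real.exp_add]
      exact Real.one_le_exp (by nlinarith)
    have e2 := mul_nonneg (add_nonneg hC₁ hC₂) hexp.le
    have e3 : P.real {ω | ω.Connects (x, t) (y, s)} ≤ 1 := measureReal_le_one
    rw [add_mul]
    linarith
  set L := ⌈ℓ⌉₊ with hL
  have hℓL : ℓ ≤ L := Nat.le_ceil ℓ
  have hLℓ : (L : ℝ) ≤ ℓ + 1 := (Nat.ceil_lt_add_one (by linarith)).le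
  set X : ℝ := 1 + L with hX
  have hX1 : 1 ≤ X := by linarith
  -- The value `D` is the inverse of the lower bound for `g` on the ball of radius `L` around `x`.
  -- Taking `c₁ ≤ 1` ensures `D ≥ 1`.
  obtain ⟨k, hk1, hk2⟩ := exists_level (b := b) (N := N) hb hβ (D := c₁⁻¹ * X ^ a)
    (one_le_mul_of_one_le_of_one_le hc₁1 (Real.one_le_rpow hX1 ha))
  have hk3 : (scale b N k : ℝ) ^ β ≤ K * X ^ (a * ratio N) := by
    refine hk2.trans (le_of_eq ?_)
    rw [mul_pow, hK, Real.rpow_mul (by linarith), Real.rpow_natCast]; ring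
  have hgood : ∀ z ∈ ballF x L, thr b N β k ≤ g z := by
    intro z hz
    have h1 : (dst 0 z : ℝ) ≤ dst 0 x + L := by
      have := (dst_triangle 0 x z).trans (Nat.add_le_add_left (mem_ballF.1 hz) _)
      exact_mod_cast this
    have h2 : 1 + (dst 0 z : ℝ) ≤ e * X := by nlinarith
    refine le_trans ?_ (hg z)
    calc thr b N β k ≤ (c₁⁻¹ * X ^ a)⁻¹ := inv_anti₀ (by positivity) hk1
      _ = c₁ * X ^ (-a) := by rw [mul_inv, inv_inv, Real.rpow_neg (by linarith)]
      _ ≤ c * e ^ (-a) * X ^ (-a) := by gcongr; exact min_le_right _ _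
      _ = c * (e * X) ^ (-a) := by rw [Real.mul_rpow (by linarith) (by linarith), mul_assoc]
      _ ≤ c * (1 + (dst 0 z : ℝ)) ^ (-a) := mul_le_mul_of_nonneg_left
          (Real.rpow_le_rpow_of_nonpos (by positivity) h2 (neg_nonpos.2 ha)) hc.le
  -- By `hβa` the scale grows at most like the square root of the radius, so the prefactor `exp
  -- (scale)` is negligible against exponential decay in `L`.
  have hS : (scale b N k : ℝ) ≤ K * √X := by
    refine (pow_le_pow_iff_left₀ (Nat.cast_nonneg _) (by positivity)
      (show β ≠ 0 by omega)).1 (hk3.trans ?_)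
    rw [mul_pow]
    refine mul_le_mul (le_self_pow₀ hK1 (by omega)) ?_ (by positivity) (by positivity)
    rw [Real.sqrt_eq_rpow, ← Real.rpow_natCast, ← Real.rpow_mul (by linarith)]
    exact Real.rpow_le_rpow_of_exponent_le hX1 (by linarith)
  have hT1 : (1 : ℝ) ≤ corrTime b N β k := by exact_mod_cast corrTime_pos (by omega) k
  have hT : (corrTime b N β k : ℝ) ≤ K ^ (12 * N + 1) * X ^ q := by
    rw [corrTime, Nat.cast_pow, pow_mul, hq, Real.rpow_mul (by linarith), Real.rpow_natCast,
      ← mul_pow]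
    exact pow_le_pow_left₀ (by positivity) hk3 _
  have hyL : dst x y ≤ L := by exact_mod_cast (le_max_left _ _).trans hℓL
  have hfloor : |s - t| - 1 ≤ |(⌊s⌋ : ℝ) - ⌊t⌋| := by
    have f1 := Int.floor_le s
    have f2 := Int.lt_floor_add_one s
    have f3 := Int.floor_le t
    have f4 := Int.lt_floor_add_one t
    have f5 := le_abs_self ((⌊s⌋ : ℝ) - ⌊t⌋)
    have f6 := neg_le_abs ((⌊s⌋ : ℝ) - ⌊t⌋)
    rcases abs_cases (s - t) with ⟨f7, -⟩ | ⟨f7, -⟩ <;> linarith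
  have hmain := h.real_connects_le hrate (by omega) hgood (hdec k) hyL t s
  have hin' := hin L _ _ _ _ _ ℓ hS hT1 hT (Nat.cast_nonneg (dst x y)) (abs_nonneg (s - t))
    (abs_nonneg _) hfloor hℓ hge hLℓ
  have hout' := hout L _ _ hS (by linarith) hT
  have e1 : Real.exp (-μ * L) ≤ Real.exp (-μ * ℓ) :=
    Real.exp_le_exp.2 (mul_le_mul_of_nonpos_left hℓL (by linarith))
  have e2 := mul_le_mul_of_nonneg_left e1 hC₂
  have e3 := mul_pos (Real.exp_pos μ) hexp
  rw [add_mul, add_mul]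
  linarith

end Choice

/-! ### The exponent and the theorem -/

lemma exponent_bound {R σ D Z τ : ℝ} (hR : 2 ≤ R) (hσ : 0 < σ) (hD : 0 ≤ D) (hτ : 0 < τ)
    (h : τ < 1 / 300 / (1 + R ^ 2 * σ * max D Z)) :
    2 * σ * D * (2 * (2 * R + 1)) * (12 * (2 * R) + 1) + 2 ≤ 1 / τ := by
  have h1 : D ≤ max D Z := le_max_left _ _
  have h0 : 0 ≤ max D Z := hD.trans h1
  have h2 : 0 ≤ R ^ 2 * σ * max D Z := by positivity
  have h3 : 300 * (1 + R ^ 2 * σ * max D Z) ≤ 1 / τ := by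
    rw [lt_div_iff₀ (by linarith)] at h
    rw [le_div_iff₀ hτ]
    linarith
  refine le_trans ?_ h3
  -- These are the factors `ratio N` and `12 * N + 1` for `N = 2 * R`. Together with the 2 in `2 * σ
  -- * D` they give 250 R², so 1/300 is small enough as the absolute constant.
  have h4 : (2 * (2 * R + 1)) * (12 * (2 * R) + 1) ≤ 125 * R ^ 2 := by nlinarith
  have h5 : σ * D ≤ σ * max D Z := mul_le_mul_of_nonneg_left h1 hσ.le
  have h6 : (σ * D) * ((2 * (2 * R + 1)) * (12 * (2 * R) + 1)) ≤
      (σ * max D Z) * (125 * R ^ 2) :=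
    mul_le_mul h5 h4 (by positivity) (by positivity)
  linarith

end QPPerc

end

theorem theorem1 :
    ∃ C : ℝ, 0 < C ∧
      ∀ (d : ℕ) (_ : 1 ≤ d) (E : QPPerc.Environment d) (ν ζ σ : ℝ)
        (_ : 0 < ν) (_ : 0 < ζ) (_ : 0 < σ) (_ : E.IsRegular ν ζ σ) (μ : ℝ) (_ : 0 < μ),
      ∃ κ₀ : ℝ, 0 < κ₀ ∧
        ∀ᵐ θ : E.Phase, ∀ κ : ℝ, 0 < κ → κ ≤ κ₀ →
          ∀ P : MeasureTheory.Measure (QPPerc.Config d),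
            QPPerc.IsPoissonLaw (E.rate κ θ) P →
          ∀ τ : ℝ, 0 < τ → τ < C / (1 + (E.numZeros : ℝ) ^ 2 * σ * max (d / ν) ζ) →
          ∀ x : QPPerc.Vertex d, ∃ Cx : ℝ, ∀ (t : ℝ) (y : QPPerc.Vertex d) (s : ℝ),
            P.real {ω | ω.Connects (x, t) (y, s)} <
              Cx * Real.exp (-μ * max (QPPerc.l1 (y - x)) (|s - t| ^ τ)) := by
  open QPPerc in
  refine ⟨1 / 300, by norm_num, fun d _ E ν ζ σ hν hζ hσ hE μ hμ => ?_⟩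
  have hR : 2 ≤ E.numZeros := le_max_left _ _
  set N := 2 * E.numZeros with hN
  set a := 2 * σ * (d / ν) with ha
  have ha0 : 0 ≤ a := by positivity
  obtain ⟨β, hβ⟩ := exists_nat_ge (max 1 (max (6 * (ζ * σ)) (2 * (a * ratio N))))
  have hβ1 : 1 ≤ β := by exact_mod_cast (le_max_left _ _).trans hβ
  have hβ2 : 6 * (ζ * σ) ≤ β := ((le_max_left _ _).trans (le_max_right _ _)).trans hβ
  have hβ3 : 2 * (a * ratio N) ≤ β := ((le_max_right _ _).trans (le_max_right _ _)).trans hβ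
  -- The basic scale, and with it `κ₀`, is fixed before the phase: separation holds for all phases
  -- at once. The rate `μ + 2` leaves two units to spare for prefactors.
  obtain ⟨b, hL, hsep⟩ := ((eventually_isLarge d N hβ1 (μ + 2)).and
    (hE.eventually_isSeparated hζ hσ hβ1 hβ2)).exists
  have hb2 : 2 ≤ b := by linarith [hL.seven_le]
  have hb0 : 0 < b := by omega
  obtain ⟨κ₀, hκ₀, hκ⟩ := exists_kappa (η := thr b N β 0) (w := waitTime b N β 0)
    (K := ((5 * 3 ^ d : ℕ) : ℝ) * Real.exp (μ + 2 + 1 + 2)) (thr_pos hb0 0)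
    (by exact_mod_cast waitTime_pos hb0 0) (by positivity) d
  refine ⟨κ₀, hκ₀, ?_⟩
  filter_upwards [hE.ae_exists_le_quality hν hσ] with θ hθ
  obtain ⟨c, hc, hg⟩ := hθ
  intro κ hκ0 hκle P hP τ hτ hτ' x
  obtain ⟨hκ1, hκη, hκs⟩ := hκ κ hκ0 hκle
  have hpos : ∀ z, 0 < E.quality θ z := fun z => lt_of_lt_of_le (by positivity) (hg z)
  have hdec : ∀ k, ∀ᶠ M : ℕ in atTop, ∀ F, Decays b N β (μ + 2) (E.quality θ) M F
      (fineProb (E.rate κ θ) M) k := by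
    intro k
    have ht := thr_pos (N := N) (β := β) hb0 k
    -- The mesh has to resolve the death windows, whose length is at least the threshold of level
    -- `k`; finer levels need a larger `M`, but the bounds do not depend on it.
    filter_upwards [eventually_gt_atTop 0, eventually_ge_atTop ⌈1 / thr b N β k⌉₊] with M hM0 hM F
    refine hL.decays (by linarith) (by omega) hβ1 hM0 (hE.isModel hκ0 M hpos) hκ0 hκ1 hκη ?_
      (hsep θ) k ?_
    · refine le_trans (le_of_eq ?_) hκs
      ring
    · rw [← div_le_iff₀ ht]
      exact Nat.ceil_le.1 hM
  have hexp := exponent_bound (R := E.numZeros) (σ := σ) (D := d / ν) (Z := ζ) (τ := τ)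
    (by exact_mod_cast hR) hσ (by positivity) hτ hτ'
  obtain ⟨C, hC⟩ := hP.exists_real_connects_le (hE.rate_nonneg hκ0) hb2 hβ1 hμ.le hτ ha0 hc hg hβ3
    (by rw [hN, ratio, ha]; push_cast; exact hexp) hdec x
  -- The added 1 makes the inequality strict.
  refine ⟨C + 1, fun t y s => (hC t y s).trans_lt ?_⟩
  exact mul_lt_mul_of_pos_right (lt_add_one C) (Real.exp_pos _)
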